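/- Let $a$ be the unilateral shift on the complex Hilbert space $\ell^2(\mathbb N)$: $a e_0=0$, $a e_{m+1}=e_m$. A bounded operator $F$ is Fredholm if there is a bounded $B$ with $1-FB$ and $1-BF$ compact; its index is $\dim\ker F-\dim\ker F^\dagger$. Fix $n\ge 0$, and identify the space $V_{\mathbb C}$ (resp. $V_{\mathbb R}$) of complex (resp. real) linear combinations $c_na^n+\dots+c_1a+c_0$ with the space $\mathbb C^{n+1}$ (resp. $\mathbb R^{n+1}$) of their coefficients. For $V=V_{\mathbb C}$ or $V=V_{\mathbb R}$ and $i\in\mathbb Z$ let $U_i\subset V$ be the set of Fredholm operators of index $i$ in $V$, and for $k\ge1$ let $$J_k=\bigcup_{i\in\mathbb Z}\partial U_i\cap\partial U_{i+k}$$ be the set of points where the index can jump by $k$ (boundaries are taken in $V$). By a stratification of $S\subset V$ we mean a partition of $S$ into finitely many nonempty embedded $C^\infty$ submanifolds of $V$ (the strata), each of a fixed codimension, such that a stratum meeting the closure of another one is contained in that closure and has larger codimension. We say that $S$ has (pure) real codimension $c$ if $S$ is nonempty and has a stratification all of whose strata have real codimension at least $c$ and in which the union of the strata of real codimension exactly $c$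 is dense in $S$. 1. (Complex coefficients.) Almost every operator in $V_{\mathbb C}$ (with respect to Lebesgue measure) is Fredholm. For every $1\le k\le n$, the set $J_k\subset V_{\mathbb C}$ has real codimension $k$, and so has each common boundary $\partial U_i\cap\partial U_{i+k}$ with $0\le i\le n-k$. 2. (Real coefficients.) Almost every operator in $V_{\mathbb R}$ is Fredholm. For every $1\le k\le n$, the set $J_k\subset V_{\mathbb R}$ has a stratification whose largest stratum has real codimension $\lfloor (k+1)/2\rfloor$ (that is, all strata have at least this codimension and it is attained), and so has each common boundary $\partial U_i\cap\partial U_{i+k}$ with $0\le i\le n-k$. -/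

import Mathlib

open scoped lp ContDiff

noncomputable section

namespace ShiftPhase

/-! ### The shift operator and its polynomials -/

lemma shift_bound (x : ℓ²(ℕ, ℂ)) (s : Finset ℕ) :
    ∑ m ∈ s, ‖x (m + 1)‖ ^ (2 : ENNReal).toReal ≤ ‖x‖ ^ (2 : ENNReal).toReal := by
  have h := lp.sum_rpow_le_norm_rpow (p := 2) (by norm_num) x (s.map ⟨Nat.succ, Nat.succ_injective⟩)
  simpa using h

/-- The unilateral shift `a` on the complex Hilbert space `ℓ²(ℕ)`: `(a x)ₘ = xₘ₊₁`. -/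
def shift : ℓ²(ℕ, ℂ) →L[ℂ] ℓ²(ℕ, ℂ) :=
  LinearMap.mkContinuous
    { toFun := fun x => ⟨fun m => x (m + 1), memℓp_gen' (shift_bound x)⟩
      map_add' := fun _ _ => rfl
      map_smul' := fun _ _ => rfl } 1
    (fun x => by
      rw [one_mul]
      exact lp.norm_le_of_forall_sum_le (by norm_num) (norm_nonneg _) (shift_bound x))

@[simp] lemma shift_apply (x : ℓ²(ℕ, ℂ)) (m : ℕ) : shift x m = x (m + 1) := rfl

/-- `a e₀ = 0` -/
lemma shift_single_zero (z : ℂ) : shift (lp.single 2 0 z) = 0 := by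
  ext m; simp [lp.single_apply]

/-- `a eₘ₊₁ = eₘ` -/
lemma shift_single_succ (m : ℕ) (z : ℂ) :
    shift (lp.single 2 (m + 1) z) = lp.single 2 m z := by
  ext j
  by_cases h : j = m <;> simp [lp.single_apply, h]

/-- The operator `cₙ aⁿ + ⋯ + c₁ a + c₀` with coefficient vector `c`. -/
def shiftPoly {n : ℕ} (c : Fin (n + 1) → ℂ) : ℓ²(ℕ, ℂ) →L[ℂ] ℓ²(ℕ, ℂ) :=
  ∑ j, c j • shift ^ (j : ℕ)

lemma shift_pow_apply (j : ℕ) (x : ℓ²(ℕ, ℂ)) (m : ℕ) : (shift ^ j) x m = x (m + j) := by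
  induction j generalizing x with
  | zero => simp
  | succ j ih => rw [pow_succ, mul_apply_eq_comp, ih, shift_apply]; congr 1

/-- The operators `1, a, …, aⁿ` are linearly independent, so that the (finite-dimensional) space
of their linear combinations is identified with the space of coefficient vectors. -/
lemma shiftPoly_injective (n : ℕ) :
    Function.Injective (shiftPoly : (Fin (n + 1) → ℂ) → (ℓ²(ℕ, ℂ) →L[ℂ] ℓ²(ℕ, ℂ))) := by
  have key : ∀ (c : Fin (n + 1) → ℂ) (i : Fin (n + 1)),
      shiftPoly c (lp.single 2 (i : ℕ) (1 : ℂ)) 0 = c i := by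
    intro c i
    simp only [shiftPoly, sum_apply, smul_apply,
      lp.coeFn_sum, Finset.sum_apply, lp.coeFn_smul, Pi.smul_apply, shift_pow_apply]
    rw [Finset.sum_eq_single i]
    · simp
    · intro j _ hj
      have : (j : ℕ) ≠ i := fun h => hj (Fin.ext h)
      simp [this]
    · simp
  intro c d h
  funext i
  rw [← key c i, ← key d i, h]

/-! ### Fredholm operators and their index -/

section Fredholm

variable {H : Type*} [NormedAddCommGroup H] [InnerProductSpace ℂ H] [CompleteSpace H]

/-- `F` is Fredholm: it is invertible modulo compact operators. -/
def IsFredholmOp (F : H →L[ℂ] H) : Prop :=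
  ∃ B : H →L[ℂ] H, IsCompactOperator (1 - F * B : H →L[ℂ] H) ∧
    IsCompactOperator (1 - B * F : H →L[ℂ] H)

/-- The index `dim ker F - dim ker F†` (meaningful for Fredholm `F`). -/
def fredholmIndex (F : H →L[ℂ] H) : ℤ :=
  (Module.finrank ℂ F.ker : ℤ) - Module.finrank ℂ (ContinuousLinearMap.adjoint F).ker

end Fredholm

/-- The region of Fredholm operators of index `i`, in the space of complex combinations
of `1, a, …, aⁿ`. -/
def complexPhase (n : ℕ) (i : ℤ) : Set (Fin (n + 1) → ℂ) :=
  {c | IsFredholmOp (shiftPoly c) ∧ fredholmIndex (shiftPoly c) = i}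

/-- The region of Fredholm operators of index `i`, in the space of real combinations
of `1, a, …, aⁿ`. -/
def realPhase (n : ℕ) (i : ℤ) : Set (Fin (n + 1) → ℝ) :=
  {c | IsFredholmOp (shiftPoly fun j => (c j : ℂ)) ∧
    fredholmIndex (shiftPoly fun j => (c j : ℂ)) = i}

/-- For regions `U i` labelled by an index `i`, the points where the index can jump by `k`: those
on a common boundary of two regions whose indices differ by `k`. -/
def jumpLocus {X : Type*} [TopologicalSpace X] (U : ℤ → Set X) (k : ℕ) : Set X :=
  ⋃ i : ℤ, frontier (U i) ∩ frontier (U (i + k))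

/-! ### Submanifolds, stratifications, codimension -/

section Strata

variable {E : Type*} [NormedAddCommGroup E] [NormedSpace ℝ E]

/-- `M` is an embedded `C^∞` submanifold (without boundary) of codimension `d` of the
finite-dimensional real space `E`: near each of its points a smooth change of coordinates
turns `M` into a linear subspace `W` of codimension `d`. -/
def IsSubmanifold (M : Set E) (d : ℕ) : Prop :=
  ∀ x ∈ M, ∃ (φ : OpenPartialHomeomorph E E) (W : Submodule ℝ E),
    x ∈ φ.source ∧ ContDiffOn ℝ ∞ φ φ.source ∧ ContDiffOn ℝ ∞ φ.symm φ.target ∧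
    Module.finrank ℝ W + d = Module.finrank ℝ E ∧
    ∀ y ∈ φ.source, y ∈ M ↔ φ y ∈ W

/-- The sets `T i` are the strata, of codimensions `d i`, of a stratification of `S`: they are
nonempty submanifolds that partition `S`, and a stratum that meets the closure of
another one is contained in it and has larger codimension. -/
structure IsStratification {ι : Type} (S : Set E) (T : ι → Set E) (d : ι → ℕ) : Prop where
  nonempty : ∀ i, (T i).Nonempty
  submanifold : ∀ i, IsSubmanifold (T i) (d i)
  disjoint : ∀ i j, i ≠ j → Disjoint (T i) (T j)
  iUnion_eq : ⋃ i, T i = S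
  frontier_condition : ∀ i j, i ≠ j → (T i ∩ closure (T j)).Nonempty →
    T i ⊆ closure (T j) ∧ d j < d i

/-- `S` is a stratified space (with finitely many strata), the largest stratum of which has
real codimension `c`. -/
def IsStratifiedWithLargestCodim (S : Set E) (c : ℕ) : Prop :=
  ∃ (ι : Type) (_ : Finite ι) (T : ι → Set E) (d : ι → ℕ), IsStratification S T d ∧
    (∀ i, c ≤ d i) ∧ ∃ i, d i = c

/-- `S` is a set of (pure) real codimension `c`: it is nonempty and has a finite stratification
by strata of codimension at least `c`, in which those of codimension `c` are dense. -/
def HasRealCodim (S : Set E) (c : ℕ) : Prop :=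
  S.Nonempty ∧
  ∃ (ι : Type) (_ : Finite ι) (T : ι → Set E) (d : ι → ℕ), IsStratification S T d ∧
    (∀ i, c ≤ d i) ∧ S ⊆ closure (⋃ i ∈ {i | d i = c}, T i)

end Strata

end ShiftPhase

end

/-!
The operator `p(a)` attached to a polynomial `p` is a product of factors `a - λ`. If `|λ| < 1` such
a factor is right invertible with a one-dimensional kernel, if `|λ| > 1` it is invertible, and if
`|λ| = 1` the vectors `(1, ζ, ζ², …)` with `ζ → λ`, once normalized, show that it cannot occur in a
Fredholm operator. Hence `p(a)` is Fredholm if and only if `p` has no root on the unit circle, and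
its index is then the number of roots of `p` in the open unit disk (`isFredholmOp_aeval_shift_iff`,
`isFredholmOp_aeval_shift`). Polynomials with a circle root form a null set by Fubini, because only
finitely many of the dilations `p(sX)` of a given `p ≠ 0` have one (`ae_forall_aeval_ne_zero`).

Polynomials of formal degree `n` are stratified by their *type* (`typeOf`): the number `r` of roots
in the open disk and the multiset of the multiplicities of the circle roots. Over `ℝ`, where complex
conjugation acts on the roots, a circle root stands for its orbit and the type records in addition
whether the root is `1`, `-1` or one of a pair of conjugate roots; this is the *kind* of the root.
The common features of the two cases are collected in the classes `CircleModel` and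
`MovingCircleModel`, so that most of the proof treats both at once. Multiplication of pairwise
coprime polynomials is a local diffeomorphism (`exists_mulChart`). Therefore, near a given
polynomial, the space is a product of neighbourhoods of powers of irreducible polynomials, one for
each circle root, and of a factor along which the type does not change (`exists_localStructure`). In
this product a stratum is a product of curves `{q ^ μ}`, with `q` running over the minimal
polynomials of the points of the circle, of isolated points (for the roots `±1` over `ℝ`) and of an
open set. So it is a submanifold (`isSubmanifold_stratum`), whose codimension is the sum of `2μ - 1`
over the circle roots that can move and of `μ` over those that cannot (`typeCodim`). Any two powers
`q ^ μ` of the same kind have neighbourhoods that correspond to each other under a rotation (over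
`ℂ`) or a Möbius transformation of the disk (over `ℝ`), and these preserve types. Thus the closure
of a stratum is a union of strata (`mem_closure_stratum_of_typeOf_eq`), and the codimension goes up
on its boundary (`typeCodim_lt_of_mem_closure`). The zero polynomial is a stratum of its own.

The Fredholm operators of index `i` are the stratum of the polynomials with `i` roots in the disk
and none on the circle. The common boundary of the regions `i` and `i + k` is a union of strata.
Apart from `0` its members satisfy `r ≤ i` and `i + k ≤ r + m`, with `m` the number of circle roots,
so that they have at least `k` circle roots (`bounds_of_mem_commonBoundary`); hence the codimension
is at least `k` over `ℂ`, and at least `⌊(k + 1) / 2⌋` over `ℝ`, where a conjugate pair of roots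
costs only one dimension (`le_indexCodim_of_mem_commonBoundary`). Conversely, polynomials with `i`
roots in the disk and exactly `k` circle roots do lie on that boundary, as these roots can be pushed
inwards or outwards (`mem_frontier_of_circleCount`). If their circle roots are simple, and over `ℝ`
consist of conjugate pairs and at most one real root, the codimension bound is attained. Over `ℂ`
such polynomials are moreover dense: push some circle roots of a given polynomial inwards, some
outwards, and rotate `k` of them with different speeds (`mem_closure_stratum_simple`).
-/

noncomputable section

namespace ShiftPhase

open Polynomial Filter Topology

/-! ### Polynomials and their coefficient vectors -/

section CoeffVectors

variable {K : Type} [Field K]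

/-- The polynomial of degree `< m` with coefficient vector `v`. -/
def polyOf {m : ℕ} (v : Fin m → K) : K[X] := ∑ i, C (v i) * X ^ (i : ℕ)

/-- The monic polynomial of degree `m` with lower coefficients `u`. -/
def monicOf {m : ℕ} (u : Fin m → K) : K[X] := X ^ m + polyOf u

/-- The first `m` coefficients of a polynomial. -/
def coeffVec (m : ℕ) (p : K[X]) : Fin m → K := fun i => p.coeff i

lemma coeff_polyOf {m : ℕ} (v : Fin m → K) (k : ℕ) :
    (polyOf v).coeff k = if h : k < m then v ⟨k, h⟩ else 0 := by
  simp only [polyOf, finsetSum_coeff, coeff_C_mul, coeff_X_pow]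
  split_ifs with h
  · rw [Finset.sum_eq_single ⟨k, h⟩]
    · simp
    · intro j _ hj
      have : k ≠ j := fun e => hj (Fin.ext e.symm)
      simp [this]
    · simp
  · refine Finset.sum_eq_zero fun j _ => ?_
    have : k ≠ j := fun e => h (e ▸ j.2)
    simp [this]

lemma degree_polyOf_lt {m : ℕ} (v : Fin m → K) : (polyOf v).degree < m := by
  rw [degree_lt_iff_coeff_zero]
  intro k hk
  rw [coeff_polyOf, dif_neg (by omega)]

lemma natDegree_polyOf_le {n : ℕ} (v : Fin (n + 1) → K) : (polyOf v).natDegree ≤ n := by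
  rw [natDegree_le_iff_coeff_eq_zero]
  intro k hk
  rw [coeff_polyOf, dif_neg (by omega)]

@[simp] lemma coeffVec_polyOf {m : ℕ} (v : Fin m → K) : coeffVec m (polyOf v) = v := by
  ext i
  simp [coeffVec, coeff_polyOf]

lemma polyOf_coeffVec {m : ℕ} {p : K[X]} (h : p.degree < m) : polyOf (coeffVec m p) = p := by
  ext k
  rw [coeff_polyOf]
  split_ifs with hk
  · rfl
  · exact ((degree_lt_iff_coeff_zero _ _).1 h k (by omega)).symm

lemma polyOf_coeffVec_succ {n : ℕ} {p : K[X]} (h : p.natDegree ≤ n) :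
    polyOf (coeffVec (n + 1) p) = p := by
  apply polyOf_coeffVec
  exact lt_of_le_of_lt (natDegree_le_iff_degree_le.1 h) (by exact_mod_cast Nat.lt_succ_self n)

lemma polyOf_eq_zero {m : ℕ} {v : Fin m → K} : polyOf v = 0 ↔ v = 0 := by
  constructor
  · intro h
    rw [← coeffVec_polyOf v, h]; rfl
  · rintro rfl
    simp [polyOf]

lemma polyOf_add {m : ℕ} (v w : Fin m → K) : polyOf (v + w) = polyOf v + polyOf w := by
  simp [polyOf, add_mul, Finset.sum_add_distrib]

lemma polyOf_smul {m : ℕ} (t : K) (v : Fin m → K) : polyOf (t • v) = C t * polyOf v := by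
  simp [polyOf, Finset.mul_sum, mul_assoc]

lemma monic_monicOf {m : ℕ} (u : Fin m → K) : (monicOf u).Monic :=
  monic_X_pow_add (degree_polyOf_lt u)

lemma natDegree_monicOf {m : ℕ} (u : Fin m → K) : (monicOf u).natDegree = m := by
  rw [monicOf, natDegree_add_eq_left_of_degree_lt, natDegree_X_pow]
  rw [degree_X_pow]
  exact degree_polyOf_lt u

lemma coeff_monicOf {m : ℕ} (u : Fin m → K) (k : ℕ) :
    (monicOf u).coeff k = if h : k < m then u ⟨k, h⟩ else if k = m then 1 else 0 := by
  rw [monicOf, coeff_add, coeff_polyOf, coeff_X_pow]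
  split_ifs <;> first | omega | simp

@[simp] lemma coeffVec_monicOf {m : ℕ} (u : Fin m → K) : coeffVec m (monicOf u) = u := by
  ext i
  simp [coeffVec, coeff_monicOf]

lemma monicOf_coeffVec {m : ℕ} {p : K[X]} (hp : p.Monic) (h : p.natDegree = m) :
    monicOf (coeffVec m p) = p := by
  ext k
  rw [coeff_monicOf]
  split_ifs with h1 h2
  · rfl
  · rw [h2, ← h]; exact hp.symm
  · exact (coeff_eq_zero_of_natDegree_lt (by omega)).symm

lemma monicOf_injective {m : ℕ} : Function.Injective (monicOf : (Fin m → K) → K[X]) := by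
  intro u v h
  rw [← coeffVec_monicOf u, h, coeffVec_monicOf]

lemma map_polyOf {L : Type} [Field L] (f : K →+* L) {m : ℕ} (v : Fin m → K) :
    (polyOf v).map f = polyOf (fun i => f (v i)) := by
  simp [polyOf, Polynomial.map_sum]

end CoeffVectors

/-! ### Smooth and continuous families of polynomials -/

section Families

variable {K : Type} [RCLike K]

/-- A family of polynomials all of whose coefficients depend smoothly on the parameter. -/
def SmoothPoly {X : Type} [NormedAddCommGroup X] [NormedSpace ℝ X] (f : X → K[X]) : Prop :=
  ∀ k, ContDiff ℝ ∞ fun x => (f x).coeff k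

namespace SmoothPoly

variable {X : Type} [NormedAddCommGroup X] [NormedSpace ℝ X] {f g : X → K[X]}

lemma mul (hf : SmoothPoly f) (hg : SmoothPoly g) : SmoothPoly fun x => f x * g x := by
  intro k
  simp only [coeff_mul]
  exact ContDiff.sum fun i _ => (hf _).mul (hg _)

lemma const (p : K[X]) : SmoothPoly fun _ : X => p := fun _ => contDiff_const

lemma pow (hf : SmoothPoly f) (k : ℕ) : SmoothPoly fun x => f x ^ k := by
  induction k with
  | zero => simpa using const 1
  | succ k ih => simpa only [pow_succ] using ih.mul hf

lemma X_sub_C {v : X → K} (hv : ContDiff ℝ ∞ v) :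
    SmoothPoly fun x => (Polynomial.X - C (v x) : K[X]) := by
  intro k
  simp only [coeff_sub, coeff_C]
  refine contDiff_const.sub ?_
  split_ifs
  · exact hv
  · exact contDiff_const

lemma prod {ι : Type} (s : Finset ι) {f : ι → X → K[X]} (hf : ∀ i, SmoothPoly (f i)) :
    SmoothPoly fun x => ∏ i ∈ s, f i x := by
  classical
  induction s using Finset.induction_on with
  | empty => simpa using const 1
  | insert i s hi ih => simpa [Finset.prod_insert hi] using (hf i).mul ih

lemma coeffVec (hf : SmoothPoly f) (m : ℕ) : ContDiff ℝ ∞ fun x => coeffVec m (f x) :=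
  contDiff_pi.2 fun i => hf i

lemma polyOf {m : ℕ} {v : X → Fin m → K} (hv : ContDiff ℝ ∞ v) :
    SmoothPoly fun x => polyOf (v x) := by
  intro k
  simp only [coeff_polyOf]
  split_ifs with h
  · exact contDiff_pi.1 hv _
  · exact contDiff_const

lemma monicOf {m : ℕ} {v : X → Fin m → K} (hv : ContDiff ℝ ∞ v) :
    SmoothPoly fun x => monicOf (v x) := by
  intro k
  simp only [coeff_monicOf]
  split_ifs with h
  · exact contDiff_pi.1 hv _
  all_goals exact contDiff_const

end SmoothPoly

end Families

/-! ### The multiplication chart -/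

/-- The inverse function theorem for a globally smooth map, as a chart that is smooth in both
directions. -/
lemma exists_smooth_chart {F E : Type} [NormedAddCommGroup F] [NormedSpace ℝ F]
    [FiniteDimensional ℝ F] [NormedAddCommGroup E] [NormedSpace ℝ E] [FiniteDimensional ℝ E]
    (f : F → E) (hf : ContDiff ℝ ∞ f) (x₀ : F) (hinj : Function.Injective (fderiv ℝ f x₀))
    (hdim : Module.finrank ℝ F = Module.finrank ℝ E) :
    ∃ φ : OpenPartialHomeomorph F E, x₀ ∈ φ.source ∧ (φ : F → E) = f ∧
      ContDiffOn ℝ ∞ φ.symm φ.target := by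
  have : CompleteSpace F := FiniteDimensional.complete ℝ F
  have : CompleteSpace E := FiniteDimensional.complete ℝ E
  have equiv_of_inj : ∀ A : F →L[ℝ] E, Function.Injective A →
      ∃ B : F ≃L[ℝ] E, (B : F →L[ℝ] E) = A := by
    intro A hA
    refine ⟨(LinearEquiv.ofInjectiveOfFinrankEq A.toLinearMap hA hdim).toContinuousLinearEquiv, ?_⟩
    ext x; rfl
  obtain ⟨B₀, hB₀⟩ := equiv_of_inj _ hinj
  have hd : ∀ x, HasFDerivAt f (fderiv ℝ f x) x := fun x =>
    (hf.differentiable (by simp)).differentiableAt.hasFDerivAt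
  have h0 : HasFDerivAt f (B₀ : F →L[ℝ] E) x₀ := hB₀ ▸ hd x₀
  let φ₁ := (hf.contDiffAt (x := x₀)).toOpenPartialHomeomorph f h0 (by simp)
  have hcont : Continuous (fderiv ℝ f) := hf.continuous_fderiv (by simp)
  have hopen : IsOpen {x | ∃ B : F ≃L[ℝ] E, (B : F →L[ℝ] E) = fderiv ℝ f x} :=
    (ContinuousLinearEquiv.isOpen (𝕜 := ℝ) (E := F) (F := E)).preimage hcont
  refine ⟨φ₁.restrOpen _ hopen, ?_, ?_, ?_⟩
  · rw [OpenPartialHomeomorph.restrOpen_source]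
    exact ⟨(hf.contDiffAt (x := x₀)).mem_toOpenPartialHomeomorph_source h0 (by simp), B₀, hB₀⟩
  · rfl
  · intro y hy
    apply ContDiffAt.contDiffWithinAt
    have hs := (φ₁.restrOpen _ hopen).map_target hy
    rw [OpenPartialHomeomorph.restrOpen_source] at hs
    obtain ⟨-, B, hB⟩ := hs
    exact (φ₁.restrOpen _ hopen).contDiffAt_symm hy (f₀' := B) (by rw [hB]; exact hd _)
      hf.contDiffAt

section MulChart

variable {K : Type} [RCLike K] {J : Type} [Fintype J]

/-- The product of the monic polynomials with lower coefficients `w.1 j` and the polynomial with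
coefficients `w.2`. -/
def mulPoly {m : J → ℕ} {N : ℕ} (w : (∀ j, Fin (m j) → K) × (Fin (N + 1) → K)) : K[X] :=
  (∏ j, monicOf (w.1 j)) * polyOf w.2

lemma natDegree_mulPoly_le {m : J → ℕ} {N n : ℕ} (hn : ∑ j, m j + N = n)
    (w : (∀ j, Fin (m j) → K) × (Fin (N + 1) → K)) : (mulPoly w).natDegree ≤ n := by
  refine natDegree_mul_le.trans ?_
  rw [natDegree_prod_of_monic _ _ fun j _ => monic_monicOf (w.1 j)]
  simp only [natDegree_monicOf]
  have := natDegree_polyOf_le w.2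
  omega

lemma finrank_mulSpace {m : J → ℕ} {N n : ℕ} (hn : ∑ j, m j + N = n) :
    Module.finrank ℝ ((∀ j, Fin (m j) → K) × (Fin (N + 1) → K)) =
      Module.finrank ℝ (Fin (n + 1) → K) := by
  have hfr : ∀ k : ℕ, Module.finrank ℝ (Fin k → K) = k * Module.finrank ℝ K := by
    intro k; simp [Module.finrank_pi_fintype]
  rw [Module.finrank_prod, Module.finrank_pi_fintype, hfr, hfr]
  simp only [hfr]
  rw [← Finset.sum_mul, ← add_mul, ← hn, add_assoc]

lemma smoothPoly_mulPoly {m : J → ℕ} {N : ℕ} :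
    SmoothPoly fun w : (∀ j, Fin (m j) → K) × (Fin (N + 1) → K) => mulPoly w := by
  apply SmoothPoly.mul
  · exact SmoothPoly.prod _ fun j => SmoothPoly.monicOf (contDiff_pi.1 contDiff_fst j)
  · exact SmoothPoly.polyOf contDiff_snd

lemma isRoot_sum_mul_prod {m : J → ℕ} {P : J → K[X]} (hP : ∀ j, (P j).natDegree = m j)
    (hPm : ∀ j, (P j).Monic) {R : K[X]} (hcop : Pairwise (Function.onFun IsCoprime P))
    (hR : ∀ j, IsCoprime (P j) R) [DecidableEq J] (Q : J → K[X]) (hQ : ∀ j, (Q j).degree < m j)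
    (S : K[X])
    (h : (∑ j, (∏ l ∈ Finset.univ.erase j, P l) * Q j) * R + (∏ j, P j) * S = 0) :
    (∀ j, Q j = 0) ∧ S = 0 := by
  have hQ0 : ∀ j, Q j = 0 := by
    intro j
    have hdvd : P j ∣ ((∏ l ∈ Finset.univ.erase j, P l) * Q j) * R := by
      have h1 : ((∏ l ∈ Finset.univ.erase j, P l) * Q j) * R =
          -((∑ i ∈ Finset.univ.erase j, (∏ l ∈ Finset.univ.erase i, P l) * Q i) * R
            + (∏ j, P j) * S) := by
        rw [← Finset.add_sum_erase _ _ (Finset.mem_univ j)] at h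
        linear_combination h
      rw [h1, dvd_neg]
      apply dvd_add
      · apply Dvd.dvd.mul_right
        refine Finset.dvd_sum fun i hi => Dvd.dvd.mul_right ?_ _
        apply Finset.dvd_prod_of_mem
        simp only [Finset.mem_erase, Finset.mem_univ, and_true] at hi ⊢
        exact fun e => hi e.symm
      · exact (Finset.dvd_prod_of_mem _ (Finset.mem_univ j)).mul_right _
    have h2 : P j ∣ (∏ l ∈ Finset.univ.erase j, P l) * Q j := (hR j).dvd_of_dvd_mul_right hdvd
    have h3 : IsCoprime (P j) (∏ l ∈ Finset.univ.erase j, P l) :=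
      IsCoprime.prod_right fun i hi => hcop (fun e => (Finset.mem_erase.1 hi).1 e.symm)
    have h4 : P j ∣ Q j := h3.dvd_of_dvd_mul_left h2
    refine eq_zero_of_dvd_of_degree_lt h4 ?_
    rw [degree_eq_natDegree (hPm j).ne_zero, hP j]
    exact hQ j
  refine ⟨hQ0, ?_⟩
  simp only [hQ0, mul_zero, Finset.sum_const_zero, zero_mul, zero_add] at h
  exact (mul_eq_zero.1 h).resolve_left (monic_prod_of_monic _ _ fun j _ => hPm j).ne_zero

/-- Multiplication of polynomials is a local diffeomorphism at a tuple of pairwise coprime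
polynomials (all but one of them monic). -/
theorem exists_mulChart {m : J → ℕ} {N n : ℕ} (hn : ∑ j, m j + N = n)
    (w₀ : (∀ j, Fin (m j) → K) × (Fin (N + 1) → K))
    (hcop : Pairwise (Function.onFun IsCoprime fun j => monicOf (w₀.1 j)))
    (hR : ∀ j, IsCoprime (monicOf (w₀.1 j)) (polyOf w₀.2)) :
    ∃ φ : OpenPartialHomeomorph ((∀ j, Fin (m j) → K) × (Fin (N + 1) → K)) (Fin (n + 1) → K),
      w₀ ∈ φ.source ∧ (∀ w, φ w = coeffVec (n + 1) (mulPoly w)) ∧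
      ContDiffOn ℝ ∞ φ φ.source ∧ ContDiffOn ℝ ∞ φ.symm φ.target := by
  classical
  have hsm : ContDiff ℝ ∞ fun w : (∀ j, Fin (m j) → K) × (Fin (N + 1) → K) =>
    coeffVec (n + 1) (mulPoly w) := smoothPoly_mulPoly.coeffVec _
  have hinj : Function.Injective (fderiv ℝ (fun w : (∀ j, Fin (m j) → K) × (Fin (N + 1) → K) =>
      coeffVec (n + 1) (mulPoly w)) w₀) := by
    rw [injective_iff_map_eq_zero]
    intro h hh
    set f := fun w : (∀ j, Fin (m j) → K) × (Fin (N + 1) → K) => coeffVec (n + 1) (mulPoly w)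
    -- the derivative along `h`, evaluated at every point of `K`, is given by the product rule
    have key : ∀ x : K, (∑ j, (∏ l ∈ Finset.univ.erase j, (monicOf (w₀.1 l)).eval x) *
        (polyOf (h.1 j)).eval x) * (polyOf w₀.2).eval x +
          (∏ j, (monicOf (w₀.1 j)).eval x) * (polyOf h.2).eval x = 0 := by
      intro x
      have hd : HasFDerivAt f (fderiv ℝ f w₀) w₀ :=
        (hsm.differentiable (by simp)).differentiableAt.hasFDerivAt
      have hline : HasDerivAt (fun t : ℝ => w₀ + t • h) h 0 := by
        simpa using ((hasDerivAt_id (0 : ℝ)).smul_const h).const_add w₀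
      have h1 : HasDerivAt (fun t : ℝ => f (w₀ + t • h)) 0 0 := by
        have := HasFDerivAt.comp_hasDerivAt (x := (0 : ℝ)) (f := fun t : ℝ => w₀ + t • h)
          (l := f) (l' := fderiv ℝ f w₀) (by simpa using hd) hline
        rw [hh] at this
        exact this
      have h2 : HasDerivAt (fun t : ℝ => (mulPoly (w₀ + t • h)).eval x) 0 0 := by
        have : (fun t : ℝ => (mulPoly (w₀ + t • h)).eval x) =
            fun t : ℝ => ∑ i : Fin (n + 1), f (w₀ + t • h) i * x ^ (i : ℕ) := by
          funext t
          rw [← polyOf_coeffVec_succ (natDegree_mulPoly_le hn (w₀ + t • h)), polyOf,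
            eval_finsetSum]
          simp [f]
        rw [this]
        have hs := HasDerivAt.fun_sum (u := Finset.univ)
          (A := fun (i : Fin (n + 1)) (t : ℝ) => f (w₀ + t • h) i * x ^ (i : ℕ)) (A' := fun _ => 0)
          (x := (0 : ℝ)) fun i _ => by
            have := ((hasDerivAt_pi.1 h1) i).mul_const (x ^ (i : ℕ))
            simpa using this
        simpa using hs
      have h3 : ∀ j, HasDerivAt (fun t : ℝ => (monicOf (w₀.1 j + t • h.1 j)).eval x)
          ((polyOf (h.1 j)).eval x) 0 := by
        intro j
        have : (fun t : ℝ => (monicOf (w₀.1 j + t • h.1 j)).eval x) =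
            fun t : ℝ => (monicOf (w₀.1 j)).eval x + t • (polyOf (h.1 j)).eval x := by
          funext t
          rw [RCLike.real_smul_eq_coe_smul (K := K) t (h.1 j), monicOf, polyOf_add, polyOf_smul]
          simp [monicOf, RCLike.real_smul_eq_coe_mul, add_assoc]
        rw [this]
        simpa using ((hasDerivAt_id (0 : ℝ)).smul_const _).const_add ((monicOf (w₀.1 j)).eval x)
      have h4 : HasDerivAt (fun t : ℝ => (polyOf (w₀.2 + t • h.2)).eval x)
          ((polyOf h.2).eval x) 0 := by
        have : (fun t : ℝ => (polyOf (w₀.2 + t • h.2)).eval x) =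
            fun t : ℝ => (polyOf w₀.2).eval x + t • (polyOf h.2).eval x := by
          funext t
          rw [RCLike.real_smul_eq_coe_smul (K := K) t h.2, polyOf_add, polyOf_smul]
          simp [RCLike.real_smul_eq_coe_mul]
        rw [this]
        simpa using ((hasDerivAt_id (0 : ℝ)).smul_const _).const_add ((polyOf w₀.2).eval x)
      have h5 := (HasDerivAt.fun_finsetProd (u := Finset.univ) fun j _ => h3 j).mul h4
      have h6 : (fun t : ℝ => (mulPoly (w₀ + t • h)).eval x) = fun t : ℝ =>
          (∏ j, (monicOf (w₀.1 j + t • h.1 j)).eval x) * (polyOf (w₀.2 + t • h.2)).eval x := by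
        funext t
        simp [mulPoly, eval_prod]
      rw [h6] at h2
      have := h5.unique h2
      simpa using this
    have hpoly : (∑ j, (∏ l ∈ Finset.univ.erase j, monicOf (w₀.1 l)) * polyOf (h.1 j)) *
        polyOf w₀.2 + (∏ j, monicOf (w₀.1 j)) * polyOf h.2 = 0 := by
      apply Polynomial.funext
      intro x
      simpa [eval_finsetSum, eval_prod] using key x
    obtain ⟨hQ, hS⟩ := isRoot_sum_mul_prod (fun j => natDegree_monicOf (w₀.1 j))
      (fun j => monic_monicOf _) hcop hR _ (fun j => degree_polyOf_lt _) _ hpoly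
    refine Prod.ext ?_ ?_
    · funext j; exact polyOf_eq_zero.1 (hQ j)
    · exact polyOf_eq_zero.1 hS
  obtain ⟨φ, h1, h2, h3⟩ := exists_smooth_chart _ hsm w₀ hinj (finrank_mulSpace hn)
  exact ⟨φ, h1, fun w => by rw [h2], by rw [h2]; exact hsm.contDiffOn, h3⟩

end MulChart

/-! ### Types of polynomials: number of roots in the disk, multiplicities on the circle -/

/-- The real dimension of the space of monic polynomials over `K` of the degree of an atom of kind
`κ`: `2` for a root that moves on the circle (kind `0`), `1` for a root at a special point. -/
def weight (κ : SignType) : ℕ := if κ = 0 then 2 else 1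

/-- The real codimension contributed by a circle root of kind `a.1` and multiplicity `a.2`: a
moving root has one real degree of freedom, a special one has none. -/
def rootCodim (a : SignType × ℕ) : ℕ := if a.1 = 0 then 2 * a.2 - 1 else a.2

/-- The real codimension of the polynomials whose circle roots have the given kinds and
multiplicities. -/
def typeCodim (M : Multiset (SignType × ℕ)) : ℕ := (M.map rootCodim).sum

lemma typeCodim_zero : typeCodim 0 = 0 := rfl

lemma typeCodim_add (M M' : Multiset (SignType × ℕ)) :
    typeCodim (M + M') = typeCodim M + typeCodim M' := by simp [typeCodim]

/-- The structure of the unit circle relative to the coefficient field `K` (`ℝ` or `ℂ`):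
representatives `rep` of the points of the circle modulo `Gal(ℂ/K)`, their kinds (`0` for the
points of a one-parameter family, `±1` for the isolated ones), and their minimal polynomials
`atom z` over `K`, of degree `deg (kind z)`. A special point is determined by its kind
(`kind_inj`), and `finrank_mul_deg` computes the real dimension of the space of monic polynomials of
the degree of an atom. -/
class CircleModel (K : Type) [RCLike K] [NormedAlgebra K ℂ] where
  rep : Set ℂ
  kind : ℂ → SignType
  atom : ℂ → K[X]
  deg : SignType → ℕ
  norm_eq_one : ∀ z ∈ rep, ‖z‖ = 1
  kind_inj : ∀ z ∈ rep, ∀ z' ∈ rep, kind z = kind z' → kind z ≠ 0 → z = z'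
  monic_atom : ∀ z ∈ rep, (atom z).Monic
  natDegree_atom : ∀ z ∈ rep, (atom z).natDegree = deg (kind z)
  finrank_mul_deg : ∀ z ∈ rep, Module.finrank ℝ K * deg (kind z) = weight (kind z)
  atom_dvd : ∀ z ∈ rep, ∀ p : K[X], aeval z p = 0 → atom z ∣ p
  aeval_atom : ∀ z ∈ rep, aeval z (atom z) = 0
  rootMultiplicity_atom : ∀ z ∈ rep, ((atom z).map (algebraMap K ℂ)).rootMultiplicity z = 1
  eq_of_aeval_atom : ∀ z ∈ rep, ∀ z' ∈ rep, aeval z' (atom z) = 0 → z' = z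
  norm_of_aeval_atom : ∀ z ∈ rep, ∀ w : ℂ, aeval w (atom z) = 0 → ‖w‖ = 1
  exists_rep : ∀ w : ℂ, ‖w‖ = 1 → ∃ z ∈ rep, ∀ p : K[X], aeval w p = 0 → aeval z p = 0

section ComplexRoots

variable {K : Type} [RCLike K] [NormedAlgebra K ℂ]

lemma isCoprime_of_forall_aeval {p q : K[X]} (h : ∀ z : ℂ, aeval z p = 0 → aeval z q ≠ 0) :
    IsCoprime p q := by
  rw [isCoprime_iff_aeval_ne_zero_of_isAlgClosed K ℂ]
  intro a
  by_cases ha : aeval a p = 0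
  · exact Or.inr (h a ha)
  · exact Or.inl ha

lemma rootMultiplicity_map_pos {p : K[X]} (hp : p ≠ 0) {z : ℂ} :
    0 < (p.map (algebraMap K ℂ)).rootMultiplicity z ↔ aeval z p = 0 := by
  have h0 : p.map (algebraMap K ℂ) ≠ 0 :=
    (Polynomial.map_ne_zero_iff (algebraMap K ℂ).injective).2 hp
  rw [rootMultiplicity_pos h0, IsRoot.def, eval_map_algebraMap]

lemma rootMultiplicity_pow_of_field {L : Type} [Field L] (p : L[X]) (k : ℕ) (z : L) :
    (p ^ k).rootMultiplicity z = k * p.rootMultiplicity z := by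
  classical
  rw [← count_roots, roots_pow, Multiset.count_nsmul, count_roots]

end ComplexRoots

section Types

variable (K : Type) [RCLike K] [NormedAlgebra K ℂ] [CircleModel K]

open CircleModel

open Classical in
/-- The representatives of circle points among the members of `Λ`. -/
def circleReps (Λ : Multiset ℂ) : Finset ℂ := Λ.toFinset.filter (· ∈ rep K)

open Classical in
/-- The type of a multiset of complex numbers: how many of them lie in the open unit disk, and the
kinds and multiplicities of those on the circle (one for each orbit of `Gal(ℂ/K)`). -/
def typ (Λ : Multiset ℂ) : ℕ × Multiset (SignType × ℕ) :=
  (Λ.countP (‖·‖ < 1), (circleReps K Λ).val.map fun z => (kind K z, Λ.count z))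

variable {K}

lemma mem_circleReps {Λ : Multiset ℂ} {z : ℂ} : z ∈ circleReps K Λ ↔ z ∈ Λ ∧ z ∈ rep K := by
  simp [circleReps]

lemma typ_add {Λ Λ' : Multiset ℂ} (h : ∀ z ∈ rep K, z ∈ Λ → z ∉ Λ') :
    typ K (Λ + Λ') = typ K Λ + typ K Λ' := by
  classical
  refine Prod.ext (Multiset.countP_add _ _ _) ?_
  have hdisj : Disjoint (circleReps K Λ) (circleReps K Λ') := by
    rw [Finset.disjoint_left]
    intro z hz hz'
    rw [mem_circleReps] at hz hz'
    exact h z hz.2 hz.1 hz'.1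
  have hunion : circleReps K (Λ + Λ') = (circleReps K Λ).disjUnion (circleReps K Λ') hdisj := by
    ext z
    simp only [mem_circleReps, Finset.mem_disjUnion, Multiset.mem_add]
    tauto
  simp only [typ, hunion, Prod.snd_add]
  rw [show ((circleReps K Λ).disjUnion (circleReps K Λ') hdisj).val =
    (circleReps K Λ).val + (circleReps K Λ').val from rfl, Multiset.map_add]
  congr 1
  · refine Multiset.map_congr rfl fun z hz => ?_
    have hz := mem_circleReps.1 hz
    rw [Multiset.count_add, Multiset.count_eq_zero_of_notMem (h z hz.2 hz.1), add_zero]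
  · refine Multiset.map_congr rfl fun z hz => ?_
    have hz := mem_circleReps.1 hz
    rw [Multiset.count_add,
      Multiset.count_eq_zero_of_notMem (fun hzΛ => h z hz.2 hzΛ hz.1), zero_add]

lemma typ_map {Λ : Multiset ℂ} (h : ℂ → ℂ) (hinj : Set.InjOn h {z | z ∈ Λ})
    (hlt : ∀ z ∈ Λ, ‖h z‖ < 1 ↔ ‖z‖ < 1) (hrep : ∀ z ∈ Λ, h z ∈ rep K ↔ z ∈ rep K)
    (hkind : ∀ z ∈ Λ, z ∈ rep K → kind K (h z) = kind K z) : typ K (Λ.map h) = typ K Λ := by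
  classical
  refine Prod.ext ?_ ?_
  · simp only [typ, Multiset.countP_map]
    rw [Multiset.countP_eq_card_filter]
    exact congrArg Multiset.card (Multiset.filter_congr hlt)
  · have himg : circleReps K (Λ.map h) = (circleReps K Λ).image h := by
      ext w
      simp only [mem_circleReps, Finset.mem_image, Multiset.mem_map]
      constructor
      · rintro ⟨⟨z, hz, rfl⟩, hw⟩
        exact ⟨z, ⟨hz, (hrep z hz).1 hw⟩, rfl⟩
      · rintro ⟨z, ⟨hz, hzr⟩, rfl⟩
        exact ⟨⟨z, hz, rfl⟩, (hrep z hz).2 hzr⟩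
    have hinj' : Set.InjOn h (circleReps K Λ : Set ℂ) :=
      hinj.mono fun z hz => (mem_circleReps.1 hz).1
    simp only [typ, himg]
    rw [Finset.image_val_of_injOn hinj', Multiset.map_map]
    refine Multiset.map_congr rfl fun z hz => ?_
    have hz := mem_circleReps.1 hz
    simp only [Function.comp_apply]
    rw [hkind z hz.1 hz.2, Multiset.count_map_eq_count h Λ hinj z hz.1]

lemma typ_snd_eq_zero {Λ : Multiset ℂ} : (typ K Λ).2 = 0 ↔ ∀ z ∈ Λ, z ∉ rep K := by
  simp only [typ, Multiset.map_eq_zero, Finset.val_eq_zero, Finset.eq_empty_iff_forall_notMem,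
    mem_circleReps, not_and]

variable (K) in
/-- The type of a polynomial: the type of the multiset of its complex roots. -/
def typeOf (p : K[X]) : ℕ × Multiset (SignType × ℕ) := typ K (p.aroots ℂ)

lemma typeOf_mul {p q : K[X]} (hp : p ≠ 0) (hq : q ≠ 0)
    (h : ∀ z ∈ rep K, aeval z p = 0 → aeval z q ≠ 0) :
    typeOf K (p * q) = typeOf K p + typeOf K q := by
  rw [typeOf, aroots_mul (mul_ne_zero hp hq)]
  refine typ_add fun z hz h1 h2 => ?_
  rw [mem_aroots] at h1 h2
  exact h z hz h1.2 h2.2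

lemma typeOf_one : typeOf K (1 : K[X]) = 0 := by
  rw [typeOf, aroots_one]
  exact Prod.ext (by simp [typ]) (by simp [typ, circleReps])

lemma typeOf_prod {ι : Type} (s : Finset ι) (p : ι → K[X]) (hp : ∀ i ∈ s, p i ≠ 0)
    (h : ∀ i ∈ s, ∀ j ∈ s, i ≠ j → ∀ z ∈ rep K, aeval z (p i) = 0 → aeval z (p j) ≠ 0) :
    typeOf K (∏ i ∈ s, p i) = ∑ i ∈ s, typeOf K (p i) := by
  classical
  induction s using Finset.induction_on with
  | empty => simpa using typeOf_one
  | insert i s hi ih =>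
    rw [Finset.prod_insert hi, Finset.sum_insert hi, typeOf_mul (hp i (by simp)), ih]
    · exact fun j hj => hp j (by simp [hj])
    · exact fun j hj l hl => h j (by simp [hj]) l (by simp [hl])
    · exact Finset.prod_ne_zero_iff.2 fun j hj => hp j (by simp [hj])
    · intro z hz hzi hzp
      rw [map_prod, Finset.prod_eq_zero_iff] at hzp
      obtain ⟨j, hj, hj0⟩ := hzp
      exact h i (by simp) j (by simp [hj]) (fun e => hi (e ▸ hj)) z hz hzi hj0

lemma typeOf_snd_eq_zero {p : K[X]} (hp : p ≠ 0) :
    (typeOf K p).2 = 0 ↔ ∀ z : ℂ, ‖z‖ = 1 → aeval z p ≠ 0 := by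
  rw [typeOf, typ_snd_eq_zero]
  constructor
  · intro h w hw hw0
    obtain ⟨z, hz, hzp⟩ := exists_rep (K := K) w hw
    exact h z (mem_aroots.2 ⟨hp, hzp p hw0⟩) hz
  · intro h z hz hzr
    exact h z (norm_eq_one z hzr) (mem_aroots.1 hz).2

lemma typeOf_atom_pow {z : ℂ} (hz : z ∈ rep K) {μ : ℕ} (hμ : μ ≠ 0) :
    typeOf K (atom z ^ μ : K[X]) = (0, {(kind K z, μ)}) := by
  classical
  have h0 : (atom z : K[X]) ≠ 0 := (monic_atom z hz).ne_zero
  have hmem : ∀ w, w ∈ (atom z ^ μ : K[X]).aroots ℂ ↔ aeval w (atom z : K[X]) = 0 := by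
    intro w
    rw [mem_aroots, map_pow, pow_eq_zero_iff hμ]
    exact and_iff_right (pow_ne_zero _ h0)
  have hreps : circleReps K ((atom z ^ μ : K[X]).aroots ℂ) = {z} := by
    ext w
    rw [mem_circleReps, hmem, Finset.mem_singleton]
    constructor
    · exact fun h => eq_of_aeval_atom z hz w h.2 h.1
    · rintro rfl
      exact ⟨aeval_atom w hz, hz⟩
  refine Prod.ext ?_ ?_
  · simp only [typeOf, typ]
    rw [Multiset.countP_eq_zero]
    intro w hw
    rw [norm_of_aeval_atom z hz w ((hmem w).1 hw)]
    exact lt_irrefl _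
  · simp only [typeOf, typ, hreps]
    rw [aroots_pow, Finset.singleton_val, Multiset.map_singleton, Multiset.count_nsmul,
      aroots_def, count_roots, rootMultiplicity_atom z hz, mul_one]

/-- A multiset that is the image of two maps can be parametrized compatibly with both. -/
lemma exists_lift_of_map_eq {J α β : Type} [Nonempty β] (T : Finset J) (f : J → α)
    (S : Multiset β) (g : β → α) (h : S.map g = T.val.map f) :
    ∃ e : J → β, T.val.map e = S ∧ ∀ j ∈ T, g (e j) = f j := by
  classical
  induction T using Finset.induction_on generalizing S with
  | empty =>
    refine ⟨fun _ => Classical.arbitrary β, ?_, by simp⟩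
    have : S = 0 := by simpa using h
    simp [this]
  | insert j T hj ih =>
    rw [Finset.insert_val_of_notMem hj, Multiset.map_cons] at h
    have hm : f j ∈ S.map g := by rw [h]; simp
    obtain ⟨b, hb, hbj⟩ := Multiset.mem_map.1 hm
    obtain ⟨S', rfl⟩ := Multiset.exists_cons_of_mem hb
    rw [Multiset.map_cons, hbj, Multiset.cons_inj_right] at h
    obtain ⟨e, he, heg⟩ := ih S' h
    refine ⟨Function.update e j b, ?_, ?_⟩
    · rw [Finset.insert_val_of_notMem hj, Multiset.map_cons, Function.update_self]
      congr 1
      rw [← he]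
      refine Multiset.map_congr rfl fun i hi => ?_
      exact Function.update_of_ne (fun hij : i = j => hj (hij ▸ hi)) _ _
    · intro i hi
      by_cases hij : i = j
      · subst hij; simpa using hbj
      · rw [Function.update_of_ne hij]
        exact heg i ((Finset.mem_insert.1 hi).resolve_left hij)

lemma isCoprime_atom {z z' : ℂ} (hz : z ∈ rep K) (hz' : z' ∈ rep K) (hne : z ≠ z') :
    IsCoprime (atom z : K[X]) (atom z') := by
  -- a common root would, by minimality of the atoms, make `z` a root of `atom z'`
  refine isCoprime_of_forall_aeval fun w hw hw' => ?_
  obtain ⟨y, hy, hyp⟩ := exists_rep (K := K) w (norm_of_aeval_atom z hz w hw)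
  exact hne ((eq_of_aeval_atom z hz y hy (hyp _ hw)).symm.trans
    (eq_of_aeval_atom z' hz' y hy (hyp _ hw')))

lemma exists_eq_atom_pow_mul {p : K[X]} (hp : p ≠ 0) {z : ℂ} (hz : z ∈ rep K) :
    ∃ q : K[X], p = atom z ^ ((p.map (algebraMap K ℂ)).rootMultiplicity z) * q ∧
      aeval z q ≠ 0 := by
  have hpos : 0 < (atom z : K[X]).degree := by
    rw [← natDegree_pos_iff_degree_pos, Nat.pos_iff_ne_zero]
    intro h0
    have h1 := (monic_atom (K := K) z hz).natDegree_eq_zero.1 h0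
    have := aeval_atom (K := K) z hz
    rw [h1] at this
    simp at this
  obtain ⟨q, hq, hnd⟩ := (finiteMultiplicity_of_degree_pos_of_monic hpos
    (monic_atom z hz) hp).exists_eq_pow_mul_and_not_dvd
  have hq0 : aeval z q ≠ 0 := fun h => hnd (atom_dvd z hz q h)
  refine ⟨q, ?_, hq0⟩
  have hqne : q ≠ 0 := by rintro rfl; simp at hq0
  have hm : (p.map (algebraMap K ℂ)).rootMultiplicity z = multiplicity (atom z) p := by
    conv_lhs => rw [hq]
    rw [Polynomial.map_mul, Polynomial.map_pow, rootMultiplicity_mul, rootMultiplicity_pow_of_field,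
      rootMultiplicity_atom z hz, mul_one]
    · have : ¬ 0 < (q.map (algebraMap K ℂ)).rootMultiplicity z := by
        rw [rootMultiplicity_map_pos hqne]; exact hq0
      omega
    · rw [← Polynomial.map_pow, ← Polynomial.map_mul, ← hq]
      exact (Polynomial.map_ne_zero_iff (algebraMap K ℂ).injective).2 hp
  rw [hm]
  exact hq

/-- Every nonzero polynomial is a product of powers of atoms and of a polynomial without roots on
the circle. The powers can be enumerated in any order compatible with the type. -/
theorem exists_factorization {p : K[X]} (hp : p ≠ 0) {J : Type} [Fintype J]
    {f : J → SignType × ℕ} {r : ℕ} (h : typeOf K p = (r, Finset.univ.val.map f)) :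
    ∃ (z : J → ℂ) (R : K[X]), Function.Injective z ∧ (∀ j, z j ∈ rep K) ∧
      (∀ j, kind K (z j) = (f j).1) ∧ (∀ j, (f j).2 ≠ 0) ∧
      p = (∏ j, atom (z j) ^ (f j).2) * R ∧ typeOf K R = (r, 0) := by
  classical
  have h2 : (circleReps K (p.aroots ℂ)).val.map
      (fun z => (kind K z, (p.aroots ℂ).count z)) = Finset.univ.val.map f := congrArg Prod.snd h
  obtain ⟨z, hz, hzf⟩ := exists_lift_of_map_eq _ f _ _ h2
  have hinj : Function.Injective z := by
    intro i j hij
    have hnd : (Finset.univ.val.map z).Nodup := by rw [hz]; exact Finset.nodup _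
    exact Multiset.inj_on_of_nodup_map hnd i (Finset.mem_univ i) j (Finset.mem_univ j) hij
  have hmem : ∀ j, z j ∈ circleReps K (p.aroots ℂ) := by
    intro j
    rw [← Finset.mem_val, ← hz]
    exact Multiset.mem_map_of_mem z (Finset.mem_univ j)
  have hrep : ∀ j, z j ∈ rep K := fun j => (mem_circleReps.1 (hmem j)).2
  have hroot : ∀ j, aeval (z j) p = 0 := fun j =>
    (mem_aroots.1 (mem_circleReps.1 (hmem j)).1).2
  have hkind : ∀ j, kind K (z j) = (f j).1 := fun j =>
    congrArg Prod.fst (hzf j (Finset.mem_univ j))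
  have hmult : ∀ j, (p.map (algebraMap K ℂ)).rootMultiplicity (z j) = (f j).2 := by
    intro j
    rw [← congrArg Prod.snd (hzf j (Finset.mem_univ j))]
    simp [aroots_def]
  have hcop : Pairwise (Function.onFun IsCoprime fun j => (atom (z j) : K[X]) ^ (f j).2) :=
    fun i j hij => (isCoprime_atom (hrep i) (hrep j) (hinj.ne hij)).pow
  obtain ⟨R, hR⟩ := Fintype.prod_dvd_of_coprime hcop (z := p) fun j => by
    obtain ⟨q, hq, -⟩ := exists_eq_atom_pow_mul hp (hrep j)
    rw [hmult j] at hq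
    exact ⟨q, hq⟩
  have hpos : ∀ j, (f j).2 ≠ 0 := by
    intro j
    rw [← hmult j, ← Nat.pos_iff_ne_zero]
    exact (rootMultiplicity_map_pos hp).2 (hroot j)
  have hR0 : R ≠ 0 := by rintro rfl; exact hp (by rw [hR, mul_zero])
  have hP0 : ∀ j, (atom (z j) : K[X]) ^ (f j).2 ≠ 0 := fun j =>
    pow_ne_zero _ (monic_atom _ (hrep j)).ne_zero
  -- `R` does not vanish at any representative: its multiplicity is used up by the atoms
  have hRrep : ∀ y ∈ rep K, aeval y R ≠ 0 := by
    intro y hy hyR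
    have hyp : aeval y p = 0 := by rw [hR, map_mul, hyR, mul_zero]
    have hym : y ∈ (circleReps K (p.aroots ℂ)).val :=
      mem_circleReps.2 ⟨mem_aroots.2 ⟨hp, hyp⟩, hy⟩
    rw [← hz, Multiset.mem_map] at hym
    obtain ⟨j, -, rfl⟩ := hym
    obtain ⟨q, hq, hq0⟩ := exists_eq_atom_pow_mul hp (hrep j)
    rw [hmult j] at hq
    apply hq0
    have : (atom (z j) : K[X]) ^ (f j).2 * q = (atom (z j) : K[X]) ^ (f j).2 *
        ((∏ i ∈ Finset.univ.erase j, (atom (z i) : K[X]) ^ (f i).2) * R) := by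
      rw [← hq, ← mul_assoc,
        Finset.mul_prod_erase _ (fun i => (atom (z i) : K[X]) ^ (f i).2) (Finset.mem_univ j)]
      exact hR
    rw [mul_left_cancel₀ (hP0 j) this, map_mul, hyR, mul_zero]
  refine ⟨z, R, hinj, hrep, hkind, hpos, hR, ?_⟩
  have htype : typeOf K p = ∑ j, ((0 : ℕ), ({f j} : Multiset (SignType × ℕ))) + typeOf K R := by
    rw [hR, typeOf_mul (Finset.prod_ne_zero_iff.2 fun j _ => hP0 j) hR0
      fun y hy _ => hRrep y hy, typeOf_prod _ _ fun j _ => hP0 j]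
    · congr 1
      refine Finset.sum_congr rfl fun j _ => ?_
      rw [typeOf_atom_pow (hrep j) (hpos j), hkind j]
    · intro i _ j _ hij y hy hyi hyj
      rw [map_pow, pow_eq_zero_iff (hpos _)] at hyi hyj
      exact hij (hinj ((eq_of_aeval_atom _ (hrep i) y hy hyi).symm.trans
        (eq_of_aeval_atom _ (hrep j) y hy hyj)))
  have hR2 : (typeOf K R).2 = 0 := typ_snd_eq_zero.2 fun y hy hyr => hRrep y hyr (mem_aroots.1 hy).2
  refine Prod.ext ?_ hR2
  have := congrArg Prod.fst htype
  rw [h] at this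
  simpa [Prod.fst_sum] using this.symm

/-- The sum of the circle roots, counted with multiplicity, and of the roots in the disk is at most
the degree. -/
lemma add_sum_le_natDegree {p : K[X]} (hp : p ≠ 0) :
    (typeOf K p).1 + ((typeOf K p).2.map fun a => deg K a.1 * a.2).sum ≤ p.natDegree := by
  classical
  obtain ⟨L, hL⟩ := Quot.exists_rep (typeOf K p).2
  have hf : (typeOf K p).2 = Finset.univ.val.map L.get := by
    rw [← hL]
    simp [Fin.univ_val_map]
  obtain ⟨z, R, hinj, hrep, hkind, hpos, hpR, hR⟩ :=
    exists_factorization hp (J := Fin L.length) (f := L.get) (r := (typeOf K p).1)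
      (Prod.ext rfl hf)
  have hR0 : R ≠ 0 := by rintro rfl; exact hp (by rw [hpR, mul_zero])
  have hr : (typeOf K p).1 ≤ R.natDegree := by
    have : (typeOf K R).1 = (typeOf K p).1 := by rw [hR]
    rw [← this]
    exact (Multiset.countP_le_card _ _).trans
      ((card_roots' _).trans natDegree_map_le)
  have hdeg : p.natDegree = ∑ j, deg K (L.get j).1 * (L.get j).2 + R.natDegree := by
    have hm : (∏ j, (atom (z j) : K[X]) ^ (L.get j).2).Monic :=
      monic_prod_of_monic _ _ fun j _ => (monic_atom _ (hrep j)).pow _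
    conv_lhs => rw [hpR]
    rw [hm.natDegree_mul' hR0, natDegree_prod_of_monic _ _ fun j _ => (monic_atom _ (hrep j)).pow _]
    congr 1
    refine Finset.sum_congr rfl fun j _ => ?_
    rw [(monic_atom _ (hrep j)).natDegree_pow, natDegree_atom _ (hrep j), hkind j, mul_comm]
  rw [hf, hdeg, Multiset.map_map]
  have : (Multiset.map ((fun a : SignType × ℕ => deg K a.1 * a.2) ∘ L.get) Finset.univ.val).sum
    = ∑ j, deg K (L.get j).1 * (L.get j).2 := rfl
  rw [this]
  omega

end Types

/-! ### Stability of the number of roots in the disk -/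

section Stability

lemma eventually_forall_ne_zero {X G : Type} [TopologicalSpace X] [TopologicalSpace G] [Zero G]
    [T1Space G] {Z : Set ℂ} (hZ : IsCompact Z) {F : X × ℂ → G} (hF : Continuous F) {x₀ : X}
    (h : ∀ z ∈ Z, F (x₀, z) ≠ 0) : ∀ᶠ x in 𝓝 x₀, ∀ z ∈ Z, F (x, z) ≠ 0 :=
  hZ.eventually_forall_of_forall_eventually (P := fun x z => F (x, z) ≠ 0) fun z hz =>
    hF.continuousAt.eventually_ne (h z hz)

lemma isCompact_circle : IsCompact {z : ℂ | ‖z‖ = 1} := by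
  have : {z : ℂ | ‖z‖ = 1} = Metric.sphere 0 1 := by ext; simp
  rw [this]
  exact isCompact_sphere 0 1

variable {K : Type} [RCLike K] [NormedAlgebra K ℂ]

lemma aeval_polyOf {m : ℕ} (v : Fin m → K) (z : ℂ) :
    aeval z (polyOf v) = ∑ i, algebraMap K ℂ (v i) * z ^ (i : ℕ) := by
  simp [polyOf]

lemma aeval_monicOf {m : ℕ} (u : Fin m → K) (z : ℂ) :
    aeval z (monicOf u) = z ^ m + ∑ i, algebraMap K ℂ (u i) * z ^ (i : ℕ) := by
  simp [monicOf, aeval_polyOf]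

lemma continuous_aeval_polyOf {m : ℕ} :
    Continuous fun x : (Fin m → K) × ℂ => aeval x.2 (polyOf x.1) := by
  simp only [aeval_polyOf]
  refine continuous_finsetSum _ fun i _ => Continuous.mul ?_ (continuous_snd.pow _)
  exact (continuous_algebraMap K ℂ).comp ((continuous_apply i).comp continuous_fst)

lemma continuous_aeval_monicOf {m : ℕ} :
    Continuous fun x : (Fin m → K) × ℂ => aeval x.2 (monicOf x.1) := by
  simp only [monicOf, map_add, map_pow, aeval_X]
  exact (continuous_snd.pow _).add continuous_aeval_polyOf

/-- Monic polynomials with all roots in the open unit disk form an open set. The reversed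
polynomial is used to make the complement of the disk compact. -/
lemma eventually_roots_in_disk {r : ℕ} {u₀ : Fin r → ℂ}
    (h : ∀ z : ℂ, 1 ≤ ‖z‖ → (monicOf u₀).eval z ≠ 0) :
    ∀ᶠ u in 𝓝 u₀, ∀ z : ℂ, 1 ≤ ‖z‖ → (monicOf u).eval z ≠ 0 := by
  let F : (Fin r → ℂ) × ℂ → ℂ := fun x => 1 + ∑ i : Fin r, x.1 i * x.2 ^ (r - (i : ℕ))
  have hF : Continuous F := by
    refine continuous_const.add (continuous_finsetSum _ fun i _ => ?_)
    exact ((continuous_apply i).comp continuous_fst).mul (continuous_snd.pow _)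
  have hrel : ∀ (u : Fin r → ℂ) (z : ℂ), z ≠ 0 → (monicOf u).eval z = z ^ r * F (u, z⁻¹) := by
    intro u z hz
    simp only [F, mul_add, mul_one, Finset.mul_sum]
    rw [← coe_aeval_eq_eval, aeval_monicOf]
    congr 1
    refine Finset.sum_congr rfl fun i _ => ?_
    have hi : (i : ℕ) + (r - i) = r := by omega
    have : z ^ r = z ^ (i : ℕ) * z ^ (r - (i : ℕ)) := by rw [← pow_add, hi]
    rw [this, inv_pow]
    have hz' : z ^ (r - (i : ℕ)) ≠ 0 := pow_ne_zero _ hz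
    simp only [Algebra.algebraMap_self, RingHom.id_apply]
    field_simp
  have h0 : ∀ y ∈ Metric.closedBall (0 : ℂ) 1, F (u₀, y) ≠ 0 := by
    intro y hy
    by_cases hy0 : y = 0
    · have : F (u₀, y) = 1 := by
        simp only [F, hy0, add_eq_left]
        refine Finset.sum_eq_zero fun i _ => ?_
        rw [zero_pow (by omega), mul_zero]
      rw [this]; exact one_ne_zero
    · have hy1 : 1 ≤ ‖y⁻¹‖ := by
        rw [norm_inv]
        exact (one_le_inv₀ (norm_pos_iff.2 hy0)).2 (by simpa using hy)
      have := h _ hy1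
      rw [hrel _ _ (inv_ne_zero hy0), inv_inv] at this
      exact (mul_ne_zero_iff.1 this).2
  filter_upwards [eventually_forall_ne_zero (isCompact_closedBall 0 1) hF h0] with u hu z hz
  have hz0 : z ≠ 0 := by rintro rfl; simp at hz; linarith
  rw [hrel u z hz0]
  refine mul_ne_zero (pow_ne_zero _ hz0) (hu _ ?_)
  rw [mem_closedBall_zero_iff, norm_inv]
  exact inv_le_one_of_one_le₀ hz

/-- Over `ℂ`: a polynomial without roots on the circle splits off its roots in the disk, and this
factorization persists nearby by the multiplication chart. -/
lemma eventually_countP_roots {N : ℕ} {v₀ : Fin (N + 1) → ℂ}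
    (h : ∀ z : ℂ, ‖z‖ = 1 → (polyOf v₀).eval z ≠ 0) :
    ∀ᶠ v in 𝓝 v₀, (∀ z : ℂ, ‖z‖ = 1 → (polyOf v).eval z ≠ 0) ∧
      (polyOf v).roots.countP (‖·‖ < 1) = (polyOf v₀).roots.countP (‖·‖ < 1) := by
  classical
  have hp0 : polyOf v₀ ≠ 0 := by
    intro h0
    exact h 1 (by simp) (by simp [h0])
  set p := polyOf v₀ with hp
  set A : ℂ[X] := ((p.roots.filter (‖·‖ < 1)).map fun a => X - C a).prod with hA
  set B : ℂ[X] := C p.leadingCoeff * ((p.roots.filter (¬ ‖·‖ < 1)).map fun a => X - C a).prod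
    with hB
  have hpAB : p = A * B := by
    have h1 : C p.leadingCoeff * (p.roots.map fun a => X - C a).prod = p :=
      C_leadingCoeff_mul_prod_multiset_X_sub_C IsAlgClosed.card_roots_eq_natDegree
    rw [← h1]
    conv_lhs => rw [← Multiset.filter_add_not (fun a : ℂ => ‖a‖ < 1) p.roots]
    rw [Multiset.map_add, Multiset.prod_add, hA, hB]
    ring
  have hAm : A.Monic := monic_multiset_prod_of_monic _ _ fun a _ => monic_X_sub_C a
  have hB0 : B ≠ 0 := by rintro h0; exact hp0 (by rw [hpAB, h0, mul_zero])
  set r := p.roots.countP (‖·‖ < 1) with hr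
  have hAr : A.natDegree = r := by
    rw [hA, natDegree_multiset_prod_X_sub_C_eq_card, hr, Multiset.countP_eq_card_filter]
  have hdeg : r + B.natDegree ≤ N := by
    have := natDegree_polyOf_le v₀
    rw [← hp, hpAB, hAm.natDegree_mul' hB0, hAr] at this
    exact this
  have hAroot : ∀ z, A.eval z = 0 → ‖z‖ < 1 := by
    intro z hz
    have : z ∈ A.roots := (mem_roots hAm.ne_zero).2 hz
    rw [hA, roots_multiset_prod_X_sub_C] at this
    exact (Multiset.mem_filter.1 this).2
  have hBroot : ∀ z, B.eval z = 0 → 1 ≤ ‖z‖ := by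
    intro z hz
    rw [hB, eval_C_mul, mul_eq_zero] at hz
    have hz := hz.resolve_left (leadingCoeff_ne_zero.2 hp0)
    have hm : ((p.roots.filter (¬ ‖·‖ < 1)).map fun a => X - C a).prod ≠ 0 :=
      (monic_multiset_prod_of_monic _ _ fun a _ => monic_X_sub_C a).ne_zero
    have : z ∈ (((p.roots.filter (¬ ‖·‖ < 1)).map fun a => X - C a).prod).roots :=
      (mem_roots hm).2 hz
    rw [roots_multiset_prod_X_sub_C] at this
    exact not_lt.1 (Multiset.mem_filter.1 this).2
  set N' := N - r
  have hn : ∑ _j : Unit, r + N' = N := by simp [N']; omega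
  let w₀ : (∀ _j : Unit, Fin r → ℂ) × (Fin (N' + 1) → ℂ) := (fun _ => coeffVec r A, coeffVec _ B)
  have hw1 : ∀ j, monicOf (w₀.1 j) = A := fun j => monicOf_coeffVec hAm hAr
  have hw2 : polyOf w₀.2 = B :=
    polyOf_coeffVec_succ (show B.natDegree ≤ N - r by omega)
  obtain ⟨φ, hs, hφ, -, -⟩ := exists_mulChart hn w₀ (fun i j hij => (hij rfl).elim) fun j => by
    rw [hw1, hw2]
    refine isCoprime_of_forall_aeval (K := ℂ) fun z hz hz' => ?_
    exact absurd (hAroot z hz) (not_lt.2 (hBroot z hz'))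
  have hφw : φ w₀ = v₀ := by
    rw [hφ, mulPoly, hw2]
    simp only [hw1, Finset.univ_unique, Finset.prod_singleton]
    rw [← hpAB, hp, coeffVec_polyOf]
  rw [← hφw, ← φ.map_nhds_eq hs, eventually_map]
  have e1 : ∀ᶠ w in 𝓝 w₀, ∀ z : ℂ, 1 ≤ ‖z‖ → (monicOf (w.1 ())).eval z ≠ 0 := by
    have hc : ContinuousAt (fun w : (∀ _j : Unit, Fin r → ℂ) × (Fin (N' + 1) → ℂ) => w.1 ()) w₀ :=
      ((continuous_apply ()).comp continuous_fst).continuousAt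
    refine hc.eventually (eventually_roots_in_disk fun z hz hz0 => ?_)
    rw [hw1] at hz0
    exact absurd (hAroot z hz0) (not_lt.2 hz)
  have e2 : ∀ᶠ w in 𝓝 w₀, ∀ z ∈ Metric.closedBall (0 : ℂ) 1, (polyOf w.2).eval z ≠ 0 := by
    have hc : Continuous fun x : ((∀ _j : Unit, Fin r → ℂ) × (Fin (N' + 1) → ℂ)) × ℂ =>
        aeval x.2 (polyOf x.1.2) :=
      (continuous_aeval_polyOf (K := ℂ)).comp
        ((continuous_snd.comp continuous_fst).prodMk continuous_snd)
    refine eventually_forall_ne_zero (isCompact_closedBall 0 1) hc fun z hz hz0 => ?_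
    have hz0 : (polyOf w₀.2).eval z = 0 := hz0
    rw [hw2] at hz0
    have hz1 : ‖z‖ ≤ 1 := by simpa using hz
    refine h z (le_antisymm hz1 (hBroot z hz0)) ?_
    rw [hpAB, eval_mul, hz0, mul_zero]
  filter_upwards [e1, e2] with w h1 h2
  have hmul : polyOf (φ w) = monicOf (w.1 ()) * polyOf w.2 := by
    rw [hφ, polyOf_coeffVec_succ (natDegree_mulPoly_le hn w)]
    simp [mulPoly]
  have hq0 : polyOf w.2 ≠ 0 := by
    intro h0
    exact h2 0 (by simp) (by simp [h0])
  rw [hmul]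
  constructor
  · intro z hz
    rw [eval_mul]
    exact mul_ne_zero (h1 z hz.ge) (h2 z (by simp [hz]))
  · rw [roots_mul (mul_ne_zero (monic_monicOf _).ne_zero hq0), Multiset.countP_add]
    have c1 : (monicOf (w.1 ())).roots.countP (‖·‖ < 1) = r := by
      rw [Multiset.countP_eq_card.2, IsAlgClosed.card_roots_eq_natDegree, natDegree_monicOf]
      intro z hz
      by_contra hlt
      exact h1 z (not_lt.1 hlt) (mem_roots (monic_monicOf _).ne_zero |>.1 hz)
    have c2 : (polyOf w.2).roots.countP (‖·‖ < 1) = 0 := by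
      rw [Multiset.countP_eq_zero]
      intro z hz hlt
      exact h2 z (by simpa using hlt.le) (mem_roots hq0 |>.1 hz)
    rw [c1, c2, add_zero]

lemma eventually_countP_aroots {N : ℕ} {v₀ : Fin (N + 1) → K}
    (h : ∀ z : ℂ, ‖z‖ = 1 → aeval z (polyOf v₀) ≠ 0) :
    ∀ᶠ v in 𝓝 v₀, (∀ z : ℂ, ‖z‖ = 1 → aeval z (polyOf v) ≠ 0) ∧
      ((polyOf v).aroots ℂ).countP (‖·‖ < 1) = ((polyOf v₀).aroots ℂ).countP (‖·‖ < 1) := by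
  have hc : Continuous fun (v : Fin (N + 1) → K) i => algebraMap K ℂ (v i) :=
    continuous_pi fun i => (continuous_algebraMap K ℂ).comp (continuous_apply i)
  have hev : ∀ (v : Fin (N + 1) → K) (z : ℂ),
      (polyOf fun i => algebraMap K ℂ (v i)).eval z = aeval z (polyOf v) := by
    intro v z
    rw [← map_polyOf, eval_map_algebraMap]
  have := (hc.continuousAt (x := v₀)).eventually (eventually_countP_roots
    (v₀ := fun i => algebraMap K ℂ (v₀ i)) fun z hz => by rw [hev]; exact h z hz)
  simp only [hev] at this
  simp only [← map_polyOf] at this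
  exact this

end Stability

/-! ### The local structure of the space of polynomials -/

section LocalStructure

variable {K : Type} [RCLike K] [NormedAlgebra K ℂ] [CircleModel K]

open CircleModel

lemma eventually_typeOf_eq {N : ℕ} {v₀ : Fin (N + 1) → K} (h0 : v₀ ≠ 0)
    (h : (typeOf K (polyOf v₀)).2 = 0) :
    ∀ᶠ v in 𝓝 v₀, v ≠ 0 ∧ (∀ z : ℂ, ‖z‖ = 1 → aeval z (polyOf v) ≠ 0) ∧
      typeOf K (polyOf v) = typeOf K (polyOf v₀) := by
  have hp0 : polyOf v₀ ≠ 0 := fun e => h0 (polyOf_eq_zero.1 e)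
  filter_upwards [eventually_countP_aroots ((typeOf_snd_eq_zero hp0).1 h),
    eventually_ne_nhds h0] with v hv hv0
  refine ⟨hv0, hv.1, Prod.ext hv.2 ?_⟩
  rw [h, typeOf_snd_eq_zero fun e => hv0 (polyOf_eq_zero.1 e)]
  exact hv.1

variable {J : Type} [Fintype J]

/-- Near a product of polynomials without common circle roots, types add up. -/
lemma eventually_typeOf_mulPoly {m : J → ℕ} {N : ℕ}
    {w₀ : (∀ j, Fin (m j) → K) × (Fin (N + 1) → K)}
    (hpair : ∀ i j, i ≠ j → ∀ z : ℂ, ‖z‖ = 1 → aeval z (monicOf (w₀.1 i)) = 0 →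
      aeval z (monicOf (w₀.1 j)) ≠ 0)
    (hv : w₀.2 ≠ 0) (hv0 : (typeOf K (polyOf w₀.2)).2 = 0) :
    ∀ᶠ w in 𝓝 w₀, mulPoly w ≠ 0 ∧
      typeOf K (mulPoly w) = typeOf K (polyOf w₀.2) + ∑ j, typeOf K (monicOf (w.1 j)) := by
  have e1 : ∀ᶠ w in 𝓝 w₀, ∀ i j, i ≠ j → ∀ z ∈ {z : ℂ | ‖z‖ = 1},
      (aeval z (monicOf (w.1 i)), aeval z (monicOf (w.1 j))) ≠ (0 : ℂ × ℂ) := by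
    rw [eventually_all]
    intro i
    rw [eventually_all]
    intro j
    by_cases hij : i = j
    · simp [hij]
    have hc : ∀ i, Continuous fun x : ((∀ j, Fin (m j) → K) × (Fin (N + 1) → K)) × ℂ =>
        aeval x.2 (monicOf (x.1.1 i)) := fun i =>
      continuous_aeval_monicOf.comp (f := fun x : ((∀ j, Fin (m j) → K) × (Fin (N + 1) → K)) × ℂ =>
        (x.1.1 i, x.2)) (by fun_prop)
    refine (eventually_forall_ne_zero isCompact_circle ((hc i).prodMk (hc j)) ?_).mono
      fun w hw _ => hw
    intro z hz h0
    rw [Prod.mk_eq_zero] at h0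
    exact hpair i j hij z hz h0.1 h0.2
  have e2 : ∀ᶠ w in 𝓝 w₀, w.2 ≠ 0 ∧ (∀ z : ℂ, ‖z‖ = 1 → aeval z (polyOf w.2) ≠ 0) ∧
      typeOf K (polyOf w.2) = typeOf K (polyOf w₀.2) :=
    continuous_snd.continuousAt.eventually (eventually_typeOf_eq hv hv0)
  filter_upwards [e1, e2] with w h1 h2
  have hm0 : ∀ j, monicOf (w.1 j) ≠ 0 := fun j => (monic_monicOf _).ne_zero
  have hp0 : polyOf w.2 ≠ 0 := fun e => h2.1 (polyOf_eq_zero.1 e)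
  have hprod : ∏ j, monicOf (w.1 j) ≠ 0 := Finset.prod_ne_zero_iff.2 fun j _ => hm0 j
  refine ⟨mul_ne_zero hprod hp0, ?_⟩
  rw [mulPoly, typeOf_mul hprod hp0 fun z hz _ => h2.2.1 z (norm_eq_one z hz), h2.2.2, add_comm,
    typeOf_prod _ _ fun j _ => hm0 j]
  intro i _ j _ hij z hz hzi hzj
  exact h1 i j hij z (norm_eq_one z hz) (Prod.mk_eq_zero.2 ⟨hzi, hzj⟩)

/-- Near a nonzero polynomial whose circle roots have the kinds and multiplicities `f j`, the space
of polynomials of formal degree `n` is, by multiplication, a product of neighbourhoods of the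
powers `atom (z j) ^ (f j).2` in spaces of monic polynomials and of a linear space, and the type
is the sum of the types of the factors. -/
theorem exists_localStructure {n : ℕ} {x : Fin (n + 1) → K} (hx : x ≠ 0)
    {f : J → SignType × ℕ} {r : ℕ} (h : typeOf K (polyOf x) = (r, Finset.univ.val.map f)) :
    ∃ (z : J → ℂ) (w₀ : (∀ j, Fin (deg K (f j).1 * (f j).2) → K) ×
        (Fin (n - ∑ j, deg K (f j).1 * (f j).2 + 1) → K))
      (φ : OpenPartialHomeomorph ((∀ j, Fin (deg K (f j).1 * (f j).2) → K) ×
        (Fin (n - ∑ j, deg K (f j).1 * (f j).2 + 1) → K)) (Fin (n + 1) → K)),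
      (∑ j, deg K (f j).1 * (f j).2 ≤ n) ∧
      (∀ j, z j ∈ rep K ∧ kind K (z j) = (f j).1 ∧ (f j).2 ≠ 0 ∧
        monicOf (w₀.1 j) = atom (z j) ^ (f j).2) ∧
      w₀ ∈ φ.source ∧ φ w₀ = x ∧ (∀ w, polyOf (φ w) = mulPoly w) ∧
      ContDiffOn ℝ ∞ φ φ.source ∧ ContDiffOn ℝ ∞ φ.symm φ.target ∧
      ∀ᶠ w in 𝓝 w₀, φ w ≠ 0 ∧
        typeOf K (polyOf (φ w)) = (r, 0) + ∑ j, typeOf K (monicOf (w.1 j)) := by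
  have hp : polyOf x ≠ 0 := fun e => hx (polyOf_eq_zero.1 e)
  obtain ⟨z, R, hinj, hrep, hkind, hpos, hpR, hR⟩ := exists_factorization hp h
  have hR0 : R ≠ 0 := by rintro rfl; exact hp (by rw [hpR, mul_zero])
  have hm : ∀ j, (atom (z j) ^ (f j).2 : K[X]).Monic := fun j => (monic_atom _ (hrep j)).pow _
  have hd : ∀ j, (atom (z j) ^ (f j).2 : K[X]).natDegree = deg K (f j).1 * (f j).2 := fun j => by
    rw [(monic_atom _ (hrep j)).natDegree_pow, natDegree_atom _ (hrep j), hkind j, mul_comm]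
  have hdeg : ∑ j, deg K (f j).1 * (f j).2 + R.natDegree ≤ n := by
    have := natDegree_polyOf_le x
    rw [hpR, (monic_prod_of_monic _ _ fun j _ => hm j).natDegree_mul' hR0,
      natDegree_prod_of_monic _ _ fun j _ => hm j] at this
    simpa only [hd] using this
  have hn : ∑ j, deg K (f j).1 * (f j).2 + (n - ∑ j, deg K (f j).1 * (f j).2) = n := by omega
  let w₀ : (∀ j, Fin (deg K (f j).1 * (f j).2) → K) ×
        (Fin (n - ∑ j, deg K (f j).1 * (f j).2 + 1) → K) :=
    (fun j => coeffVec _ (atom (z j) ^ (f j).2), coeffVec _ R)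
  have hw1 : ∀ j, monicOf (w₀.1 j) = atom (z j) ^ (f j).2 := fun j => monicOf_coeffVec (hm j) (hd j)
  have hw2 : polyOf w₀.2 = R := polyOf_coeffVec_succ (by omega)
  have hRc : ∀ y : ℂ, ‖y‖ = 1 → aeval y R ≠ 0 :=
    (typeOf_snd_eq_zero hR0).1 (by rw [hR])
  obtain ⟨φ, hs, hφ, hφ1, hφ2⟩ := exists_mulChart hn w₀
    (fun i j hij => by
      simp only [Function.onFun, hw1]
      exact (isCoprime_atom (hrep i) (hrep j) (hinj.ne hij)).pow)
    (fun j => by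
      rw [hw1, hw2]
      refine isCoprime_of_forall_aeval fun y hy => hRc y ?_
      rw [map_pow, pow_eq_zero_iff (hpos j)] at hy
      exact norm_of_aeval_atom _ (hrep j) y hy)
  have hφp : ∀ w, polyOf (φ w) = mulPoly w := fun w => by
    rw [hφ, polyOf_coeffVec_succ (natDegree_mulPoly_le hn w)]
  refine ⟨z, w₀, φ, by omega, fun j => ⟨hrep j, hkind j, hpos j, hw1 j⟩, hs, ?_, hφp, hφ1, hφ2, ?_⟩
  · have : polyOf (φ w₀) = polyOf x := by
      rw [hφp, mulPoly, hw2, hpR]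
      simp only [hw1]
    rw [← coeffVec_polyOf (φ w₀), this, coeffVec_polyOf]
  · have := eventually_typeOf_mulPoly (w₀ := w₀) ?_ ?_ (by rw [hw2, hR])
    · filter_upwards [this] with w hw
      rw [hφp, hw.2, hw2, hR]
      refine ⟨fun e => hw.1 ?_, rfl⟩
      rw [← hφp, e, polyOf_eq_zero]
    · intro i j hij y hy hyi hyj
      rw [hw1, map_pow, pow_eq_zero_iff (hpos _)] at hyi hyj
      obtain ⟨y', hy', hyp⟩ := exists_rep (K := K) y hy
      exact hij (hinj ((eq_of_aeval_atom _ (hrep i) y' hy' (hyp _ hyi)).symm.trans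
        (eq_of_aeval_atom _ (hrep j) y' hy' (hyp _ hyj))))
    · intro e
      rw [e, polyOf_eq_zero.2 rfl] at hw2
      exact hR0 hw2.symm

end LocalStructure

/-! ### Constructions of submanifolds -/

section Submanifolds

variable {E : Type} [NormedAddCommGroup E] [NormedSpace ℝ E]

lemma isSubmanifold_singleton (x : E) : IsSubmanifold {x} (Module.finrank ℝ E) := by
  rintro y rfl
  refine ⟨(Homeomorph.addRight (-y)).toOpenPartialHomeomorph, ⊥, by simp, ?_, ?_, by simp, ?_⟩
  · exact (contDiff_id.add contDiff_const).contDiffOn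
  · exact (contDiff_id.add contDiff_const).contDiffOn
  · intro z _
    simp [add_neg_eq_zero]

lemma IsSubmanifold.pi {J : Type} [Fintype J] {X : J → Type} [∀ j, NormedAddCommGroup (X j)]
    [∀ j, NormedSpace ℝ (X j)] [∀ j, FiniteDimensional ℝ (X j)] {M : ∀ j, Set (X j)} {d : J → ℕ}
    (h : ∀ j, IsSubmanifold (M j) (d j)) :
    IsSubmanifold {u : ∀ j, X j | ∀ j, u j ∈ M j} (∑ j, d j) := by
  intro u hu
  choose φ W hs h1 h2 hd hW using fun j => h j (u j) (hu j)
  refine ⟨OpenPartialHomeomorph.pi φ, Submodule.pi Set.univ W, ?_, ?_, ?_, ?_, ?_⟩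
  · simpa using hs
  · rw [contDiffOn_pi]
    intro j
    refine (h1 j).comp (contDiff_pi.1 contDiff_id j).contDiffOn ?_
    intro v hv
    exact (Set.mem_univ_pi.1 (by simpa using hv)) j
  · rw [contDiffOn_pi]
    intro j
    refine (h2 j).comp (contDiff_pi.1 contDiff_id j).contDiffOn ?_
    intro v hv
    exact (Set.mem_univ_pi.1 (by simpa using hv)) j
  · have e : Module.finrank ℝ (Submodule.pi Set.univ W) = ∑ j, Module.finrank ℝ (W j) := by
      let e : (Submodule.pi Set.univ W) ≃ₗ[ℝ] ∀ j, W j :=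
        { toFun := fun x j => ⟨x.1 j, x.2 j (Set.mem_univ j)⟩
          invFun := fun y => ⟨fun j => (y j).1, fun j _ => (y j).2⟩
          map_add' := fun _ _ => rfl
          map_smul' := fun _ _ => rfl
          left_inv := fun _ => rfl
          right_inv := fun _ => rfl }
      rw [e.finrank_eq, Module.finrank_pi_fintype]
    rw [e, Module.finrank_pi_fintype, ← Finset.sum_add_distrib]
    exact Finset.sum_congr rfl fun j _ => hd j
  · intro v hv
    have hv' : ∀ j, v j ∈ (φ j).source := by simpa using hv
    simp only [Set.mem_ofPred_eq, Submodule.mem_pi, Set.mem_univ, true_implies]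
    exact forall_congr' fun j => hW j (v j) (hv' j)

lemma IsSubmanifold.prod_univ {Y : Type} [NormedAddCommGroup Y] [NormedSpace ℝ Y]
    [FiniteDimensional ℝ E] [FiniteDimensional ℝ Y] {M : Set E} {d : ℕ} (h : IsSubmanifold M d) :
    IsSubmanifold {w : E × Y | w.1 ∈ M} d := by
  intro w hw
  obtain ⟨φ, W, hs, h1, h2, hd, hW⟩ := h w.1 hw
  refine ⟨φ.prod (OpenPartialHomeomorph.refl Y), W.prod ⊤, ?_, ?_, ?_, ?_, ?_⟩
  · simpa using hs
  · refine ContDiffOn.prodMk ?_ contDiff_snd.contDiffOn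
    exact h1.comp contDiff_fst.contDiffOn fun v hv => by simpa using hv
  · refine ContDiffOn.prodMk ?_ contDiff_snd.contDiffOn
    exact h2.comp contDiff_fst.contDiffOn fun v hv => by simpa using hv
  · let e : (W.prod (⊤ : Submodule ℝ Y)) ≃ₗ[ℝ] W × Y :=
      { toFun := fun x => (⟨x.1.1, x.2.1⟩, x.1.2)
        invFun := fun y => ⟨(y.1.1, y.2), y.1.2, trivial⟩
        map_add' := fun _ _ => rfl
        map_smul' := fun _ _ => rfl
        left_inv := fun _ => rfl
        right_inv := fun _ => rfl }
    rw [e.finrank_eq, Module.finrank_prod, Module.finrank_prod]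
    omega
  · intro v hv
    have hv' : v.1 ∈ φ.source := by simpa using hv
    simpa using hW v.1 hv'

/-- A set that corresponds to a submanifold under local diffeomorphisms is a submanifold. -/
lemma isSubmanifold_of_charts [FiniteDimensional ℝ E] {M : Set E} {d : ℕ}
    (h : ∀ x ∈ M, ∃ (F : Type) (_ : NormedAddCommGroup F) (_ : NormedSpace ℝ F)
      (_ : FiniteDimensional ℝ F) (φ : OpenPartialHomeomorph F E) (w : F) (N : Set F),
      Module.finrank ℝ F = Module.finrank ℝ E ∧ w ∈ φ.source ∧ φ w = x ∧
      ContDiffOn ℝ ∞ φ φ.source ∧ ContDiffOn ℝ ∞ φ.symm φ.target ∧ IsSubmanifold N d ∧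
      ∀ᶠ y in 𝓝 w, φ y ∈ M ↔ y ∈ N) : IsSubmanifold M d := by
  intro x hx
  obtain ⟨F, _, _, _, φ, w, N, hF, hw, rfl, h1, h2, hN, hev⟩ := h x hx
  obtain ⟨O, hO, hOo, hwO⟩ := eventually_nhds_iff.1 hev
  obtain ⟨ψ, W, hs, g1, g2, hd, hW⟩ := hN w ((hO w hwO).1 hx)
  let e : F ≃L[ℝ] E := ContinuousLinearEquiv.ofFinrankEq hF
  let χ := (φ.restrOpen O hOo).symm
  have hχs : ∀ y, y ∈ χ.source → y ∈ φ.target ∧ φ.symm y ∈ O := by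
    intro y hy
    have h3 := χ.map_source hy
    have h4 : χ y ∈ φ.source ∩ O := by
      have : χ.target = φ.source ∩ O := by
        simp only [χ, OpenPartialHomeomorph.symm_target, OpenPartialHomeomorph.restrOpen_source]
      rw [← this]; exact h3
    have h5 : φ (χ y) = y := χ.left_inv hy
    exact ⟨h5 ▸ φ.map_source h4.1, h4.2⟩
  have hχc : ⇑χ = φ.symm := rfl
  have hχc' : ⇑χ.symm = φ := rfl
  refine ⟨(χ.trans ψ).trans e.toHomeomorph.toOpenPartialHomeomorph,
    W.map (e.toLinearEquiv : F →ₗ[ℝ] E), ?_, ?_, ?_, ?_, ?_⟩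
  · have hmem : φ w ∈ χ.source := by
      have : w ∈ (φ.restrOpen O hOo).source := by
        rw [OpenPartialHomeomorph.restrOpen_source]; exact ⟨hw, hwO⟩
      exact (φ.restrOpen O hOo).map_source this
    simp only [OpenPartialHomeomorph.trans_source, Homeomorph.toOpenPartialHomeomorph_source,
      Set.preimage_univ, Set.inter_univ, Set.mem_inter_iff, Set.mem_preimage]
    refine ⟨hmem, ?_⟩
    rw [hχc, φ.left_inv hw]; exact hs
  · refine e.contDiff.comp_contDiffOn ?_
    simp only [OpenPartialHomeomorph.trans_source, Homeomorph.toOpenPartialHomeomorph_source,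
      Set.preimage_univ, Set.inter_univ, OpenPartialHomeomorph.coe_trans]
    refine g1.comp (h2.mono fun y hy => (hχs y hy.1).1) ?_
    intro y hy
    exact hy.2
  · have hsm : ContDiffOn ℝ ∞ (χ.trans ψ).symm (χ.trans ψ).target := by
      simp only [OpenPartialHomeomorph.trans_symm_eq_symm_trans_symm,
        OpenPartialHomeomorph.coe_trans, OpenPartialHomeomorph.trans_target]
      refine ContDiffOn.comp (t := φ.source) (h1.congr fun y _ => by rw [hχc'])
        (g2.mono fun y hy => hy.1) ?_
      intro y hy
      have : ψ.symm y ∈ χ.target := hy.2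
      have h6 : χ.target = φ.source ∩ O := by
        simp only [χ, OpenPartialHomeomorph.symm_target, OpenPartialHomeomorph.restrOpen_source]
      rw [h6] at this
      exact this.1
    refine ContDiffOn.comp (g := (χ.trans ψ).symm) (f := e.symm) (t := (χ.trans ψ).target) hsm
      e.symm.contDiff.contDiffOn ?_
    intro y hy
    rw [OpenPartialHomeomorph.trans_target] at hy
    exact hy.2
  · rw [← hF, ← hd, LinearEquiv.finrank_map_eq e.toLinearEquiv W]
  · intro y hy
    simp only [OpenPartialHomeomorph.trans_source, Homeomorph.toOpenPartialHomeomorph_source,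
      Set.preimage_univ, Set.inter_univ, Set.mem_inter_iff, Set.mem_preimage] at hy
    have h7 := hχs y hy.1
    have h8 : φ (φ.symm y) = y := φ.right_inv h7.1
    have h9 := hO _ h7.2
    rw [h8] at h9
    rw [h9]
    have h10 := hW _ hy.2
    rw [hχc] at h10
    rw [h10]
    simp only [OpenPartialHomeomorph.coe_trans, Function.comp_apply, hχc]
    constructor
    · intro h11
      exact ⟨_, h11, rfl⟩
    · rintro ⟨v, hv, hve⟩
      have : v = ψ (φ.symm y) := e.injective hve
      rw [← this]; exact hv

/-- A curve that is locally the graph of a smooth function over an interval of a line. -/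
lemma isSubmanifold_of_graph [FiniteDimensional ℝ E] {M : Set E}
    (h : ∀ x ∈ M, ∃ (O : Set E) (L : E →L[ℝ] ℝ) (v : E) (g : ℝ → E) (I : Set ℝ),
      IsOpen O ∧ x ∈ O ∧ IsOpen I ∧ L v = 1 ∧ ContDiffOn ℝ ∞ g I ∧ (∀ t ∈ I, L (g t) = t) ∧
      ∀ y ∈ O, y ∈ M ↔ ∃ t ∈ I, y = g t) : IsSubmanifold M (Module.finrank ℝ E - 1) := by
  intro x hx
  obtain ⟨O, L, v, g, I, hO, hxO, hI, hLv, hg, hLg, hM⟩ := h x hx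
  have hsm : ∀ s : ℝ → E, ContDiffOn ℝ ∞ s I → ContDiffOn ℝ ∞ (fun y => s (L y)) (L ⁻¹' I) :=
    fun s hs => hs.comp L.contDiff.contDiffOn fun y hy => hy
  have hf : ContDiffOn ℝ ∞ (fun y => y - g (L y) + L y • v) (L ⁻¹' I) :=
    (contDiffOn_id.sub (hsm g hg)).add (L.contDiff.contDiffOn.smul contDiffOn_const)
  have hf' : ContDiffOn ℝ ∞ (fun y => y + g (L y) - L y • v) (L ⁻¹' I) :=
    (contDiffOn_id.add (hsm g hg)).sub (L.contDiff.contDiffOn.smul contDiffOn_const)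
  have hL1 : ∀ y, L y ∈ I → L (y - g (L y) + L y • v) = L y := by
    intro y hy; simp [hLg _ hy, hLv]
  have hL2 : ∀ y, L y ∈ I → L (y + g (L y) - L y • v) = L y := by
    intro y hy; simp [hLg _ hy, hLv]
  let φ : OpenPartialHomeomorph E E :=
    { toFun := fun y => y - g (L y) + L y • v
      invFun := fun y => y + g (L y) - L y • v
      source := L ⁻¹' I
      target := L ⁻¹' I
      map_source' := fun y hy => by rw [Set.mem_preimage, hL1 y hy]; exact hy
      map_target' := fun y hy => by rw [Set.mem_preimage, hL2 y hy]; exact hy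
      left_inv' := fun y hy => by
        simp only [hL1 y hy]; abel
      right_inv' := fun y hy => by
        simp only [hL2 y hy]; abel
      open_source := hI.preimage L.continuous
      open_target := hI.preimage L.continuous
      continuousOn_toFun := hf.continuousOn
      continuousOn_invFun := hf'.continuousOn }
  obtain ⟨t, ht, rfl⟩ := (hM x hxO).1 hx
  have hv0 : v ≠ 0 := by rintro rfl; simp at hLv
  refine ⟨φ.restrOpen O hO, Submodule.span ℝ {v}, ?_, ?_, ?_, ?_, ?_⟩
  · rw [OpenPartialHomeomorph.restrOpen_source]
    exact ⟨by change L (g t) ∈ I; rw [hLg t ht]; exact ht, hxO⟩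
  · rw [OpenPartialHomeomorph.restrOpen_source]
    exact hf.mono Set.inter_subset_left
  · refine hf'.mono fun y hy => ?_
    exact hy.1
  · rw [finrank_span_singleton hv0]
    have : 0 < Module.finrank ℝ E := Module.finrank_pos_iff_exists_ne_zero.2 ⟨v, hv0⟩
    omega
  · intro y hy
    rw [OpenPartialHomeomorph.restrOpen_source] at hy
    have hy1 : L y ∈ I := hy.1
    rw [hM y hy.2, Submodule.mem_span_singleton]
    change _ ↔ ∃ a : ℝ, a • v = y - g (L y) + L y • v
    constructor
    · rintro ⟨s, hs, rfl⟩
      exact ⟨L (g s), by simp [hLg s hs]⟩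
    · rintro ⟨a, ha⟩
      have : a = L y := by
        have := congrArg L ha
        rw [hL1 y hy1] at this
        simpa [hLv] using this
      refine ⟨L y, hy1, ?_⟩
      rw [this] at ha
      have h0 : y - g (L y) = 0 := by simpa using ha.symm
      exact sub_eq_zero.1 h0

end Submanifolds

/-! ### The strata -/

/-- A `CircleModel` in which, moreover, the `μ`-th powers of the atoms of kind `0` form a curve in
the space of monic polynomials, and in which the neighbourhoods of any two points of this curve
look alike, as far as types are concerned. -/
class MovingCircleModel (K : Type) [RCLike K] [NormedAlgebra K ℂ] extends CircleModel K where
  isSubmanifold_curve : ∀ μ : ℕ, μ ≠ 0 → IsSubmanifold {u : Fin (deg 0 * μ) → K |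
    ∃ z ∈ rep, kind z = 0 ∧ monicOf u = atom z ^ μ} (2 * μ - 1)
  exists_transport : ∀ z ∈ rep, ∀ z' ∈ rep, kind z = 0 → kind z' = 0 → ∀ μ : ℕ,
    ∃ g : (Fin (deg 0 * μ) → K) → (Fin (deg 0 * μ) → K),
      Tendsto g (𝓝 (coeffVec _ (atom z ^ μ))) (𝓝 (coeffVec _ (atom z' ^ μ))) ∧
      ∀ᶠ u in 𝓝 (coeffVec _ (atom z ^ μ)), typeOf K (monicOf (g u)) = typeOf K (monicOf u)

section Strata

variable {K : Type} [RCLike K] [NormedAlgebra K ℂ]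

lemma rootCodim_add_ite {a : SignType × ℕ} (h : a.2 ≠ 0) :
    rootCodim a + (if a.1 = 0 then 1 else 0) = weight a.1 * a.2 := by
  unfold rootCodim weight
  split_ifs <;> omega

lemma rootCodim_pos {a : SignType × ℕ} (h : a.2 ≠ 0) : 0 < rootCodim a := by
  unfold rootCodim
  split_ifs <;> omega

section

variable [CircleModel K]

open CircleModel

lemma count_ne_zero_of_mem_circleReps {Λ : Multiset ℂ} {y : ℂ} (hy : y ∈ circleReps K Λ) :
    Λ.count y ≠ 0 := by
  rw [Multiset.count_ne_zero]
  exact (mem_circleReps.1 hy).1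

/-- The degree bound for the number of roots, in terms of real dimensions. -/
lemma finrank_mul_add_sum_weight_le {p : K[X]} (hp : p ≠ 0) :
    Module.finrank ℝ K * (typeOf K p).1 + ∑ y ∈ circleReps K (p.aroots ℂ),
      weight (kind K y) * (p.aroots ℂ).count y ≤ Module.finrank ℝ K * p.natDegree := by
  have h := Nat.mul_le_mul_left (Module.finrank ℝ K) (add_sum_le_natDegree hp)
  rw [mul_add] at h
  refine le_trans (le_of_eq ?_) h
  congr 1
  have e : ((typeOf K p).2.map fun a => deg K a.1 * a.2).sum =
      ∑ y ∈ circleReps K (p.aroots ℂ), deg K (kind K y) * (p.aroots ℂ).count y := by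
    simp only [typeOf, typ, Multiset.map_map]
    rfl
  rw [e, Finset.mul_sum]
  refine Finset.sum_congr rfl fun y hy => ?_
  rw [← mul_assoc, finrank_mul_deg y (mem_circleReps.1 hy).2]

lemma typeCodim_typeOf (p : K[X]) : typeCodim (typeOf K p).2 =
    ∑ y ∈ circleReps K (p.aroots ℂ), rootCodim (kind K y, (p.aroots ℂ).count y) := by
  simp only [typeCodim, typeOf, typ, Multiset.map_map]
  rfl

/-- The codimension of a type is the real dimension of the conditions that all circle roots are
fixed, minus one for each root that moves. -/
lemma typeCodim_add_sum (p : K[X]) : typeCodim (typeOf K p).2 +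
    ∑ y ∈ circleReps K (p.aroots ℂ), (if kind K y = 0 then 1 else 0) =
    ∑ y ∈ circleReps K (p.aroots ℂ), weight (kind K y) * (p.aroots ℂ).count y := by
  rw [typeCodim_typeOf, ← Finset.sum_add_distrib]
  exact Finset.sum_congr rfl fun y hy => rootCodim_add_ite (count_ne_zero_of_mem_circleReps hy)

/-- Polynomials near a power of an atom either are powers of an atom of the same kind or have a
type of smaller codimension. -/
lemma eventually_typeCodim_lt {z : ℂ} (hz : z ∈ rep K) {κ : SignType} (hκ : kind K z = κ) {μ : ℕ}
    (hμ : μ ≠ 0) {u₀ : Fin (deg K κ * μ) → K} (hu₀ : monicOf u₀ = atom z ^ μ) :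
    ∀ᶠ u in 𝓝 u₀, typeOf K (monicOf u) = (0, {(κ, μ)}) ∨
      typeCodim (typeOf K (monicOf u)).2 < rootCodim (κ, μ) := by
  have hfin : {y | y ∈ rep K ∧ kind K y ≠ 0}.Finite := by
    refine Set.Finite.of_finite_image (f := kind K) (Set.toFinite _) ?_
    intro y hy y' hy' h
    exact kind_inj y hy.1 y' hy'.1 h hy.2
  have hev : ∀ᶠ u in 𝓝 u₀, ∀ y ∈ {y | y ∈ rep K ∧ kind K y ≠ 0}, y ≠ z →
      aeval y (monicOf u) ≠ 0 := by
    rw [eventually_all_finite hfin]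
    intro y hy
    by_cases hyz : y = z
    · simp [hyz]
    have hc : Continuous fun u : Fin (deg K κ * μ) → K => aeval y (monicOf u) :=
      continuous_aeval_monicOf.comp (continuous_id.prodMk continuous_const)
    refine (hc.continuousAt.eventually_ne ?_).mono fun u hu _ => hu
    rw [hu₀, map_pow]
    refine pow_ne_zero _ fun h0 => hyz ?_
    exact eq_of_aeval_atom z hz y hy.1 h0
  filter_upwards [hev] with u hu
  have hp0 : monicOf u ≠ 0 := (monic_monicOf u).ne_zero
  set p := monicOf u with hp
  have hspec : ∀ y ∈ circleReps K (p.aroots ℂ), kind K y ≠ 0 → y = z := by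
    intro y hy hk
    by_contra hne
    have hy := mem_circleReps.1 hy
    exact hu y ⟨hy.2, hk⟩ hne (mem_aroots.1 hy.1).2
  have hle := finrank_mul_add_sum_weight_le hp0
  have hdeg : Module.finrank ℝ K * p.natDegree = weight κ * μ := by
    rw [hp, natDegree_monicOf, ← mul_assoc, ← hκ, finrank_mul_deg z hz]
  rw [hdeg] at hle
  have hadd := typeCodim_add_sum p
  have hroot := rootCodim_add_ite (a := (κ, μ)) hμ
  have hDpos : 0 < Module.finrank ℝ K := Module.finrank_pos
  rcases Nat.lt_or_ge 1 (circleReps K (p.aroots ℂ)).card with hcard | hcard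
  · right
    have h2 : (if κ = 0 then 1 else 0) + 1 ≤
        ∑ y ∈ circleReps K (p.aroots ℂ), (if kind K y = 0 then 1 else 0) := by
      split_ifs with hκ0
      · rw [Finset.sum_congr rfl (g := fun _ => 1)]
        · simp only [Finset.sum_const, smul_eq_mul, mul_one]
          omega
        · intro y hy
          by_cases hk : kind K y = 0
          · simp [hk]
          · have := hspec y hy hk
            rw [this, hκ] at hk
            exact absurd hκ0 hk
      · obtain ⟨y, hy, hyz⟩ := Finset.exists_mem_ne hcard z
        have hk : kind K y = 0 := by
          by_contra hk
          exact hyz (hspec y hy hk)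
        refine le_trans (by simp [hk]) (Finset.single_le_sum
          (f := fun y => if kind K y = 0 then 1 else 0) (fun _ _ => Nat.zero_le _) hy)
    have h3 := Nat.zero_le (Module.finrank ℝ K * (typeOf K p).1)
    simp only at hroot
    omega
  · rcases Nat.le_one_iff_eq_zero_or_eq_one.1 hcard with h0 | h1
    · right
      rw [typeCodim_typeOf, Finset.card_eq_zero.1 h0, Finset.sum_empty]
      exact rootCodim_pos hμ
    · obtain ⟨y, hy⟩ := Finset.card_eq_one.1 h1
      have hym : y ∈ circleReps K (p.aroots ℂ) := by rw [hy]; simp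
      rw [typeCodim_typeOf]
      simp only [hy, Finset.sum_singleton] at hle ⊢
      have hc0 := count_ne_zero_of_mem_circleReps hym
      set c := (p.aroots ℂ).count y with hc
      by_cases hk : kind K y = κ
      · rw [hk] at hle ⊢
        have hwpos : 0 < weight κ := by unfold weight; split_ifs <;> norm_num
        have hcμ : c ≤ μ := Nat.le_of_mul_le_mul_left (by omega) hwpos
        rcases hcμ.eq_or_lt with he | hlt
        · left
          have hs : (typeOf K p).1 = 0 := by
            rw [he] at hle
            have : Module.finrank ℝ K * (typeOf K p).1 = 0 := by omega
            exact (Nat.mul_eq_zero.1 this).resolve_left hDpos.ne'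
          refine Prod.ext hs ?_
          simp only [typeOf, typ, hy, Finset.singleton_val, Multiset.map_singleton, hk]
          rw [← he, hc]
        · right
          unfold rootCodim
          simp only
          split_ifs <;> omega
      · right
        have hk0 : kind K y = 0 := by
          by_contra hk0
          have := hspec y hym hk0
          exact hk (this ▸ hκ)
        have hκ0 : κ ≠ 0 := fun e => hk (hk0.trans e.symm)
        rw [hk0] at hle ⊢
        simp only [weight, rootCodim, if_neg hκ0, if_true] at hle ⊢
        omega

/-- A monic polynomial of the type and the degree of a power of an atom is a power of an atom. -/
lemma exists_eq_atom_pow {κ : SignType} {μ : ℕ} {u : Fin (deg K κ * μ) → K}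
    (h : typeOf K (monicOf u) = (0, {(κ, μ)})) :
    ∃ z ∈ rep K, kind K z = κ ∧ monicOf u = atom z ^ μ := by
  obtain ⟨z, R, -, hrep, hkind, -, hpR, -⟩ := exists_factorization (monic_monicOf u).ne_zero
    (J := Unit) (f := fun _ => (κ, μ)) (r := 0) (by rw [h]; rfl)
  simp only [Finset.univ_unique, Finset.prod_singleton] at hpR
  have hm : (atom (z default) ^ μ : K[X]).Monic := (monic_atom _ (hrep _)).pow μ
  have hRm : R.Monic := hm.of_mul_monic_left (hpR ▸ monic_monicOf u)
  have hdeg := congrArg natDegree hpR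
  rw [natDegree_monicOf, hm.natDegree_mul hRm, (monic_atom _ (hrep _)).natDegree_pow,
    natDegree_atom _ (hrep _), hkind] at hdeg
  have hR1 : R = 1 := hRm.natDegree_eq_zero.1 (by rw [mul_comm] at hdeg; simp only at hdeg; omega)
  exact ⟨z default, hrep _, hkind _, by rw [hpR, hR1, mul_one]⟩

variable (K) in
/-- The stratum of nonzero polynomials of formal degree `n` of type `θ`. -/
def stratum (n : ℕ) (θ : ℕ × Multiset (SignType × ℕ)) : Set (Fin (n + 1) → K) :=
  {x | x ≠ 0 ∧ typeOf K (polyOf x) = θ}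

lemma exists_enumeration {α : Type} (M : Multiset α) :
    ∃ (l : ℕ) (f : Fin l → α), M = Finset.univ.val.map f := by
  obtain ⟨L, rfl⟩ := Quot.exists_rep M
  exact ⟨L.length, L.get, by simp [Fin.univ_val_map]⟩

lemma sum_prod_singleton {J α : Type} [Fintype J] (f : J → α) (r : ℕ) :
    ((r, 0) : ℕ × Multiset α) + ∑ j, (0, {f j}) = (r, Finset.univ.val.map f) := by
  refine Prod.ext ?_ ?_
  · simp [Prod.fst_sum]
  · simp only [Prod.snd_add, zero_add, Prod.snd_sum]
    conv_rhs => rw [← Multiset.sum_map_singleton (Finset.univ.val.map f), Multiset.map_map]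
    rfl

/-- The type of a stratum whose closure contains `x` is either the type of `x` or of smaller
codimension. -/
theorem typeCodim_lt_of_mem_closure {n : ℕ} {x : Fin (n + 1) → K} (hx : x ≠ 0)
    {θ : ℕ × Multiset (SignType × ℕ)} (hθ : typeOf K (polyOf x) ≠ θ)
    (hc : x ∈ closure (stratum K n θ)) :
    typeCodim θ.2 < typeCodim (typeOf K (polyOf x)).2 := by
  obtain ⟨l, f, hf⟩ := exists_enumeration (typeOf K (polyOf x)).2
  obtain ⟨z, w₀, φ, -, hz, hs, hφx, -, -, -, hev⟩ :=
    exists_localStructure hx (f := f) (r := (typeOf K (polyOf x)).1) (Prod.ext rfl hf)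
  have hnear : ∀ᶠ w in 𝓝 w₀, ∀ j, typeOf K (monicOf (w.1 j)) = (0, {f j}) ∨
      typeCodim (typeOf K (monicOf (w.1 j))).2 < rootCodim (f j) := by
    rw [eventually_all]
    intro j
    have := eventually_typeCodim_lt (hz j).1 (hz j).2.1 (hz j).2.2.1 (hz j).2.2.2
    exact ((continuous_apply j).comp continuous_fst).continuousAt.eventually this
  rw [mem_closure_iff_frequently, ← hφx, ← φ.map_nhds_eq hs, frequently_map] at hc
  obtain ⟨w, hw, hw1, hw2⟩ := (hc.and_eventually (hev.and hnear)).exists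
  have hsum := hw1.2
  rw [hw.2] at hsum
  have h1 : typeCodim θ.2 = ∑ j, typeCodim (typeOf K (monicOf (w.1 j))).2 := by
    rw [hsum]
    simp only [Prod.snd_add, zero_add, Prod.snd_sum]
    exact map_sum (⟨⟨typeCodim, typeCodim_zero⟩, typeCodim_add⟩ :
      Multiset (SignType × ℕ) →+ ℕ) _ _
  have h2 : typeCodim (typeOf K (polyOf x)).2 = ∑ j, rootCodim (f j) := by
    rw [hf, typeCodim, Multiset.map_map]; rfl
  rw [h1, h2]
  have hle : ∀ j, typeCodim (typeOf K (monicOf (w.1 j))).2 ≤ rootCodim (f j) := by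
    intro j
    rcases hw2 j with h | h
    · rw [h]; simp [typeCodim]
    · exact h.le
  by_contra hlt
  apply hθ
  have hall : ∀ j, typeOf K (monicOf (w.1 j)) = (0, {f j}) := by
    intro j
    refine (hw2 j).resolve_right fun h => hlt ?_
    exact Finset.sum_lt_sum (fun i _ => hle i) ⟨j, Finset.mem_univ j, h⟩
  rw [hsum]
  simp only [hall]
  rw [sum_prod_singleton, ← hf]

/-- Every stratum has positive dimension. -/
lemma typeCodim_lt_of_nonempty {n : ℕ} {θ : ℕ × Multiset (SignType × ℕ)}
    (h : (stratum K n θ).Nonempty) : typeCodim θ.2 < Module.finrank ℝ (Fin (n + 1) → K) := by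
  obtain ⟨x, hx, rfl⟩ := h
  have hp : polyOf x ≠ 0 := fun e => hx (polyOf_eq_zero.1 e)
  have h1 := finrank_mul_add_sum_weight_le hp
  have h2 := typeCodim_add_sum (polyOf x)
  have h3 : Module.finrank ℝ K * (polyOf x).natDegree ≤ Module.finrank ℝ K * n :=
    Nat.mul_le_mul_left _ (natDegree_polyOf_le x)
  have h4 : Module.finrank ℝ (Fin (n + 1) → K) = Module.finrank ℝ K * n + Module.finrank ℝ K := by
    simp [Module.finrank_pi_fintype]; ring
  have h5 : 0 < Module.finrank ℝ K := Module.finrank_pos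
  have h6 := Nat.zero_le (Module.finrank ℝ K * (typeOf K (polyOf x)).1)
  omega

/-- Strata are invariant under nonzero scalars. -/
lemma zero_mem_closure_stratum {n : ℕ} {θ : ℕ × Multiset (SignType × ℕ)}
    (h : (stratum K n θ).Nonempty) : (0 : Fin (n + 1) → K) ∈ closure (stratum K n θ) := by
  obtain ⟨x, hx, hxθ⟩ := h
  have hc : Continuous fun t : K => t • x := by fun_prop
  have ht : Tendsto (fun t : K => t • x) (𝓝[≠] 0) (𝓝 0) := by
    have := hc.tendsto 0
    rw [zero_smul] at this
    exact this.mono_left nhdsWithin_le_nhds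
  refine mem_closure_of_tendsto ht ?_
  filter_upwards [self_mem_nhdsWithin] with t ht
  have ht : t ≠ 0 := ht
  refine ⟨smul_ne_zero ht hx, ?_⟩
  rw [polyOf_smul, typeOf, aroots_C_mul _ ht]
  exact hxθ

lemma finite_types (n : ℕ) : {θ | (stratum K n θ).Nonempty}.Finite := by
  let s : Finset (SignType × ℕ) := Finset.univ ×ˢ Finset.range (n + 1)
  refine ((Set.finite_Iic n).prod (Set.finite_Iic (n • s.val))).subset ?_
  rintro θ ⟨x, hx, rfl⟩
  classical
  have hp : polyOf x ≠ 0 := fun e => hx (polyOf_eq_zero.1 e)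
  have hdeg : ∀ Λ : Multiset ℂ, Λ ≤ (polyOf x).aroots ℂ → Λ.card ≤ n := fun Λ h =>
    (Multiset.card_le_card h).trans ((card_roots' _).trans
      (natDegree_map_le.trans (natDegree_polyOf_le x)))
  constructor
  · exact (Multiset.countP_le_card _ _).trans (hdeg _ le_rfl)
  · change (typeOf K (polyOf x)).2 ≤ n • s.val
    rw [Multiset.le_iff_count]
    intro a
    by_cases ha : a ∈ (typeOf K (polyOf x)).2
    · have has : a ∈ s := by
        simp only [typeOf, typ, Multiset.mem_map] at ha
        obtain ⟨y, -, rfl⟩ := ha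
        simp only [s, Finset.mem_product, Finset.mem_univ, true_and, Finset.mem_range]
        exact Nat.lt_succ_of_le ((Multiset.count_le_card _ _).trans (hdeg _ le_rfl))
      rw [Multiset.count_nsmul, Multiset.count_eq_one_of_mem s.nodup has, mul_one]
      refine (Multiset.count_le_card _ _).trans ?_
      simp only [typeOf, typ, Multiset.card_map]
      refine hdeg _ ?_
      rw [Finset.val_le_iff_val_subset]
      intro y hy
      exact (mem_circleReps.1 hy).1
    · rw [Multiset.count_eq_zero_of_notMem ha]
      exact Nat.zero_le _

lemma isOpen_stratum (n r : ℕ) : IsOpen (stratum K n (r, 0)) := by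
  rw [isOpen_iff_mem_nhds]
  rintro x ⟨hx, hxr⟩
  filter_upwards [eventually_typeOf_eq hx (by rw [hxr])] with y hy
  exact ⟨hy.1, hy.2.2.trans hxr⟩

end

section

variable [MovingCircleModel K]

open CircleModel MovingCircleModel

lemma isSubmanifold_atom_pow {κ : SignType} (h : ∃ z ∈ rep K, kind K z = κ) {μ : ℕ} (hμ : μ ≠ 0) :
    IsSubmanifold {u : Fin (deg K κ * μ) → K | ∃ z ∈ rep K, kind K z = κ ∧ monicOf u = atom z ^ μ}
      (rootCodim (κ, μ)) := by
  by_cases hκ : κ = 0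
  · subst hκ
    simpa [rootCodim] using isSubmanifold_curve (K := K) μ hμ
  · obtain ⟨z, hz, hzκ⟩ := h
    have hdeg : (atom z ^ μ : K[X]).natDegree = deg K κ * μ := by
      rw [(monic_atom z hz).natDegree_pow, natDegree_atom z hz, hzκ, mul_comm]
    have hset : {u : Fin (deg K κ * μ) → K | ∃ z ∈ rep K, kind K z = κ ∧ monicOf u = atom z ^ μ} =
        {coeffVec _ (atom z ^ μ)} := by
      ext u
      simp only [Set.mem_ofPred_eq, Set.mem_singleton_iff]
      constructor
      · rintro ⟨y, hy, hyκ, hu⟩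
        have : y = z := kind_inj y hy z hz (hyκ.trans hzκ.symm) (hyκ ▸ hκ)
        rw [← this, ← hu, coeffVec_monicOf]
      · rintro rfl
        exact ⟨z, hz, hzκ, monicOf_coeffVec ((monic_atom z hz).pow μ) hdeg⟩
    have hcod : rootCodim (κ, μ) = Module.finrank ℝ (Fin (deg K κ * μ) → K) := by
      have h1 := finrank_mul_deg (K := K) z hz
      rw [hzκ] at h1
      rw [Module.finrank_pi_fintype]
      simp only [Finset.sum_const, Finset.card_univ, Fintype.card_fin, smul_eq_mul]
      rw [show deg K κ * μ * Module.finrank ℝ K = (Module.finrank ℝ K * deg K κ) * μ by ring, h1]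
      simp [rootCodim, weight, hκ]
    rw [hset, hcod]
    exact isSubmanifold_singleton _

/-- The strata are submanifolds: in the multiplication chart, a stratum is a product of curves and
points and of a linear space. -/
theorem isSubmanifold_stratum (n : ℕ) (θ : ℕ × Multiset (SignType × ℕ)) :
    IsSubmanifold (stratum K n θ) (typeCodim θ.2) := by
  obtain ⟨l, f, hf⟩ := exists_enumeration θ.2
  refine isSubmanifold_of_charts fun x hx => ?_
  obtain ⟨hx0, hxθ⟩ := hx
  obtain ⟨z, w₀, φ, hdeg, hz, hs, hφx, -, hφ1, hφ2, hev⟩ :=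
    exists_localStructure hx0 (f := f) (r := θ.1) (hxθ.trans (Prod.ext rfl hf))
  refine ⟨_, _, _, inferInstance, φ, w₀, {w | w.1 ∈ {u : ∀ j, Fin (deg K (f j).1 * (f j).2) → K |
    ∀ j, u j ∈ {u : Fin (deg K (f j).1 * (f j).2) → K |
      ∃ z ∈ rep K, kind K z = (f j).1 ∧ monicOf u = atom z ^ (f j).2}}},
    finrank_mulSpace (by omega), hs, hφx, hφ1, hφ2, ?_, ?_⟩
  · have hcod : typeCodim θ.2 = ∑ j, rootCodim ((f j).1, (f j).2) := by
      rw [hf, typeCodim, Multiset.map_map]; rfl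
    rw [hcod]
    exact (IsSubmanifold.pi fun j => isSubmanifold_atom_pow
      ⟨z j, (hz j).1, (hz j).2.1⟩ (hz j).2.2.1).prod_univ
  · have hnear : ∀ᶠ w in 𝓝 w₀, ∀ j, typeOf K (monicOf (w.1 j)) = (0, {f j}) ∨
        typeCodim (typeOf K (monicOf (w.1 j))).2 < rootCodim (f j) := by
      rw [eventually_all]
      intro j
      have := eventually_typeCodim_lt (hz j).1 (hz j).2.1 (hz j).2.2.1 (hz j).2.2.2
      exact ((continuous_apply j).comp continuous_fst).continuousAt.eventually this
    filter_upwards [hev, hnear] with w hw1 hw2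
    constructor
    · rintro ⟨-, hw⟩ j
      refine exists_eq_atom_pow ((hw2 j).resolve_right fun hlt => ?_)
      have hsum := hw1.2
      rw [hw] at hsum
      have h1 : typeCodim θ.2 = ∑ j, typeCodim (typeOf K (monicOf (w.1 j))).2 := by
        rw [hsum]
        simp only [Prod.snd_add, zero_add, Prod.snd_sum]
        exact map_sum (⟨⟨typeCodim, typeCodim_zero⟩, typeCodim_add⟩ :
          Multiset (SignType × ℕ) →+ ℕ) _ _
      have h2 : typeCodim θ.2 = ∑ j, rootCodim (f j) := by
        rw [hf, typeCodim, Multiset.map_map]; rfl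
      have hle : ∀ j, typeCodim (typeOf K (monicOf (w.1 j))).2 ≤ rootCodim (f j) := by
        intro j
        rcases hw2 j with h | h
        · rw [h]; simp [typeCodim]
        · exact h.le
      have := Finset.sum_lt_sum (fun i _ => hle i) ⟨j, Finset.mem_univ j, hlt⟩
      omega
    · intro hw
      refine ⟨hw1.1, ?_⟩
      rw [hw1.2]
      have hall : ∀ j, typeOf K (monicOf (w.1 j)) = (0, {f j}) := by
        intro j
        obtain ⟨y, hy, hyk, hyu⟩ := hw j
        rw [hyu, typeOf_atom_pow hy (hz j).2.2.1, hyk]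
      simp only [hall]
      rw [sum_prod_singleton, ← hf]

/-- Transport for all kinds: at a special point the two powers are equal. -/
lemma exists_transport_of_kind {κ : SignType} {μ : ℕ} {z z' : ℂ} (hz : z ∈ rep K)
    (hz' : z' ∈ rep K) (hk : kind K z = κ) (hk' : kind K z' = κ) {u u' : Fin (deg K κ * μ) → K}
    (hu : monicOf u = atom z ^ μ) (hu' : monicOf u' = atom z' ^ μ) :
    ∃ g : (Fin (deg K κ * μ) → K) → (Fin (deg K κ * μ) → K), Tendsto g (𝓝 u) (𝓝 u') ∧
      ∀ᶠ v in 𝓝 u, typeOf K (monicOf (g v)) = typeOf K (monicOf v) := by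
  by_cases hκ : κ = 0
  · subst hκ
    obtain ⟨g, hg⟩ := exists_transport (K := K) z hz z' hz' hk hk' μ
    rw [← hu, ← hu', coeffVec_monicOf, coeffVec_monicOf] at hg
    exact ⟨g, hg⟩
  · have hzz : z = z' := kind_inj z hz z' hz' (hk.trans hk'.symm) (hk ▸ hκ)
    have huu : u = u' := monicOf_injective (by rw [hu, hu', hzz])
    exact ⟨id, huu ▸ tendsto_id, Eventually.of_forall fun _ => rfl⟩

/-- The closure of a stratum is a union of strata (and `0`): if it contains one polynomial of a
type, it contains all of them, since their neighbourhoods look alike. -/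
theorem mem_closure_stratum_of_typeOf_eq {n : ℕ} {x x' : Fin (n + 1) → K} (hx : x ≠ 0)
    (hx' : x' ≠ 0) (h : typeOf K (polyOf x) = typeOf K (polyOf x'))
    {θ : ℕ × Multiset (SignType × ℕ)} (hc : x ∈ closure (stratum K n θ)) :
    x' ∈ closure (stratum K n θ) := by
  obtain ⟨l, f, hf⟩ := exists_enumeration (typeOf K (polyOf x)).2
  obtain ⟨z, w₀, φ, -, hz, hs, hφx, -, -, -, hev⟩ :=
    exists_localStructure hx (f := f) (r := (typeOf K (polyOf x)).1) (Prod.ext rfl hf)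
  obtain ⟨z', w₀', φ', -, hz', hs', hφx', -, -, -, hev'⟩ :=
    exists_localStructure hx' (f := f) (r := (typeOf K (polyOf x)).1)
      (h.symm.trans (Prod.ext rfl hf))
  choose g hg hgt using fun j => exists_transport_of_kind (hz j).1 (hz' j).1 (hz j).2.1 (hz' j).2.1
    (hz j).2.2.2 (hz' j).2.2.2
  rw [mem_closure_iff_frequently, ← hφx, ← φ.map_nhds_eq hs, frequently_map] at hc
  rw [mem_closure_iff_frequently, ← hφx', ← φ'.map_nhds_eq hs', frequently_map]
  have hcj : ∀ j, Tendsto (fun w : (∀ j, Fin (deg K (f j).1 * (f j).2) → K) ×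
      (Fin (n - ∑ j, deg K (f j).1 * (f j).2 + 1) → K) => w.1 j) (𝓝 w₀) (𝓝 (w₀.1 j)) := fun j =>
    Continuous.tendsto (by fun_prop) w₀
  have hG : Tendsto (fun w : (∀ j, Fin (deg K (f j).1 * (f j).2) → K) ×
      (Fin (n - ∑ j, deg K (f j).1 * (f j).2 + 1) → K) => ((fun j => g j (w.1 j), w₀'.2) :
      (∀ j, Fin (deg K (f j).1 * (f j).2) → K) ×
      (Fin (n - ∑ j, deg K (f j).1 * (f j).2 + 1) → K))) (𝓝 w₀) (𝓝 w₀') := by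
    exact (tendsto_pi_nhds.2 fun j => (hg j).comp (hcj j)).prodMk_nhds tendsto_const_nhds
  have hty : ∀ᶠ w in 𝓝 w₀, ∀ j, typeOf K (monicOf (g j (w.1 j))) = typeOf K (monicOf (w.1 j)) :=
    eventually_all.2 fun j => (hcj j).eventually (hgt j)
  have hfreq : ∃ᶠ w in 𝓝 w₀', ((typeOf K (polyOf x)).1, 0) +
      ∑ j, typeOf K (monicOf (w.1 j)) = θ := by
    refine hG.frequently ((hc.and_eventually (hev.and hty)).mono ?_)
    rintro w ⟨hw, hw1, hw2⟩
    simp only [hw2]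
    rw [← hw1.2]
    exact hw.2
  refine (hfreq.and_eventually hev').mono ?_
  rintro w ⟨hw, hw1, hw2⟩
  exact ⟨hw1, hw2.trans hw⟩

/-- The index of the stratum of a polynomial: its type, or `none` for the zero polynomial. -/
def stratumIndex {n : ℕ} (x : Fin (n + 1) → K) : Option (ℕ × Multiset (SignType × ℕ)) :=
  open Classical in if x = 0 then none else some (typeOf K (polyOf x))

lemma stratumIndex_eq_none {n : ℕ} {x : Fin (n + 1) → K} : stratumIndex x = none ↔ x = 0 := by
  simp [stratumIndex]

lemma stratumIndex_eq_some {n : ℕ} {x : Fin (n + 1) → K} {θ : ℕ × Multiset (SignType × ℕ)} :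
    stratumIndex x = some θ ↔ x ∈ stratum K n θ := by
  simp [stratumIndex, stratum]

/-- The set `S` is a union of strata. -/
def IsStratumUnion {n : ℕ} (S : Set (Fin (n + 1) → K)) : Prop :=
  ∀ x ∈ S, ∀ y, stratumIndex x = stratumIndex y → y ∈ S

lemma isStratumUnion_iUnion {n : ℕ} {ι : Type} {S : ι → Set (Fin (n + 1) → K)}
    (h : ∀ i, IsStratumUnion (S i)) : IsStratumUnion (⋃ i, S i) := by
  intro x hx y hxy
  obtain ⟨i, hi⟩ := Set.mem_iUnion.1 hx
  exact Set.mem_iUnion.2 ⟨i, h i x hi y hxy⟩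

lemma IsStratumUnion.inter {n : ℕ} {S S' : Set (Fin (n + 1) → K)} (h : IsStratumUnion S)
    (h' : IsStratumUnion S') : IsStratumUnion (S ∩ S') := fun x hx y hxy =>
  ⟨h x hx.1 y hxy, h' x hx.2 y hxy⟩

lemma isStratumUnion_frontier_stratum (n r : ℕ) :
    IsStratumUnion (frontier (stratum K n (r, 0))) := by
  rw [(isOpen_stratum n r).frontier_eq]
  rintro x ⟨hxc, hxn⟩ y hxy
  rcases hi : stratumIndex x with _ | θ
  · rw [stratumIndex_eq_none.1 hi] at hxc hxn
    rw [hi] at hxy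
    rw [stratumIndex_eq_none.1 hxy.symm]
    exact ⟨hxc, hxn⟩
  · rw [hi] at hxy
    have hx := stratumIndex_eq_some.1 hi
    have hy := stratumIndex_eq_some.1 hxy.symm
    refine ⟨mem_closure_stratum_of_typeOf_eq hx.1 hy.1 (hx.2.trans hy.2.symm) hxc, fun hyn => ?_⟩
    exact hxn ⟨hx.1, hx.2.trans (hy.2.symm.trans hyn.2)⟩

variable (K) in
/-- The codimension of the stratum with a given index. -/
def indexCodim (n : ℕ) : Option (ℕ × Multiset (SignType × ℕ)) → ℕ
  | none => Module.finrank ℝ (Fin (n + 1) → K)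
  | some θ => typeCodim θ.2

/-- A union of strata is stratified by the strata that it contains. -/
theorem IsStratumUnion.isStratification {n : ℕ} {S : Set (Fin (n + 1) → K)}
    (hS : IsStratumUnion S) :
    Finite {θ : Option (ℕ × Multiset (SignType × ℕ)) // ∃ x ∈ S, stratumIndex x = θ} ∧
    IsStratification S
      (fun θ : {θ : Option (ℕ × Multiset (SignType × ℕ)) // ∃ x ∈ S, stratumIndex x = θ} =>
        {x | stratumIndex x = θ.1}) (fun θ => indexCodim K n θ.1) := by
  have hnone : {x : Fin (n + 1) → K | stratumIndex x = none} = {0} := by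
    ext x; simp [stratumIndex_eq_none]
  have hsome : ∀ θ, {x : Fin (n + 1) → K | stratumIndex x = some θ} = stratum K n θ := fun θ => by
    ext x; exact stratumIndex_eq_some
  constructor
  · have hfin : (insert none (some '' {θ | (stratum K n θ).Nonempty})).Finite :=
      ((finite_types n).image _).insert _
    refine (hfin.subset ?_).to_subtype
    rintro θ ⟨x, -, rfl⟩
    rcases hi : stratumIndex x with _ | θ
    · exact Set.mem_insert _ _
    · exact Set.mem_insert_of_mem _ ⟨θ, ⟨x, stratumIndex_eq_some.1 hi⟩, rfl⟩
  · refine ⟨?_, ?_, ?_, ?_, ?_⟩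
    · rintro ⟨θ, x, hx, hxθ⟩
      exact ⟨x, hxθ⟩
    · rintro ⟨_ | θ, -⟩
      · rw [hnone]
        exact isSubmanifold_singleton 0
      · rw [hsome]
        exact isSubmanifold_stratum n θ
    · intro i j hij
      rw [Set.disjoint_left]
      intro x hx hx'
      exact hij (Subtype.ext (hx.symm.trans hx'))
    · ext y
      rw [Set.mem_iUnion]
      constructor
      · rintro ⟨⟨θ, x, hx, hxθ⟩, hy⟩
        exact hS x hx y (hxθ.trans hy.symm)
      · intro hy
        exact ⟨⟨stratumIndex y, y, hy, rfl⟩, rfl⟩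
    · rintro ⟨i, hi⟩ ⟨j, hj⟩ hij ⟨x, hxi, hxj⟩
      have hne : i ≠ j := fun e => hij (Subtype.ext e)
      have hjne : {x : Fin (n + 1) → K | stratumIndex x = j}.Nonempty := by
        obtain ⟨y, -, hy⟩ := hj; exact ⟨y, hy⟩
      clear hij
      simp only at hxi hxj ⊢
      rcases j with _ | θ'
      · rw [hnone, closure_singleton] at hxj
        rw [Set.mem_ofPred_eq, show x = 0 from hxj, stratumIndex_eq_none.2 rfl] at hxi
        exact absurd hxi.symm hne
      · rw [hsome] at hxj hjne ⊢
        rcases i with _ | θ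
        · rw [hnone]
          refine ⟨?_, typeCodim_lt_of_nonempty hjne⟩
          rintro y rfl
          exact zero_mem_closure_stratum hjne
        · have hx := stratumIndex_eq_some.1 hxi
          constructor
          · intro y hy
            have hy := stratumIndex_eq_some.1 hy
            exact mem_closure_stratum_of_typeOf_eq hx.1 hy.1 (hx.2.trans hy.2.symm) hxj
          · have h1 : typeOf K (polyOf x) ≠ θ' := fun e => hne (by rw [← hx.2, e])
            have := typeCodim_lt_of_mem_closure hx.1 h1 hxj
            rw [hx.2] at this
            exact this

end

end Strata

/-! ### Common boundaries of the phases -/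

section Boundaries

variable {K : Type} [RCLike K] [NormedAlgebra K ℂ]

section

variable [CircleModel K]

open CircleModel

variable (K) in
/-- The number of circle roots, counted with multiplicity, of a polynomial whose circle roots have
the kinds and multiplicities `M`. -/
def circleCount (M : Multiset (SignType × ℕ)) : ℕ := (M.map fun a => deg K a.1 * a.2).sum

lemma typ_of_forall_norm_lt {Λ : Multiset ℂ} (h : ∀ z ∈ Λ, ‖z‖ < 1) : typ K Λ = (Λ.card, 0) := by
  refine Prod.ext (Multiset.countP_eq_card.2 h) (typ_snd_eq_zero.2 fun z hz hzr => ?_)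
  exact (h z hz).ne (norm_eq_one z hzr)

lemma typ_of_forall_lt_norm {Λ : Multiset ℂ} (h : ∀ z ∈ Λ, 1 < ‖z‖) : typ K Λ = (0, 0) := by
  refine Prod.ext (Multiset.countP_eq_zero.2 fun z hz => (h z hz).le.not_gt)
    (typ_snd_eq_zero.2 fun z hz hzr => ?_)
  exact (h z hz).ne' (norm_eq_one z hzr)

lemma stratum_of_natDegree_le {n : ℕ} {p : K[X]} (hp : p ≠ 0) (hn : p.natDegree ≤ n) :
    coeffVec (n + 1) p ∈ stratum K n (typeOf K p) := by
  refine ⟨fun h => hp ?_, by rw [polyOf_coeffVec_succ hn]⟩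
  rw [← polyOf_coeffVec_succ hn, h, polyOf_eq_zero]

/-- A point in the closure of the phase `i` has at most `i` roots in the open disk, and at least `i`
in the closed disk. -/
lemma le_of_mem_closure_stratum {n i : ℕ} {x : Fin (n + 1) → K} (hx : x ≠ 0)
    (hc : x ∈ closure (stratum K n (i, 0))) :
    (typeOf K (polyOf x)).1 ≤ i ∧
      i ≤ (typeOf K (polyOf x)).1 + circleCount K (typeOf K (polyOf x)).2 := by
  obtain ⟨l, f, hf⟩ := exists_enumeration (typeOf K (polyOf x)).2
  obtain ⟨z, w₀, φ, -, hz, hs, hφx, -, -, -, hev⟩ :=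
    exists_localStructure hx (f := f) (r := (typeOf K (polyOf x)).1) (Prod.ext rfl hf)
  rw [mem_closure_iff_frequently, ← hφx, ← φ.map_nhds_eq hs, frequently_map] at hc
  obtain ⟨w, hw, hw1⟩ := (hc.and_eventually hev).exists
  have hsum := hw1.2
  rw [hw.2] at hsum
  have h1 : i = (typeOf K (polyOf x)).1 + ∑ j, (typeOf K (monicOf (w.1 j))).1 := by
    simpa [Prod.fst_sum] using congrArg Prod.fst hsum
  have h2 : ∑ j, (typeOf K (monicOf (w.1 j))).1 ≤ circleCount K (typeOf K (polyOf x)).2 := by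
    have : circleCount K (typeOf K (polyOf x)).2 = ∑ j, deg K (f j).1 * (f j).2 := by
      rw [hf, circleCount, Multiset.map_map]; rfl
    rw [this]
    refine Finset.sum_le_sum fun j _ => ?_
    have h3 := add_sum_le_natDegree (monic_monicOf (w.1 j)).ne_zero
    rw [natDegree_monicOf] at h3
    omega
  omega

/-- A polynomial of type `(i, M)` with `k` circle roots is on the boundary of the phases `i`
and `i + k`: all the circle roots can be pushed out of, or into, the disk. -/
lemma mem_frontier_of_circleCount {n i k : ℕ} (hk : 1 ≤ k) {M : Multiset (SignType × ℕ)}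
    (hM : circleCount K M = k) {x : Fin (n + 1) → K} (hx : x ∈ stratum K n (i, M)) :
    x ∈ frontier (stratum K n (i, 0)) ∩ frontier (stratum K n (i + k, 0)) := by
  obtain ⟨l, f, hf⟩ := exists_enumeration M
  have hp : polyOf x ≠ 0 := fun e => hx.1 (polyOf_eq_zero.1 e)
  obtain ⟨z, R, -, hrep, hkind, hpos, hpR, hR⟩ :=
    exists_factorization hp (f := f) (r := i) (by rw [hx.2, hf])
  have hR0 : R ≠ 0 := by rintro rfl; exact hp (by rw [hpR, mul_zero])
  set P : K[X] := ∏ j, atom (z j) ^ (f j).2 with hP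
  have hPm : P.Monic := monic_prod_of_monic _ _ fun j _ => (monic_atom _ (hrep j)).pow _
  have hPd : P.natDegree = k := by
    rw [hP, natDegree_prod_of_monic _ _ fun j _ => (monic_atom _ (hrep j)).pow _, ← hM, hf,
      circleCount, Multiset.map_map]
    refine Finset.sum_congr rfl fun j _ => ?_
    rw [(monic_atom _ (hrep j)).natDegree_pow, natDegree_atom _ (hrep j), hkind j, mul_comm]
    rfl
  have hProots : ∀ y ∈ P.aroots ℂ, ‖y‖ = 1 := by
    intro y hy
    have hy0 := (mem_aroots.1 hy).2
    rw [hP, map_prod, Finset.prod_eq_zero_iff] at hy0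
    obtain ⟨j, -, hj⟩ := hy0
    rw [map_pow, pow_eq_zero_iff (hpos j)] at hj
    exact norm_of_aeval_atom _ (hrep j) y hj
  have hdeg : ∀ t : K, (P.scaleRoots t * R).natDegree ≤ n := by
    intro t
    have h1 := natDegree_polyOf_le x
    rw [hpR, hPm.natDegree_mul' hR0] at h1
    rw [((monic_scaleRoots_iff t).2 hPm).natDegree_mul' hR0, natDegree_scaleRoots]
    exact h1
  have hcont : Continuous fun t : ℝ => coeffVec (n + 1) (P.scaleRoots (t : K) * R) := by
    refine continuous_pi fun m => ?_
    simp only [coeffVec, coeff_mul, coeff_scaleRoots]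
    exact continuous_finsetSum _ fun a _ => by
      have := RCLike.continuous_ofReal (K := K)
      fun_prop
  have hone : coeffVec (n + 1) (P.scaleRoots ((1 : ℝ) : K) * R) = x := by
    rw [RCLike.ofReal_one, scaleRoots_one, ← hpR, coeffVec_polyOf]
  have haroots : ∀ t : ℝ, t ≠ 0 → (P.scaleRoots (t : K)).aroots ℂ =
      (P.aroots ℂ).map (algebraMap K ℂ (t : K) * ·) := by
    intro t ht
    rw [aroots_def, map_scaleRoots, roots_scaleRoots]
    · exact IsUnit.mk0 _ (by simpa using ht)
    · rw [hPm.leadingCoeff]; simp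
  have hnorm : ∀ t : ℝ, 0 < t → ∀ y ∈ (P.scaleRoots (t : K)).aroots ℂ, ‖y‖ = t := by
    intro t ht y hy
    rw [haroots t ht.ne', Multiset.mem_map] at hy
    obtain ⟨y, hy, rfl⟩ := hy
    rw [norm_mul, hProots y hy, mul_one, norm_algebraMap']
    simpa using ht.le
  have hmul : ∀ t : ℝ, 0 < t → typeOf K (P.scaleRoots (t : K) * R) =
      typeOf K (P.scaleRoots (t : K)) + (i, 0) := by
    intro t ht
    rw [← hR]
    refine typeOf_mul ((monic_scaleRoots_iff _).2 hPm).ne_zero hR0 fun y hy _ => ?_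
    exact (typeOf_snd_eq_zero hR0).1 (by rw [hR]) y (norm_eq_one y hy)
  have hcard : ∀ t : ℝ, ((P.scaleRoots (t : K)).aroots ℂ).card = k := fun t => by
    rw [IsAlgClosed.card_aroots_eq_natDegree, natDegree_scaleRoots, hPd]
  have hne : ∀ t : ℝ, P.scaleRoots (t : K) * R ≠ 0 := fun t =>
    mul_ne_zero ((monic_scaleRoots_iff _).2 hPm).ne_zero hR0
  have hx0 : ∀ r, x ∉ stratum K n (r, 0) := by
    intro r hr
    have := (hx.2.symm.trans hr.2)
    have hM0 : M = 0 := congrArg Prod.snd this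
    rw [hM0] at hM
    simp [circleCount] at hM
    omega
  rw [(isOpen_stratum n i).frontier_eq, (isOpen_stratum n (i + k)).frontier_eq]
  refine ⟨⟨?_, hx0 _⟩, ⟨?_, hx0 _⟩⟩
  · have ht : Tendsto (fun t : ℝ => coeffVec (n + 1) (P.scaleRoots (t : K) * R)) (𝓝[>] 1)
        (𝓝 x) := by
      have := hcont.tendsto 1
      rw [hone] at this
      exact this.mono_left nhdsWithin_le_nhds
    refine mem_closure_of_tendsto ht ?_
    filter_upwards [self_mem_nhdsWithin] with t ht
    have ht : 1 < t := ht
    have h1 := stratum_of_natDegree_le (hne t) (hdeg t)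
    rw [hmul t (by linarith), typeOf, typ_of_forall_lt_norm fun y hy => by
      rw [hnorm t (by linarith) y hy]; exact ht] at h1
    simpa using h1
  · have ht : Tendsto (fun t : ℝ => coeffVec (n + 1) (P.scaleRoots (t : K) * R)) (𝓝[<] 1)
        (𝓝 x) := by
      have := hcont.tendsto 1
      rw [hone] at this
      exact this.mono_left nhdsWithin_le_nhds
    refine mem_closure_of_tendsto ht ?_
    filter_upwards [Ioo_mem_nhdsLT (show (0 : ℝ) < 1 by norm_num)] with t ht
    have h1 := stratum_of_natDegree_le (hne t) (hdeg t)
    rw [hmul t ht.1, typeOf, typ_of_forall_norm_lt fun y hy => by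
      rw [hnorm t ht.1 y hy]; exact ht.2, hcard] at h1
    simpa [add_comm] using h1

/-- The codimension is at least half the real dimension of the conditions that all circle roots,
in number `circleCount`, are fixed. -/
lemma finrank_mul_circleCount_le (p : K[X]) :
    Module.finrank ℝ K * circleCount K (typeOf K p).2 ≤ 2 * typeCodim (typeOf K p).2 := by
  have e : circleCount K (typeOf K p).2 =
      ∑ y ∈ circleReps K (p.aroots ℂ), deg K (kind K y) * (p.aroots ℂ).count y := by
    simp only [circleCount, typeOf, typ, Multiset.map_map]
    rfl
  rw [e, typeCodim_typeOf, Finset.mul_sum, Finset.mul_sum]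
  refine Finset.sum_le_sum fun y hy => ?_
  have h1 := rootCodim_add_ite (a := (kind K y, (p.aroots ℂ).count y))
    (count_ne_zero_of_mem_circleReps hy)
  rw [← mul_assoc, finrank_mul_deg y (mem_circleReps.1 hy).2]
  have h2 := rootCodim_pos (a := (kind K y, (p.aroots ℂ).count y))
    (count_ne_zero_of_mem_circleReps hy)
  simp only at h1
  split_ifs at h1 <;> omega

lemma typeOf_X_pow_mul_prod_atom (i : ℕ) {s : Finset ℂ} (hs : ∀ z ∈ s, z ∈ rep K) :
    typeOf K (X ^ i * ∏ z ∈ s, atom z : K[X]) = (i, s.val.map fun z => (kind K z, 1)) := by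
  have h0 : ∀ z ∈ s, (atom z : K[X]) ≠ 0 := fun z hz => (monic_atom z (hs z hz)).ne_zero
  rw [typeOf_mul (pow_ne_zero _ X_ne_zero) (Finset.prod_ne_zero_iff.2 h0), typeOf_prod _ _ h0]
  · have h1 : typeOf K (X ^ i : K[X]) = (i, 0) := by
      rw [typeOf, aroots_X_pow, typ_of_forall_norm_lt]
      · simp
      · intro z hz
        rw [Multiset.mem_singleton.1 (Multiset.mem_of_mem_nsmul hz)]
        simp
    have h2 : ∀ z ∈ s, typeOf K (atom z : K[X]) = (0, {(kind K z, 1)}) := fun z hz => by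
      have := typeOf_atom_pow (hs z hz) one_ne_zero
      rwa [pow_one] at this
    rw [h1, Finset.sum_congr rfl h2]
    refine Prod.ext ?_ ?_
    · simp [Prod.fst_sum]
    · simp only [Prod.snd_add, zero_add, Prod.snd_sum]
      rw [← Multiset.sum_map_singleton (s.val.map _), Multiset.map_map]
      rfl
  · intro z hz y hy hzy w hw h1 h2
    exact hzy ((eq_of_aeval_atom z (hs z hz) w hw h1).symm.trans
      (eq_of_aeval_atom y (hs y hy) w hw h2))
  · intro z hz h1
    have : z = 0 := by
      simp only [map_pow, aeval_X] at h1
      exact eq_zero_of_pow_eq_zero h1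
    have h2 := norm_eq_one z hz
    rw [this, norm_zero] at h2
    exact absurd h2 (by norm_num)

/-- Simple circle roots on the orbits of `s`, and `i` roots at the origin. -/
lemma exists_mem_stratum_of_finset {n i k : ℕ} (hn : i + k ≤ n) {s : Finset ℂ}
    (hs : ∀ z ∈ s, z ∈ rep K) (hk : ∑ z ∈ s, deg K (kind K z) = k) :
    ∃ M, (stratum K n (i, M)).Nonempty ∧ circleCount K M = k ∧ typeCodim M = s.card := by
  refine ⟨s.val.map fun z => (kind K z, 1),
    ⟨coeffVec (n + 1) (X ^ i * ∏ z ∈ s, atom z), ?_⟩, ?_, ?_⟩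
  · rw [← typeOf_X_pow_mul_prod_atom i hs]
    have hm : (∏ z ∈ s, atom z : K[X]).Monic := monic_prod_of_monic _ _ fun z hz =>
      monic_atom z (hs z hz)
    refine stratum_of_natDegree_le ((monic_X_pow i).mul hm).ne_zero ?_
    rw [(monic_X_pow i).natDegree_mul hm, natDegree_X_pow, natDegree_prod_of_monic _ _ fun z hz =>
      monic_atom z (hs z hz), Finset.sum_congr rfl fun z hz => natDegree_atom z (hs z hz), hk]
    exact hn
  · rw [circleCount, Multiset.map_map, ← hk]
    simp only [Function.comp_def, mul_one]
    rfl
  · rw [typeCodim, Multiset.map_map]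
    have : (rootCodim ∘ fun z => (kind K z, 1)) = fun _ : ℂ => 1 := by
      funext z
      simp [rootCodim]
    rw [this]
    simp

end

section

variable [MovingCircleModel K]

open CircleModel

/-- A union of strata, all of which have codimension at least `c`, this value being attained. -/
lemma IsStratumUnion.isStratifiedWithLargestCodim {n c : ℕ} {S : Set (Fin (n + 1) → K)}
    (hS : IsStratumUnion S) (hc : ∀ x ∈ S, c ≤ indexCodim K n (stratumIndex x))
    (hex : ∃ x ∈ S, indexCodim K n (stratumIndex x) = c) : IsStratifiedWithLargestCodim S c := by
  obtain ⟨hfin, hstr⟩ := hS.isStratification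
  refine ⟨_, hfin, _, _, hstr, ?_, ?_⟩
  · rintro ⟨θ, x, hx, rfl⟩
    exact hc x hx
  · obtain ⟨x, hx, hxc⟩ := hex
    exact ⟨⟨_, x, hx, rfl⟩, hxc⟩

lemma IsStratumUnion.hasRealCodim {n c : ℕ} {S : Set (Fin (n + 1) → K)}
    (hS : IsStratumUnion S) (hne : S.Nonempty)
    (hc : ∀ x ∈ S, c ≤ indexCodim K n (stratumIndex x))
    (hd : S ⊆ closure {x | x ∈ S ∧ indexCodim K n (stratumIndex x) = c}) : HasRealCodim S c := by
  obtain ⟨hfin, hstr⟩ := hS.isStratification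
  refine ⟨hne, _, hfin, _, _, hstr, ?_, ?_⟩
  · rintro ⟨θ, x, hx, rfl⟩
    exact hc x hx
  · refine hd.trans (closure_mono ?_)
    rintro x ⟨hx, hxc⟩
    exact Set.mem_iUnion₂.2 ⟨⟨_, x, hx, rfl⟩, hxc, rfl⟩

variable (K) in
/-- The common boundary of the phases `i` and `i + k`. -/
def commonBoundary (n k i : ℕ) : Set (Fin (n + 1) → K) :=
  frontier (stratum K n (i, 0)) ∩ frontier (stratum K n (i + k, 0))

lemma isStratumUnion_commonBoundary (n k i : ℕ) : IsStratumUnion (commonBoundary K n k i) :=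
  (isStratumUnion_frontier_stratum n i).inter (isStratumUnion_frontier_stratum n (i + k))

lemma bounds_of_mem_commonBoundary {n k i : ℕ} {x : Fin (n + 1) → K} (hx0 : x ≠ 0)
    (hx : x ∈ commonBoundary K n k i) : (typeOf K (polyOf x)).1 ≤ i ∧
      i + k ≤ (typeOf K (polyOf x)).1 + circleCount K (typeOf K (polyOf x)).2 :=
  ⟨(le_of_mem_closure_stratum hx0 (frontier_subset_closure hx.1)).1,
    (le_of_mem_closure_stratum hx0 (frontier_subset_closure hx.2)).2⟩

/-- The lower bound for the codimension of the strata of a common boundary. They have at least `k`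
circle roots; the zero polynomial has a large enough codimension, as `k ≤ n`. -/
lemma le_indexCodim_of_mem_commonBoundary {n k i : ℕ} (hk : k ≤ n) {x : Fin (n + 1) → K}
    (hx : x ∈ commonBoundary K n k i) :
    (Module.finrank ℝ K * k + 1) / 2 ≤ indexCodim K n (stratumIndex x) := by
  have hD : 0 < Module.finrank ℝ K := Module.finrank_pos
  rcases hi : stratumIndex x with _ | θ
  · have h1 : Module.finrank ℝ (Fin (n + 1) → K) =
        Module.finrank ℝ K * n + Module.finrank ℝ K := by
      simp [Module.finrank_pi_fintype]; ring
    have h2 := Nat.mul_le_mul_left (Module.finrank ℝ K) hk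
    simp only [indexCodim, h1]
    omega
  · have hxs := stratumIndex_eq_some.1 hi
    have h1 := bounds_of_mem_commonBoundary hxs.1 hx
    have h2 := finrank_mul_circleCount_le (polyOf x)
    have h3 := Nat.mul_le_mul_left (Module.finrank ℝ K)
      (show k ≤ circleCount K (typeOf K (polyOf x)).2 by omega)
    rw [hxs.2] at h2 h3
    simp only [indexCodim]
    omega

/-- The common boundary contains a stratum on which the circle roots are simple and lie on the
orbits of `s`. -/
lemma exists_mem_commonBoundary {n k i : ℕ} (hk : 1 ≤ k) (hn : i + k ≤ n) {s : Finset ℂ}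
    (hs : ∀ z ∈ s, z ∈ rep K) (hsk : ∑ z ∈ s, deg K (kind K z) = k) :
    ∃ x ∈ commonBoundary K n k i, indexCodim K n (stratumIndex x) = s.card := by
  obtain ⟨M, ⟨x, hx⟩, hM, hMc⟩ := exists_mem_stratum_of_finset hn hs hsk
  refine ⟨x, mem_frontier_of_circleCount hk hM hx, ?_⟩
  rw [stratumIndex_eq_some.2 hx]
  exact hMc

lemma isStratified_commonBoundary {n k i : ℕ} (hk : 1 ≤ k) (hn : i + k ≤ n) {s : Finset ℂ}
    (hs : ∀ z ∈ s, z ∈ rep K) (hsk : ∑ z ∈ s, deg K (kind K z) = k)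
    (hcard : s.card = (Module.finrank ℝ K * k + 1) / 2) :
    IsStratifiedWithLargestCodim (commonBoundary K n k i) ((Module.finrank ℝ K * k + 1) / 2) := by
  refine (isStratumUnion_commonBoundary n k i).isStratifiedWithLargestCodim
    (fun x hx => le_indexCodim_of_mem_commonBoundary (show k ≤ n by omega) hx) ?_
  rw [← hcard]
  exact exists_mem_commonBoundary hk hn hs hsk

lemma isStratified_iUnion_commonBoundary {n k : ℕ} (hk : 1 ≤ k) (hn : k ≤ n) {s : Finset ℂ}
    (hs : ∀ z ∈ s, z ∈ rep K) (hsk : ∑ z ∈ s, deg K (kind K z) = k)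
    (hcard : s.card = (Module.finrank ℝ K * k + 1) / 2) :
    IsStratifiedWithLargestCodim (⋃ i, commonBoundary K n k i)
      ((Module.finrank ℝ K * k + 1) / 2) := by
  refine (isStratumUnion_iUnion fun i =>
    isStratumUnion_commonBoundary n k i).isStratifiedWithLargestCodim (fun x hx => ?_) ?_
  · obtain ⟨i, hi⟩ := Set.mem_iUnion.1 hx
    exact le_indexCodim_of_mem_commonBoundary hn hi
  · rw [← hcard]
    obtain ⟨x, hx, h⟩ := exists_mem_commonBoundary (n := n) (i := 0) hk (by omega) hs hsk
    exact ⟨x, Set.mem_iUnion.2 ⟨0, hx⟩, h⟩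

end

/-- The jump locus of a family of regions that are empty for negative indices. -/
lemma jumpLocus_eq_iUnion {X : Type} [TopologicalSpace X] (U : ℤ → Set X)
    (h : ∀ i : ℤ, i < 0 → U i = ∅) (k : ℕ) :
    jumpLocus U k = ⋃ i : ℕ, frontier (U i) ∩ frontier (U (i + k)) := by
  ext x
  simp only [jumpLocus, Set.mem_iUnion]
  constructor
  · rintro ⟨i, hi⟩
    rcases lt_or_ge i 0 with h0 | h0
    · rw [h i h0, frontier_empty] at hi
      exact hi.1.elim
    · lift i to ℕ using h0
      exact ⟨i, hi⟩
  · rintro ⟨i, hi⟩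
    exact ⟨i, hi⟩

end Boundaries

/-! ### The circle over the complex numbers -/

section ComplexModel

/-- Over `ℂ` every point of the circle is its own orbit and can move. -/
instance complexCircleModel : CircleModel ℂ where
  rep := {z | ‖z‖ = 1}
  kind := fun _ => 0
  atom := fun z => X - C z
  deg := fun _ => 1
  norm_eq_one := fun _ hz => hz
  kind_inj := fun _ _ _ _ _ h => absurd rfl h
  monic_atom := fun z _ => monic_X_sub_C z
  natDegree_atom := fun z _ => natDegree_X_sub_C z
  finrank_mul_deg := fun _ _ => by simp [weight]
  atom_dvd := fun z _ p h => dvd_iff_isRoot.2 (by simpa using h)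
  aeval_atom := fun z _ => by simp
  rootMultiplicity_atom := fun z _ => by
    rw [Algebra.algebraMap_self, Polynomial.map_id, rootMultiplicity_X_sub_C_self]
  eq_of_aeval_atom := fun z _ w _ h => by simpa [sub_eq_zero] using h
  norm_of_aeval_atom := fun z hz w h => by
    have : w = z := by simpa [sub_eq_zero] using h
    rw [this]; exact hz
  exists_rep := fun w hw => ⟨w, hw, fun _ h => h⟩

lemma mem_rep_complex {z : ℂ} : z ∈ CircleModel.rep ℂ ↔ ‖z‖ = 1 := Iff.rfl

lemma aroots_complex (p : ℂ[X]) : p.aroots ℂ = p.roots := by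
  rw [aroots_def, Algebra.algebraMap_self, Polynomial.map_id]

/-- The next-to-leading coefficient of a monic polynomial. -/
lemma nextCoeff_monicOf {K : Type} [RCLike K] {m : ℕ} (hm : 0 < m) (u : Fin m → K) :
    (monicOf u).nextCoeff = u ⟨m - 1, by omega⟩ := by
  rw [nextCoeff_of_natDegree_pos (by rw [natDegree_monicOf]; exact hm), natDegree_monicOf,
    coeff_monicOf, dif_pos (by omega)]

/-- The powers `(X - z) ^ μ` form a curve: it is parametrized by `z`, which moves on the circle and
is a linear function of the next-to-leading coefficient. -/
lemma isSubmanifold_curve_complex (μ : ℕ) (hμ : μ ≠ 0) :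
    IsSubmanifold {u : Fin (1 * μ) → ℂ | ∃ z ∈ {z : ℂ | ‖z‖ = 1}, (0 : SignType) = 0 ∧
      monicOf u = (X - C z) ^ μ} (2 * μ - 1) := by
  have hm : 0 < 1 * μ := by omega
  have hμ' : (μ : ℂ) ≠ 0 := Nat.cast_ne_zero.2 hμ
  have hfr : 2 * μ - 1 = Module.finrank ℝ (Fin (1 * μ) → ℂ) - 1 := by
    simp [Module.finrank_pi_fintype, mul_comm]
  rw [hfr]
  -- the root `z` of `(X - z) ^ μ` is a linear function of the next-to-leading coefficient
  let ζ : (Fin (1 * μ) → ℂ) →L[ℝ] ℂ :=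
    ((-(μ : ℂ)⁻¹) • ContinuousLinearMap.proj (R := ℂ) (φ := fun _ : Fin (1 * μ) => ℂ)
      ⟨1 * μ - 1, by omega⟩).restrictScalars ℝ
  have hζa : ∀ u, ζ u = -(μ : ℂ)⁻¹ * u ⟨1 * μ - 1, by omega⟩ := fun u => rfl
  have hζ : ∀ (u : Fin (1 * μ) → ℂ) (z : ℂ), monicOf u = (X - C z) ^ μ → ζ u = z := by
    intro u z h
    have h1 := nextCoeff_monicOf hm u
    rw [h, (monic_X_sub_C z).nextCoeff_pow, nextCoeff_X_sub_C] at h1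
    rw [hζa, ← h1]
    simp [hμ']
  have hnd : ∀ z : ℂ, ((X - C z) ^ μ : ℂ[X]).natDegree = 1 * μ := fun z => by
    rw [natDegree_pow, natDegree_X_sub_C, mul_comm]
  refine isSubmanifold_of_graph fun x hx => ?_
  obtain ⟨b, hb, -, hxb⟩ := hx
  have hbb : (starRingEnd ℂ) b * b = 1 := by
    rw [mul_comm, Complex.mul_conj, Complex.normSq_eq_norm_sq]
    simp [show ‖b‖ = 1 from hb]
  let ρ : ℝ → ℂ := fun s => b * ((Real.sqrt (1 - s ^ 2) : ℂ) + s * Complex.I)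
  have hρb : ∀ s, (starRingEnd ℂ) b * ρ s = (Real.sqrt (1 - s ^ 2) : ℂ) + s * Complex.I := by
    intro s
    simp only [ρ]
    rw [← mul_assoc, hbb, one_mul]
  have hρn : ∀ s ∈ Set.Ioo (-1 : ℝ) 1, ‖ρ s‖ = 1 := by
    intro s hs
    have h1 : 0 ≤ 1 - s ^ 2 := by nlinarith [hs.1, hs.2]
    have h2 : ‖(Real.sqrt (1 - s ^ 2) : ℂ) + s * Complex.I‖ = 1 := by
      rw [Complex.norm_add_mul_I, Real.sq_sqrt h1]; simp
    simp only [ρ, norm_mul, h2, mul_one]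
    exact hb
  have hρs : ContDiffOn ℝ ∞ ρ (Set.Ioo (-1 : ℝ) 1) := by
    have h1 : ContDiffOn ℝ ∞ (fun s : ℝ => Real.sqrt (1 - s ^ 2)) (Set.Ioo (-1 : ℝ) 1) := by
      refine ContDiffOn.sqrt (by fun_prop) fun s hs => ?_
      nlinarith [hs.1, hs.2]
    refine contDiffOn_const.mul (ContDiffOn.add ?_ ?_)
    · exact Complex.ofRealCLM.contDiff.comp_contDiffOn h1
    · exact (Complex.ofRealCLM.contDiff.contDiffOn).mul contDiffOn_const
  let L : (Fin (1 * μ) → ℂ) →L[ℝ] ℝ := Complex.imCLM.comp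
    ((((starRingEnd ℂ) b) • (ContinuousLinearMap.id ℝ ℂ)).comp ζ)
  have hL : ∀ u, L u = ((starRingEnd ℂ) b * ζ u).im := fun u => rfl
  refine ⟨{u | 0 < ((starRingEnd ℂ) b * ζ u).re}, L,
    Pi.single ⟨1 * μ - 1, by omega⟩ (-(μ : ℂ) * (b * Complex.I)),
    fun s => coeffVec _ ((X - C (ρ s)) ^ μ), Set.Ioo (-1) 1, ?_, ?_, isOpen_Ioo, ?_, ?_, ?_, ?_⟩
  · exact isOpen_lt continuous_const
      (Complex.continuous_re.comp (continuous_const.mul ζ.continuous))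
  · rw [Set.mem_ofPred_eq, hζ x b hxb, hbb]
    simp
  · rw [hL, hζa, Pi.single_eq_same]
    have : (starRingEnd ℂ) b * (-(μ : ℂ)⁻¹ * (-(μ : ℂ) * (b * Complex.I))) = Complex.I := by
      rw [show (starRingEnd ℂ) b * (-(μ : ℂ)⁻¹ * (-(μ : ℂ) * (b * Complex.I))) =
        ((starRingEnd ℂ) b * b) * ((μ : ℂ)⁻¹ * μ) * Complex.I by ring, hbb,
        inv_mul_cancel₀ hμ']
      ring
    rw [this, Complex.I_im]
  · rw [contDiffOn_pi]
    intro j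
    exact ((SmoothPoly.X_sub_C (K := ℂ) contDiff_id).pow μ j).comp_contDiffOn hρs
  · intro s hs
    rw [hL, hζ _ (ρ s) (monicOf_coeffVec ((monic_X_sub_C _).pow _) (hnd _)), hρb]
    simp
  · intro y hy
    constructor
    · rintro ⟨z, hz, -, hyz⟩
      rw [Set.mem_ofPred_eq, hζ y z hyz] at hy
      set w := (starRingEnd ℂ) b * z with hw
      have hwn : w.re ^ 2 + w.im ^ 2 = 1 := by
        have h1 : ‖w‖ = 1 := by
          rw [hw, norm_mul, RCLike.norm_conj, show ‖b‖ = 1 from hb, show ‖z‖ = 1 from hz, one_mul]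
        have h2 := Complex.normSq_eq_norm_sq w
        rw [h1, Complex.normSq_apply] at h2
        nlinarith
      have hz' : ρ w.im = z := by
        have h1 : Real.sqrt (1 - w.im ^ 2) = w.re := by
          rw [show 1 - w.im ^ 2 = w.re ^ 2 by linarith, Real.sqrt_sq hy.le]
        simp only [ρ, h1, Complex.re_add_im]
        rw [hw, ← mul_assoc, mul_comm b, hbb, one_mul]
      refine ⟨w.im, ⟨by nlinarith [sq_pos_of_pos hy], by nlinarith [sq_pos_of_pos hy]⟩, ?_⟩
      simp only [hz']
      rw [← hyz, coeffVec_monicOf]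
    · rintro ⟨s, hs, rfl⟩
      exact ⟨ρ s, hρn s hs, rfl, monicOf_coeffVec ((monic_X_sub_C _).pow _) (hnd _)⟩

/-- Rotations preserve types. -/
lemma typeOf_scaleRoots_complex {c : ℂ} (hc : ‖c‖ = 1) (p : ℂ[X]) :
    typeOf ℂ (p.scaleRoots c) = typeOf ℂ p := by
  have hc0 : c ≠ 0 := by rintro rfl; simp at hc
  rw [typeOf, typeOf, aroots_complex, aroots_complex, roots_scaleRoots _ (IsUnit.mk0 _ hc0)]
  refine typ_map _ (mul_right_injective₀ hc0).injOn ?_ ?_ ?_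
  · intro z _; rw [norm_mul, hc, one_mul]
  · intro z _; rw [mem_rep_complex, mem_rep_complex, norm_mul, hc, one_mul]
  · intro z _ _; rfl

/-- Rotations move any point of the circle to any other one. -/
lemma exists_transport_complex {z z' : ℂ} (hz : ‖z‖ = 1) (hz' : ‖z'‖ = 1) (μ : ℕ) :
    ∃ g : (Fin (1 * μ) → ℂ) → (Fin (1 * μ) → ℂ),
      Tendsto g (𝓝 (coeffVec _ ((X - C z) ^ μ))) (𝓝 (coeffVec _ ((X - C z') ^ μ))) ∧
      ∀ᶠ u in 𝓝 (coeffVec _ ((X - C z) ^ μ)), typeOf ℂ (monicOf (g u)) = typeOf ℂ (monicOf u) := by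
  have hz0 : z ≠ 0 := by rintro rfl; simp at hz
  set c := z' / z with hc
  have hcn : ‖c‖ = 1 := by rw [hc, norm_div, hz, hz', div_one]
  have hzc : z * c = z' := by rw [hc]; field_simp
  have hnd : ((X - C z) ^ μ : ℂ[X]).natDegree = 1 * μ := by
    rw [natDegree_pow, natDegree_X_sub_C, mul_comm]
  have hg : ∀ u : Fin (1 * μ) → ℂ,
      monicOf (coeffVec (1 * μ) ((monicOf u).scaleRoots c)) = (monicOf u).scaleRoots c := fun u =>
    monicOf_coeffVec ((monic_scaleRoots_iff c).2 (monic_monicOf u))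
      (by rw [natDegree_scaleRoots, natDegree_monicOf])
  refine ⟨fun u => coeffVec _ ((monicOf u).scaleRoots c), ?_, ?_⟩
  · have hcont : Continuous fun u : Fin (1 * μ) → ℂ =>
        coeffVec (1 * μ) ((monicOf u).scaleRoots c) := by
      refine continuous_pi fun j => ?_
      simp only [coeffVec, coeff_scaleRoots, natDegree_monicOf]
      have : Continuous fun u : Fin (1 * μ) → ℂ => (monicOf u).coeff j := by
        simp only [coeff_monicOf, Fin.is_lt, dite_true, Fin.eta]
        exact continuous_apply j
      exact this.mul continuous_const
    convert hcont.tendsto _ using 2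
    rw [monicOf_coeffVec ((monic_X_sub_C z).pow μ) hnd, pow_scaleRoots_of_isReduced,
      X_sub_C_scaleRoots, hzc]
  · refine Eventually.of_forall fun u => ?_
    rw [hg]
    exact typeOf_scaleRoots_complex hcn _

instance complexMovingCircleModel : MovingCircleModel ℂ where
  isSubmanifold_curve := isSubmanifold_curve_complex
  exists_transport := fun _ hz _ hz' _ _ μ => exists_transport_complex hz hz' μ

/-! ### Density of the strata with simple circle roots -/

lemma typeOf_X_sub_C_of_norm_lt {y : ℂ} (hy : ‖y‖ < 1) : typeOf ℂ (X - C y) = (1, 0) := by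
  rw [typeOf, aroots_complex, roots_X_sub_C, typ_of_forall_norm_lt]
  · simp
  · intro z hz; rw [Multiset.mem_singleton.1 hz]; exact hy

lemma typeOf_X_sub_C_of_lt_norm {y : ℂ} (hy : 1 < ‖y‖) : typeOf ℂ (X - C y) = (0, 0) := by
  rw [typeOf, aroots_complex, roots_X_sub_C, typ_of_forall_lt_norm]
  intro z hz; rw [Multiset.mem_singleton.1 hz]; exact hy

lemma typeOf_X_sub_C_of_norm_eq {y : ℂ} (hy : ‖y‖ = 1) : typeOf ℂ (X - C y) = (0, {(0, 1)}) := by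
  have := typeOf_atom_pow (K := ℂ) (z := y) hy one_ne_zero
  rw [pow_one] at this
  exact this

/-- Two points that rotate with different speeds are different at small positive times. -/
lemma eventually_rotate_ne (w w' : ℂ) (hw : w ≠ 0) {a b : ℕ} (hab : a ≠ b) :
    ∀ᶠ ε : ℝ in 𝓝[>] 0, w * Complex.exp (ε * a * Complex.I) ≠
      w' * Complex.exp (ε * b * Complex.I) := by
  have hd : ∀ (w : ℂ) (a : ℕ), HasDerivAt (fun ε : ℝ => w * Complex.exp (ε * a * Complex.I))
      (w * (a * Complex.I)) 0 := by
    intro w a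
    have h1 : HasDerivAt (fun ε : ℝ => ((ε : ℂ) * a * Complex.I)) (1 * a * Complex.I) 0 :=
      (Complex.ofRealCLM.hasDerivAt.mul_const _).mul_const _
    have h2 := (h1.cexp).const_mul w
    simpa using h2
  by_cases h : w = w'
  · subst h
    have h3 := ((hd w a).sub (hd w b)).eventually_ne (c := 0) ?_
    · refine (h3.filter_mono (nhdsWithin_mono 0 fun x hx => ?_)).mono fun ε hε => ?_
      · exact (show (0 : ℝ) < x from hx).ne'
      · exact fun e => hε (by simp [e])
    · rw [← mul_sub, ← sub_mul]
      refine mul_ne_zero hw (mul_ne_zero (sub_ne_zero.2 ?_) Complex.I_ne_zero)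
      exact_mod_cast hab
  · have h3 : ContinuousAt (fun ε : ℝ => w * Complex.exp (ε * a * Complex.I) -
        w' * Complex.exp (ε * b * Complex.I)) 0 := ((hd w a).sub (hd w' b)).continuousAt
    have h4 := h3.eventually_ne (y := 0) (by simpa [sub_eq_zero] using h)
    exact (h4.filter_mono nhdsWithin_le_nhds).mono fun ε hε e => hε (by simp [e])

/-- Any polynomial with `r` roots in the open disk and `m` roots on the circle is a limit of
polynomials with `i` roots in the open disk and `k` circle roots that are simple, provided that
`r ≤ i` and `i + k ≤ r + m`: push some of the circle roots into the disk, some out of it, and let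
the others rotate with different speeds. -/
theorem mem_closure_stratum_simple {n i k : ℕ} {x : Fin (n + 1) → ℂ} (hx : x ≠ 0)
    (h1 : (typeOf ℂ (polyOf x)).1 ≤ i)
    (h2 : i + k ≤ (typeOf ℂ (polyOf x)).1 + circleCount ℂ (typeOf ℂ (polyOf x)).2) :
    x ∈ closure (stratum ℂ n (i, Multiset.replicate k (0, 1))) := by
  classical
  obtain ⟨l, f, hf⟩ := exists_enumeration (typeOf ℂ (polyOf x)).2
  have hp : polyOf x ≠ 0 := fun e => hx (polyOf_eq_zero.1 e)
  set r := (typeOf ℂ (polyOf x)).1 with hr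
  obtain ⟨z, R, -, hrep, -, hpos, hpR, hR⟩ := exists_factorization hp (f := f) (r := r)
    (Prod.ext rfl hf)
  have hR0 : R ≠ 0 := by rintro rfl; exact hp (by rw [hpR, mul_zero])
  have hRc := (typeOf_snd_eq_zero hR0).1 (by rw [hR])
  -- the circle roots, repeated according to their multiplicities
  let A := Σ j : Fin l, Fin (f j).2
  let w : A → ℂ := fun a => z a.1
  have hwn : ∀ a, ‖w a‖ = 1 := fun a => hrep a.1
  have hw0 : ∀ a, w a ≠ 0 := fun a e => by have := hwn a; rw [e] at this; simp at this
  have hcard : Fintype.card A = circleCount ℂ (typeOf ℂ (polyOf x)).2 := by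
    rw [hf, circleCount, Multiset.map_map, Fintype.card_sigma]
    simp only [Fintype.card_fin]
    refine Finset.sum_congr rfl fun j _ => ?_
    exact (one_mul _).symm
  have hprod : polyOf x = (∏ a, (X - C (w a))) * R := by
    rw [hpR, Fintype.prod_sigma]
    simp only [w, Finset.prod_const, Finset.card_univ, Fintype.card_fin]
    rfl
  obtain ⟨S, -, hS⟩ := Finset.exists_subset_card_eq
    (s := (Finset.univ : Finset A)) (n := i - r) (by rw [Finset.card_univ]; omega)
  obtain ⟨T, hTS, hT⟩ := Finset.exists_subset_card_eq
    (s := Sᶜ) (n := k) (by rw [Finset.card_compl]; omega)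
  let e := Fintype.equivFin A
  let y : ℝ → A → ℂ := fun ε a => if a ∈ S then ((1 - ε : ℝ) : ℂ) * w a else
    if a ∈ T then w a * Complex.exp (ε * ((e a : ℕ) : ℂ) * Complex.I) else ((1 + ε : ℝ) : ℂ) * w a
  have hy0 : ∀ a, y 0 a = w a := fun a => by simp [y]
  have hyc : ∀ a, Continuous fun ε => y ε a := by
    intro a
    simp only [y]
    split_ifs <;> fun_prop
  let Q : ℝ → ℂ[X] := fun ε => (∏ a, (X - C (y ε a))) * R
  have hQm : ∀ ε, (∏ a, (X - C (y ε a))).Monic := fun ε =>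
    monic_prod_of_monic _ _ fun a _ => monic_X_sub_C _
  have hQ0 : ∀ ε, Q ε ≠ 0 := fun ε => mul_ne_zero (hQm ε).ne_zero hR0
  have hQd : ∀ ε, (Q ε).natDegree ≤ n := by
    intro ε
    have h3 := natDegree_polyOf_le x
    rw [hprod, (monic_prod_of_monic _ _ fun a _ => monic_X_sub_C _).natDegree_mul' hR0,
      natDegree_prod_of_monic _ _ fun a _ => monic_X_sub_C _] at h3
    simp only [Q]
    rw [(hQm ε).natDegree_mul' hR0, natDegree_prod_of_monic _ _ fun a _ => monic_X_sub_C _]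
    simpa only [natDegree_X_sub_C] using h3
  have hQc : Continuous fun ε => coeffVec (n + 1) (Q ε) := by
    have h3 : SmoothPoly fun v : A → ℂ => (∏ a, (X - C (v a))) * R := by
      exact SmoothPoly.mul (SmoothPoly.prod _ fun a =>
        SmoothPoly.X_sub_C (contDiff_apply ℝ ℂ a)) (SmoothPoly.const R)
    exact (h3.coeffVec (n + 1)).continuous.comp (continuous_pi hyc)
  have htend : Tendsto (fun ε => coeffVec (n + 1) (Q ε)) (𝓝[>] 0) (𝓝 x) := by
    have h3 := hQc.tendsto 0
    have h4 : coeffVec (n + 1) (Q 0) = x := by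
      simp only [Q, hy0]
      rw [← hprod, coeffVec_polyOf]
    rw [h4] at h3
    exact h3.mono_left nhdsWithin_le_nhds
  have hdist : ∀ᶠ ε : ℝ in 𝓝[>] 0, ∀ a b : A, a ≠ b →
      w a * Complex.exp (ε * ((e a : ℕ) : ℂ) * Complex.I) ≠
        w b * Complex.exp (ε * ((e b : ℕ) : ℂ) * Complex.I) := by
    rw [eventually_all]
    intro a
    rw [eventually_all]
    intro b
    by_cases hab : a = b
    · simp [hab]
    refine (eventually_rotate_ne (w a) (w b) (hw0 a) ?_).mono fun ε hε _ => hε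
    exact fun h => hab (e.injective (Fin.ext h))
  refine mem_closure_of_tendsto htend ?_
  filter_upwards [hdist, Ioo_mem_nhdsGT (show (0 : ℝ) < 1 by norm_num)] with ε hε hε1
  have hyS : ∀ a ∈ S, ‖y ε a‖ < 1 := by
    intro a ha
    simp only [y, if_pos ha, norm_mul, hwn, mul_one, Complex.norm_real, Real.norm_eq_abs]
    rw [abs_of_pos (by linarith [hε1.2])]
    linarith [hε1.1]
  have hyTeq : ∀ a ∈ T, y ε a = w a * Complex.exp (ε * ((e a : ℕ) : ℂ) * Complex.I) := by
    intro a ha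
    have : a ∉ S := Finset.mem_compl.1 (hTS ha)
    simp only [y, if_neg this, if_pos ha]
  have hyT : ∀ a ∈ T, ‖y ε a‖ = 1 := by
    intro a ha
    rw [hyTeq a ha, norm_mul, hwn, one_mul]
    have := Complex.norm_exp_ofReal_mul_I (ε * ((e a : ℕ) : ℝ))
    push_cast at this
    exact this
  have hyO : ∀ a, a ∉ S → a ∉ T → 1 < ‖y ε a‖ := by
    intro a ha ha'
    simp only [y, if_neg ha, if_neg ha', norm_mul, hwn, mul_one, Complex.norm_real,
      Real.norm_eq_abs]
    rw [abs_of_pos (by linarith [hε1.1])]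
    linarith [hε1.1]
  have hmemT : ∀ a, ‖y ε a‖ = 1 → a ∈ T := by
    intro a ha
    by_contra haT
    by_cases haS : a ∈ S
    · exact (hyS a haS).ne ha
    · exact (hyO a haS haT).ne' ha
  have htype : ∀ a, typeOf ℂ (X - C (y ε a)) =
      (if a ∈ S then 1 else 0, if a ∈ T then {(0, 1)} else 0) := by
    intro a
    by_cases haS : a ∈ S
    · have haT : a ∉ T := fun h => Finset.mem_compl.1 (hTS h) haS
      rw [typeOf_X_sub_C_of_norm_lt (hyS a haS), if_pos haS, if_neg haT]
    · by_cases haT : a ∈ T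
      · rw [typeOf_X_sub_C_of_norm_eq (hyT a haT), if_neg haS, if_pos haT]
      · rw [typeOf_X_sub_C_of_lt_norm (hyO a haS haT), if_neg haS, if_neg haT]
  have hQt : typeOf ℂ (Q ε) = (i, Multiset.replicate k (0, 1)) := by
    simp only [Q]
    rw [typeOf_mul (hQm ε).ne_zero hR0 fun v hv _ => hRc v hv, hR, typeOf_prod]
    · simp only [htype]
      refine Prod.ext ?_ ?_
      · simp only [Prod.fst_add, Prod.fst_sum, Finset.sum_ite_mem, Finset.univ_inter,
          Finset.sum_const, smul_eq_mul, mul_one, hS]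
        omega
      · simp only [Prod.snd_add, Prod.snd_sum, Finset.sum_ite_mem, Finset.univ_inter,
          Finset.sum_const, hT, add_zero]
        rw [Multiset.nsmul_singleton]
    · exact fun a _ => (monic_X_sub_C _).ne_zero
    · intro a _ b _ hab v hv hva hvb
      have hva : v = y ε a := by simpa [sub_eq_zero] using hva
      have hvb : v = y ε b := by simpa [sub_eq_zero] using hvb
      have hv : ‖v‖ = 1 := hv
      have haT := hmemT a (hva ▸ hv)
      have hbT := hmemT b (hvb ▸ hv)
      refine hε a b hab ?_
      rw [← hyTeq a haT, ← hyTeq b hbT, ← hva, ← hvb]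
  rw [← hQt]
  exact stratum_of_natDegree_le (hQ0 ε) (hQd ε)

/-- The strata of codimension `k` are dense in the common boundary over `ℂ`. -/
lemma commonBoundary_subset_closure {n k i : ℕ} (hk : 1 ≤ k) (hn : i + k ≤ n) :
    commonBoundary ℂ n k i ⊆
      closure {x | x ∈ commonBoundary ℂ n k i ∧ indexCodim ℂ n (stratumIndex x) = k} := by
  have hcount : circleCount ℂ (Multiset.replicate k (0, 1)) = k := by
    simp only [circleCount, Multiset.map_replicate, Multiset.sum_replicate, smul_eq_mul]
    exact mul_one k
  have hsub : stratum ℂ n (i, Multiset.replicate k (0, 1)) ⊆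
      {x | x ∈ commonBoundary ℂ n k i ∧ indexCodim ℂ n (stratumIndex x) = k} := by
    intro x hx
    refine ⟨mem_frontier_of_circleCount hk hcount hx, ?_⟩
    rw [stratumIndex_eq_some.2 hx]
    simp [indexCodim, typeCodim, rootCodim]
  intro x hx
  refine closure_mono hsub ?_
  by_cases hx0 : x = 0
  · subst hx0
    apply zero_mem_closure_stratum
    -- a nonempty stratum of the required type is found near `X ^ i * (X - 1) ^ k`
    have hm : (X ^ i * (X - C 1) ^ k : ℂ[X]).Monic := (monic_X_pow i).mul ((monic_X_sub_C 1).pow k)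
    have hd : (X ^ i * (X - C 1) ^ k : ℂ[X]).natDegree ≤ n := by
      rw [(monic_X_pow i).natDegree_mul ((monic_X_sub_C 1).pow k), natDegree_X_pow,
        natDegree_pow, natDegree_X_sub_C, mul_one]
      exact hn
    have ht : typeOf ℂ (X ^ i * (X - C 1) ^ k : ℂ[X]) = (i, {(0, k)}) := by
      have h1 := typeOf_X_pow_mul_prod_atom (K := ℂ) i (s := ∅) (by simp)
      rw [Finset.prod_empty, mul_one] at h1
      have h2 := typeOf_atom_pow (K := ℂ) (z := 1) (by simp [mem_rep_complex])
        (show k ≠ 0 by omega)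
      rw [typeOf_mul (monic_X_pow i).ne_zero ((monic_X_sub_C 1).pow k).ne_zero]
      · rw [h1]
        refine (congrArg _ h2).trans ?_
        refine Prod.ext ?_ ?_
        · simp
        · simp only [Prod.snd_add, Finset.empty_val, Multiset.map_zero, zero_add]
          rfl
      · intro z hz hz0
        have : z = 0 := by
          simp only [map_pow, aeval_X] at hz0
          exact eq_zero_of_pow_eq_zero hz0
        rw [mem_rep_complex, this] at hz
        simp at hz
    have hy := stratum_of_natDegree_le hm.ne_zero hd
    rw [ht] at hy
    have hcl := mem_closure_stratum_simple (i := i) (k := k) hy.1 (by rw [hy.2]) (by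
      rw [hy.2]
      simp only [circleCount, Multiset.map_singleton, Multiset.sum_singleton]
      exact Nat.add_le_add_left (one_mul k).ge i)
    exact closure_nonempty_iff.1 ⟨_, hcl⟩
  · have hb := bounds_of_mem_commonBoundary hx0 hx
    exact mem_closure_stratum_simple hx0 hb.1 hb.2

end ComplexModel

/-! ### The circle over the real numbers -/

section RealModel

/-- The real quadratic polynomial `X² - 2tX + 1`, with roots of modulus one if `|t| ≤ 1`. -/
def quad (t : ℝ) : ℝ[X] := monicOf ![1, -(2 * t)]

lemma quad_eq (t : ℝ) : quad t = X ^ 2 - C (2 * t) * X + C 1 := by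
  simp [quad, monicOf, polyOf, Fin.sum_univ_two]
  ring

lemma monic_quad (t : ℝ) : (quad t).Monic := monic_monicOf _

lemma natDegree_quad (t : ℝ) : (quad t).natDegree = 2 := natDegree_monicOf _

lemma aeval_quad (t : ℝ) (w : ℂ) : aeval w (quad t) = w ^ 2 - 2 * t * w + 1 := by
  simp [quad_eq]

lemma smoothPoly_quad : SmoothPoly quad := by
  apply SmoothPoly.monicOf
  rw [contDiff_pi]
  intro i
  fin_cases i
  · exact contDiff_const
  · exact (contDiff_const.mul contDiff_id).neg

lemma re_sq_add_im_sq {z : ℂ} (hz : ‖z‖ = 1) : z.re ^ 2 + z.im ^ 2 = 1 := by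
  have h := Complex.normSq_eq_norm_sq z
  rw [hz, Complex.normSq_apply] at h
  nlinarith

/-- Over `ℂ` the polynomial `quad (re z)` splits into the factors of `z` and of its conjugate. -/
lemma map_quad {z : ℂ} (hz : ‖z‖ = 1) : (quad z.re).map (algebraMap ℝ ℂ) =
    (X - C z) * (X - C ((starRingEnd ℂ) z)) := by
  apply Polynomial.funext
  intro w
  rw [eval_map_algebraMap, aeval_quad]
  have h1 : z * (starRingEnd ℂ) z = 1 := by
    rw [Complex.mul_conj, Complex.normSq_eq_norm_sq, hz]; simp
  have h2 : z + (starRingEnd ℂ) z = 2 * z.re := by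
    rw [Complex.add_conj]; push_cast; ring
  simp only [eval_mul, eval_sub, eval_X, eval_C]
  linear_combination (-1 : ℂ) * h1 + w * h2

lemma aeval_quad_eq_zero {z w : ℂ} (hz : ‖z‖ = 1) :
    aeval w (quad z.re) = 0 ↔ w = z ∨ w = (starRingEnd ℂ) z := by
  rw [← eval_map_algebraMap, map_quad hz]
  simp [sub_eq_zero]

open Classical in
/-- The kind of a point of the closed upper half circle: `1` and `-1` for the two real points, and
`0` for the others. -/
def realKind (z : ℂ) : SignType := if z.im = 0 then (if 0 < z.re then 1 else -1) else 0

open Classical in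
/-- The minimal polynomial over `ℝ` of a point of the circle. -/
def realAtom (z : ℂ) : ℝ[X] := if z.im = 0 then X - C z.re else quad z.re

/-- The degree of `realAtom z`, in terms of the kind of `z`. -/
def realDeg (κ : SignType) : ℕ := if κ = 0 then 2 else 1

lemma realKind_eq_zero {z : ℂ} : realKind z = 0 ↔ z.im ≠ 0 := by
  unfold realKind
  split_ifs with h h' <;> simp [h]

lemma realAtom_of_im_eq_zero {z : ℂ} (h : z.im = 0) : realAtom z = X - C z.re := if_pos h

lemma realAtom_of_im_ne_zero {z : ℂ} (h : z.im ≠ 0) : realAtom z = quad z.re := if_neg h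

lemma algebraMap_re {z : ℂ} (h : z.im = 0) : algebraMap ℝ ℂ z.re = z := by
  apply Complex.ext <;> simp [h]

lemma eq_one_or_eq_neg_one {z : ℂ} (hz : ‖z‖ = 1) (h : z.im = 0) : z = 1 ∨ z = -1 := by
  have h1 := re_sq_add_im_sq hz
  rw [h] at h1
  have h2 : (z.re - 1) * (z.re + 1) = 0 := by nlinarith
  rcases mul_eq_zero.1 h2 with h2 | h2
  · left; apply Complex.ext <;> simp [h]; linarith
  · right; apply Complex.ext <;> simp [h]; linarith

lemma realKind_one : realKind 1 = 1 := by simp [realKind]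

lemma realKind_neg_one : realKind (-1) = -1 := by
  have : ¬ (0 : ℝ) < -1 := by norm_num
  simp [realKind, this]

lemma realKind_inj {z w : ℂ} (hz : ‖z‖ = 1) (hw : ‖w‖ = 1) (h : realKind z = realKind w)
    (h0 : realKind z ≠ 0) : z = w := by
  have hzi : z.im = 0 := not_not.1 (mt realKind_eq_zero.2 h0)
  have hwi : w.im = 0 := not_not.1 (mt realKind_eq_zero.2 (h ▸ h0))
  rcases eq_one_or_eq_neg_one hz hzi with rfl | rfl <;>
    rcases eq_one_or_eq_neg_one hw hwi with rfl | rfl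
  · rfl
  · rw [realKind_one, realKind_neg_one] at h; exact absurd h (by decide)
  · rw [realKind_one, realKind_neg_one] at h; exact absurd h (by decide)
  · rfl

lemma monic_realAtom (z : ℂ) : (realAtom z).Monic := by
  unfold realAtom
  split_ifs
  · exact monic_X_sub_C _
  · exact monic_quad _

lemma natDegree_realAtom (z : ℂ) : (realAtom z).natDegree = realDeg (realKind z) := by
  by_cases h : z.im = 0
  · have h' : realKind z ≠ 0 := fun e => realKind_eq_zero.1 e h
    rw [realAtom_of_im_eq_zero h, natDegree_X_sub_C, realDeg, if_neg h']
  · rw [realAtom_of_im_ne_zero h, natDegree_quad, realDeg, if_pos (realKind_eq_zero.2 h)]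

lemma realAtom_dvd {z : ℂ} (hz : ‖z‖ = 1) (p : ℝ[X]) (hp : aeval z p = 0) : realAtom z ∣ p := by
  by_cases h : z.im = 0
  · rw [realAtom_of_im_eq_zero h, dvd_iff_isRoot, IsRoot.def]
    rw [← algebraMap_re h, aeval_algebraMap_apply] at hp
    simpa using hp
  · have := quadratic_dvd_of_aeval_eq_zero_im_ne_zero p hp h
    rw [hz, one_pow] at this
    rw [realAtom_of_im_ne_zero h, quad_eq]
    exact this

lemma aeval_realAtom_eq_zero {z w : ℂ} (hz : ‖z‖ = 1) :
    aeval w (realAtom z) = 0 ↔ w = z ∨ w = (starRingEnd ℂ) z := by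
  by_cases h : z.im = 0
  · rw [realAtom_of_im_eq_zero h, Complex.conj_eq_iff_im.2 h, or_self, map_sub, aeval_X, aeval_C,
      algebraMap_re h, sub_eq_zero]
  · rw [realAtom_of_im_ne_zero h, aeval_quad_eq_zero hz]

lemma rootMultiplicity_realAtom {z : ℂ} (hz : ‖z‖ = 1) :
    ((realAtom z).map (algebraMap ℝ ℂ)).rootMultiplicity z = 1 := by
  by_cases h : z.im = 0
  · rw [realAtom_of_im_eq_zero h, Polynomial.map_sub, map_X, map_C, algebraMap_re h,
      rootMultiplicity_X_sub_C_self]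
  · have hne : z ≠ (starRingEnd ℂ) z := fun e => h (Complex.conj_eq_iff_im.1 e.symm)
    rw [realAtom_of_im_ne_zero h, map_quad hz,
      rootMultiplicity_mul (mul_ne_zero (X_sub_C_ne_zero _) (X_sub_C_ne_zero _)),
      rootMultiplicity_X_sub_C_self, rootMultiplicity_X_sub_C, if_neg hne]

/-- The representatives are the points of the closed upper half circle. The special points are
`1` and `-1`; the atoms of the other points are quadratic. -/
instance realCircleModel : CircleModel ℝ where
  rep := {z | ‖z‖ = 1 ∧ 0 ≤ z.im}
  kind := realKind
  atom := realAtom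
  deg := realDeg
  norm_eq_one := fun _ hz => hz.1
  kind_inj := fun _ hz _ hw h h0 => realKind_inj hz.1 hw.1 h h0
  monic_atom := fun z _ => monic_realAtom z
  natDegree_atom := fun z _ => natDegree_realAtom z
  finrank_mul_deg := fun z _ => by
    simp [weight, realDeg]
  atom_dvd := fun _ hz p hp => realAtom_dvd hz.1 p hp
  aeval_atom := fun _ hz => (aeval_realAtom_eq_zero hz.1).2 (Or.inl rfl)
  rootMultiplicity_atom := fun _ hz => rootMultiplicity_realAtom hz.1
  eq_of_aeval_atom := by
    intro z hz w hw h
    rcases (aeval_realAtom_eq_zero hz.1).1 h with h | h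
    · exact h
    · have h1 := hw.2
      rw [h, Complex.conj_im] at h1
      rw [h]
      exact Complex.conj_eq_iff_im.2 (le_antisymm (by linarith) hz.2)
  norm_of_aeval_atom := by
    intro z hz w h
    rcases (aeval_realAtom_eq_zero hz.1).1 h with h | h
    · rw [h]; exact hz.1
    · rw [h, RCLike.norm_conj]; exact hz.1
  exists_rep := by
    intro w hw
    rcases le_total 0 w.im with h | h
    · exact ⟨w, ⟨hw, h⟩, fun _ h => h⟩
    · refine ⟨(starRingEnd ℂ) w, ⟨by rw [RCLike.norm_conj]; exact hw, by simpa using h⟩, ?_⟩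
      intro p hp
      rw [aeval_conj, hp, map_zero]

lemma mem_rep_real {z : ℂ} : z ∈ CircleModel.rep ℝ ↔ ‖z‖ = 1 ∧ 0 ≤ z.im := Iff.rfl

lemma natDegree_quad_pow (t : ℝ) (μ : ℕ) : (quad t ^ μ).natDegree = 2 * μ := by
  rw [natDegree_pow, natDegree_quad, mul_comm]

lemma nextCoeff_quad_pow (t : ℝ) (μ : ℕ) : (quad t ^ μ).nextCoeff = μ * (-(2 * t)) := by
  rw [(monic_quad t).nextCoeff_pow, nsmul_eq_mul, quad, nextCoeff_monicOf (by norm_num)]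
  rfl

/-- Points of the open upper half circle are determined by their real parts, which lie
in `(-1, 1)`. -/
lemma re_mem_Ioo {z : ℂ} (hz : ‖z‖ = 1) (h : z.im ≠ 0) : z.re ∈ Set.Ioo (-1 : ℝ) 1 := by
  have h1 := re_sq_add_im_sq hz
  have h2 : 0 < z.im ^ 2 := by positivity
  constructor <;> nlinarith

/-- The point of the upper half circle with real part `t`. -/
def upperPoint (t : ℝ) : ℂ := ⟨t, Real.sqrt (1 - t ^ 2)⟩

lemma upperPoint_im_pos {t : ℝ} (ht : t ∈ Set.Ioo (-1 : ℝ) 1) : 0 < (upperPoint t).im :=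
  Real.sqrt_pos.2 (by nlinarith [ht.1, ht.2])

lemma norm_upperPoint {t : ℝ} (ht : t ∈ Set.Ioo (-1 : ℝ) 1) : ‖upperPoint t‖ = 1 := by
  have h1 : 0 ≤ 1 - t ^ 2 := by nlinarith [ht.1, ht.2]
  have h2 : Complex.normSq (upperPoint t) = 1 := by
    rw [Complex.normSq_apply, upperPoint, Real.mul_self_sqrt h1]; ring
  rw [Complex.normSq_eq_norm_sq] at h2
  nlinarith [norm_nonneg (upperPoint t)]

lemma upperPoint_mem_rep {t : ℝ} (ht : t ∈ Set.Ioo (-1 : ℝ) 1) :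
    upperPoint t ∈ CircleModel.rep ℝ := ⟨norm_upperPoint ht, (upperPoint_im_pos ht).le⟩

lemma realKind_upperPoint {t : ℝ} (ht : t ∈ Set.Ioo (-1 : ℝ) 1) : realKind (upperPoint t) = 0 :=
  realKind_eq_zero.2 (upperPoint_im_pos ht).ne'

lemma realAtom_upperPoint {t : ℝ} (ht : t ∈ Set.Ioo (-1 : ℝ) 1) :
    realAtom (upperPoint t) = quad t :=
  realAtom_of_im_ne_zero (upperPoint_im_pos ht).ne'

/-- The powers `quad t ^ μ` with `-1 < t < 1` form a curve. -/
lemma isSubmanifold_curve_real (μ : ℕ) (hμ : μ ≠ 0) :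
    IsSubmanifold {u : Fin (realDeg 0 * μ) → ℝ | ∃ z ∈ CircleModel.rep ℝ, realKind z = 0 ∧
      monicOf u = realAtom z ^ μ} (2 * μ - 1) := by
  have hm : 0 < 2 * μ := by omega
  have hμ' : (μ : ℝ) ≠ 0 := Nat.cast_ne_zero.2 hμ
  change IsSubmanifold {u : Fin (2 * μ) → ℝ | ∃ z ∈ CircleModel.rep ℝ, realKind z = 0 ∧
      monicOf u = realAtom z ^ μ} (2 * μ - 1)
  have hfr : 2 * μ - 1 = Module.finrank ℝ (Fin (2 * μ) → ℝ) - 1 := by simp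
  rw [hfr]
  -- the parameter `t` of `quad t ^ μ` is a linear function of the next-to-leading coefficient
  let L : (Fin (2 * μ) → ℝ) →L[ℝ] ℝ := (-(2 * (μ : ℝ))⁻¹) •
    ContinuousLinearMap.proj (R := ℝ) (φ := fun _ : Fin (2 * μ) => ℝ) ⟨2 * μ - 1, by omega⟩
  have hLa : ∀ u, L u = -(2 * (μ : ℝ))⁻¹ * u ⟨2 * μ - 1, by omega⟩ := fun u => rfl
  have hL : ∀ (u : Fin (2 * μ) → ℝ) (t : ℝ), monicOf u = quad t ^ μ → L u = t := by
    intro u t h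
    have h1 := nextCoeff_monicOf hm u
    rw [h, nextCoeff_quad_pow] at h1
    rw [hLa, ← h1]
    field_simp
  have hmon : ∀ t, monicOf (coeffVec (2 * μ) (quad t ^ μ)) = quad t ^ μ := fun t =>
    monicOf_coeffVec ((monic_quad t).pow μ) (natDegree_quad_pow t μ)
  refine isSubmanifold_of_graph fun x _ => ⟨Set.univ, L,
    Pi.single ⟨2 * μ - 1, by omega⟩ (-(2 * (μ : ℝ))), fun t => coeffVec _ (quad t ^ μ),
    Set.Ioo (-1) 1, isOpen_univ, Set.mem_univ _, isOpen_Ioo, ?_, ?_, ?_, ?_⟩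
  · rw [hLa, Pi.single_eq_same]
    field_simp
  · exact ((smoothPoly_quad.pow μ).coeffVec _).contDiffOn
  · exact fun t _ => hL _ t (hmon t)
  · intro y _
    constructor
    · rintro ⟨z, hz, hz0, hy⟩
      have him := realKind_eq_zero.1 hz0
      rw [realAtom_of_im_ne_zero him] at hy
      exact ⟨z.re, re_mem_Ioo hz.1 him, by simp only [← hy, coeffVec_monicOf]⟩
    · rintro ⟨t, ht, rfl⟩
      refine ⟨upperPoint t, upperPoint_mem_rep ht, realKind_upperPoint ht, ?_⟩
      rw [realAtom_upperPoint ht, hmon]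

end RealModel

/-! ### Möbius transformations of the disk -/

section Moebius

/-- The homogenization of a polynomial `p` of degree at most `m`, evaluated
at `(X + s, 1 + s X)`. The roots of the result are the images of the roots of `p` under the Möbius
transformation `z ↦ (z - s) / (1 - s z)`. -/
def moebiusPoly {F : Type} [Field F] (s : F) (m : ℕ) (p : F[X]) : F[X] :=
  ∑ j ∈ Finset.range (m + 1), C (p.coeff j) * ((X + C s) ^ j * (1 + C s * X) ^ (m - j))

lemma coeff_moebiusPoly {F : Type} [Field F] (s : F) (m : ℕ) (p : F[X]) (i : ℕ) :
    (moebiusPoly s m p).coeff i = ∑ j ∈ Finset.range (m + 1),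
      p.coeff j * ((X + C s) ^ j * (1 + C s * X) ^ (m - j) : F[X]).coeff i := by
  rw [moebiusPoly, finsetSum_coeff]
  exact Finset.sum_congr rfl fun j _ => coeff_C_mul _

lemma map_moebiusPoly {F F' : Type} [Field F] [Field F'] (f : F →+* F') (s : F) (m : ℕ)
    (p : F[X]) : (moebiusPoly s m p).map f = moebiusPoly (f s) m (p.map f) := by
  simp [moebiusPoly, Polynomial.map_sum]

lemma eval_moebiusPoly {F : Type} [Field F] (s : F) {m : ℕ} {p : F[X]} (hp : p.natDegree ≤ m)
    {w : F} (hw : 1 + s * w ≠ 0) :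
    (moebiusPoly s m p).eval w = (1 + s * w) ^ m * p.eval ((w + s) / (1 + s * w)) := by
  rw [moebiusPoly, eval_finsetSum, eval_eq_sum_range' (Nat.lt_succ_of_le hp), Finset.mul_sum]
  refine Finset.sum_congr rfl fun j hj => ?_
  have hj : j ≤ m := Nat.lt_succ_iff.1 (Finset.mem_range.1 hj)
  simp only [eval_mul, eval_pow, eval_add, eval_C, eval_X, eval_one]
  rw [div_pow]
  have : (1 + s * w) ^ m = (1 + s * w) ^ (m - j) * (1 + s * w) ^ j := by
    rw [← pow_add, Nat.sub_add_cancel hj]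
  have hj0 := pow_ne_zero j hw
  rw [this]
  generalize (1 + s * w) ^ j = A at hj0 ⊢
  field_simp

/-- Two polynomials are equal if they agree away from the pole of a Möbius transformation. -/
lemma eq_of_eval_eq {F : Type} [Field F] [Infinite F] (s : F) {p q : F[X]}
    (h : ∀ w, 1 + s * w ≠ 0 → p.eval w = q.eval w) : p = q := by
  have h0 : (1 + C s * X : F[X]) ≠ 0 := by
    intro e
    have := congrArg (eval 0) e
    simp at this
  refine mul_left_cancel₀ h0 (Polynomial.funext fun w => ?_)
  by_cases hw : 1 + s * w = 0
  · simp [hw]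
  · rw [eval_mul, eval_mul, h w hw]

lemma moebiusPoly_prod {F : Type} [Field F] [Infinite F] (s : F) (Λ : Multiset F) :
    moebiusPoly s (Multiset.card Λ) (Λ.map fun l => X - C l).prod =
      (Λ.map fun l => C (1 - s * l) * X - C (l - s)).prod := by
  refine eq_of_eval_eq s fun w hw => ?_
  rw [eval_moebiusPoly s (natDegree_multiset_prod_X_sub_C_eq_card Λ).le hw,
    eval_multiset_prod, eval_multiset_prod, Multiset.map_map, Multiset.map_map]
  induction Λ using Multiset.induction_on with
  | empty => simp
  | cons l Λ ih =>
    rw [Multiset.card_cons, Multiset.map_cons, Multiset.map_cons, Multiset.prod_cons,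
      Multiset.prod_cons, ← ih, pow_succ]
    simp only [Function.comp_apply, eval_sub, eval_mul, eval_X, eval_C]
    field_simp
    ring

/-- The Möbius transformation of the disk attached to `s ∈ (-1, 1)`. -/
def moebius (s : ℝ) (z : ℂ) : ℂ := (z - s) / (1 - s * z)

lemma moebiusPoly_eq_C_mul {s : ℝ} (Λ : Multiset ℂ) (hΛ : ∀ l ∈ Λ, 1 - s * l ≠ 0) :
    moebiusPoly (s : ℂ) (Multiset.card Λ) (Λ.map fun l => X - C l).prod =
      C (Λ.map fun l => 1 - (s : ℂ) * l).prod *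
        ((Λ.map (moebius s)).map fun l => X - C l).prod := by
  rw [moebiusPoly_prod, map_multiset_prod, Multiset.map_map, Multiset.map_map,
    ← Multiset.prod_map_mul]
  refine congrArg Multiset.prod (Multiset.map_congr rfl fun l hl => ?_)
  have : l - s = (1 - s * l) * moebius s l := by
    rw [moebius, mul_div_cancel₀ _ (hΛ l hl)]
  simp only [Function.comp_apply]
  rw [this, C_mul]
  ring

lemma moebius_injOn (s : ℝ) (hs : s ∈ Set.Ioo (-1 : ℝ) 1) :
    Set.InjOn (moebius s) {z | 1 - s * z ≠ 0} := by
  intro z hz w hw h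
  have hz : 1 - s * z ≠ 0 := hz
  have hw : 1 - s * w ≠ 0 := hw
  rw [moebius, moebius, div_eq_div_iff hz hw] at h
  have h1 : (1 - (s : ℂ) ^ 2) * (z - w) = 0 := by linear_combination h
  have h2 : (1 - (s : ℂ) ^ 2) ≠ 0 := by
    have : (1 - s ^ 2 : ℝ) ≠ 0 := by nlinarith [hs.1, hs.2]
    exact_mod_cast this
  exact sub_eq_zero.1 ((mul_eq_zero.1 h1).resolve_left h2)

lemma normSq_sub_normSq (s : ℝ) (z : ℂ) : Complex.normSq (1 - s * z) - Complex.normSq (z - s) =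
    (1 - s ^ 2) * (1 - Complex.normSq z) := by
  simp only [Complex.normSq_apply, Complex.sub_re, Complex.sub_im, Complex.mul_re, Complex.mul_im,
    Complex.one_re, Complex.one_im, Complex.ofReal_re, Complex.ofReal_im]
  ring

lemma moebius_im (s : ℝ) (z : ℂ) :
    (moebius s z).im = z.im * ((1 - s ^ 2) / Complex.normSq (1 - s * z)) := by
  rw [moebius, Complex.div_im]
  simp only [Complex.sub_re, Complex.sub_im, Complex.mul_re, Complex.mul_im,
    Complex.one_re, Complex.one_im, Complex.ofReal_re, Complex.ofReal_im]
  ring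

variable {s : ℝ} {z : ℂ}

lemma moebius_factor_pos (hs : s ∈ Set.Ioo (-1 : ℝ) 1) (hz : 1 - s * z ≠ 0) :
    0 < (1 - s ^ 2) / Complex.normSq (1 - s * z) :=
  div_pos (by nlinarith [hs.1, hs.2]) (Complex.normSq_pos.2 hz)

lemma normSq_moebius (hz : 1 - s * z ≠ 0) :
    1 - Complex.normSq (moebius s z) =
    (1 - s ^ 2) / Complex.normSq (1 - s * z) * (1 - Complex.normSq z) := by
  have h := normSq_sub_normSq s z
  have hz' := (Complex.normSq_pos.2 hz).ne'
  rw [moebius, Complex.normSq_div, div_mul_eq_mul_div, ← h, sub_div, div_self hz']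

lemma norm_moebius_lt (hs : s ∈ Set.Ioo (-1 : ℝ) 1) (hz : 1 - s * z ≠ 0) :
    ‖moebius s z‖ < 1 ↔ ‖z‖ < 1 := by
  have h := normSq_moebius hz
  have hp := moebius_factor_pos hs hz
  have h1 : ∀ w : ℂ, ‖w‖ < 1 ↔ 0 < 1 - Complex.normSq w := fun w => by
    rw [Complex.normSq_eq_norm_sq, sub_pos, sq_lt_one_iff₀ (norm_nonneg _)]
  rw [h1, h1, h, mul_pos_iff_of_pos_left hp]

lemma norm_moebius_eq (hs : s ∈ Set.Ioo (-1 : ℝ) 1) (hz : 1 - s * z ≠ 0) :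
    ‖moebius s z‖ = 1 ↔ ‖z‖ = 1 := by
  have h := normSq_moebius hz
  have hp := moebius_factor_pos hs hz
  have h1 : ∀ w : ℂ, ‖w‖ = 1 ↔ 1 - Complex.normSq w = 0 := fun w => by
    rw [Complex.normSq_eq_norm_sq, sub_eq_zero, eq_comm (a := (1 : ℝ)),
      pow_eq_one_iff_of_nonneg (norm_nonneg w) two_ne_zero]
  rw [h1, h1, h, mul_eq_zero, or_iff_right hp.ne']

lemma moebius_mem_rep (hs : s ∈ Set.Ioo (-1 : ℝ) 1) (hz : 1 - s * z ≠ 0) :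
    moebius s z ∈ CircleModel.rep ℝ ↔ z ∈ CircleModel.rep ℝ := by
  rw [mem_rep_real, mem_rep_real, norm_moebius_eq hs hz, moebius_im,
    mul_nonneg_iff_of_pos_right (moebius_factor_pos hs hz)]

lemma realKind_moebius (hs : s ∈ Set.Ioo (-1 : ℝ) 1) (hz : 1 - s * z ≠ 0)
    (hz1 : ‖z‖ = 1) : realKind (moebius s z) = realKind z := by
  by_cases h : z.im = 0
  · have hs1 : ((1 : ℂ) - s) ≠ 0 := by
      have : (1 - s : ℝ) ≠ 0 := by linarith [hs.2]
      exact_mod_cast this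
    have hs2 : ((1 : ℂ) + s) ≠ 0 := by
      have : (1 + s : ℝ) ≠ 0 := by linarith [hs.1]
      exact_mod_cast this
    rcases eq_one_or_eq_neg_one hz1 h with rfl | rfl
    · rw [moebius, mul_one, div_self hs1]
    · rw [moebius, mul_neg_one, sub_neg_eq_add, show (-1 - s : ℂ) = -(1 + s) by ring, neg_div,
        div_self hs2]
  · rw [realKind_eq_zero.2 h, realKind_eq_zero, moebius_im]
    exact mul_ne_zero h (moebius_factor_pos hs hz).ne'

/-- Möbius transformations of the disk that commute with complex conjugation preserve types
over `ℝ`. -/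
lemma typ_map_moebius (hs : s ∈ Set.Ioo (-1 : ℝ) 1) (Λ : Multiset ℂ)
    (hΛ : ∀ l ∈ Λ, 1 - s * l ≠ 0) : typ ℝ (Λ.map (moebius s)) = typ ℝ Λ := by
  refine typ_map _ ((moebius_injOn s hs).mono fun z hz => hΛ z hz) ?_ ?_ ?_
  · exact fun z hz => norm_moebius_lt hs (hΛ z hz)
  · exact fun z hz => moebius_mem_rep hs (hΛ z hz)
  · exact fun z hz hzr => realKind_moebius hs (hΛ z hz) hzr.1

end Moebius

/-! ### Transport along the circle over the real numbers -/

section Transport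

variable {s : ℝ}

/-- The monic polynomial of degree `m` whose roots are the images of those of `p` under a Möbius
transformation, if none of these is at infinity. -/
def moebiusMonic (s : ℝ) (m : ℕ) (p : ℝ[X]) : ℝ[X] :=
  C ((moebiusPoly s m p).coeff m)⁻¹ * moebiusPoly s m p

lemma moebiusMonic_spec {m : ℕ} {p : ℝ[X]} (hp : p.Monic) (hm : p.natDegree = m)
    (h : ∀ l ∈ p.aroots ℂ, 1 - s * l ≠ 0) :
    (moebiusMonic s m p).Monic ∧ (moebiusMonic s m p).natDegree = m ∧
      (moebiusMonic s m p).aroots ℂ = (p.aroots ℂ).map (moebius s) := by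
  set Λ := p.aroots ℂ with hΛ
  have hsplit : (p.map (algebraMap ℝ ℂ)).Splits := IsAlgClosed.splits _
  have hcard : Multiset.card Λ = m := by
    rw [hΛ, aroots_def, ← hsplit.natDegree_eq_card_roots, natDegree_map, hm]
  have hprod : p.map (algebraMap ℝ ℂ) = (Λ.map fun l => X - C l).prod := by
    exact hsplit.eq_prod_roots_of_monic (hp.map _)
  have hmap := map_moebiusPoly (algebraMap ℝ ℂ) s m p
  have hc0 : (Λ.map fun l => 1 - (s : ℂ) * l).prod ≠ 0 := by
    rw [Ne, Multiset.prod_eq_zero_iff, Multiset.mem_map]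
    rintro ⟨l, hl, e⟩
    exact h l hl e
  rw [hprod, ← hcard] at hmap
  rw [show (algebraMap ℝ ℂ) s = (s : ℂ) from rfl, moebiusPoly_eq_C_mul Λ h, hcard] at hmap
  have hmon : ((Λ.map (moebius s)).map fun l => X - C l).prod.Monic :=
    monic_multiset_prod_of_monic _ _ fun l _ => monic_X_sub_C l
  have hdeg : ((Λ.map (moebius s)).map fun l => X - C l).prod.natDegree = m := by
    rw [natDegree_multiset_prod_X_sub_C_eq_card, Multiset.card_map, hcard]
  have hd : (moebiusPoly s m p).natDegree = m := by
    rw [← natDegree_map (algebraMap ℝ ℂ), hmap, natDegree_C_mul hc0, hdeg]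
  have hne : moebiusPoly s m p ≠ 0 := by
    intro e
    rw [e, Polynomial.map_zero] at hmap
    exact mul_ne_zero (C_ne_zero.2 hc0) hmon.ne_zero hmap.symm
  have hlc : (moebiusPoly s m p).coeff m ≠ 0 := by
    have h1 := leadingCoeff_ne_zero.2 hne
    rwa [leadingCoeff, hd] at h1
  refine ⟨?_, ?_, ?_⟩
  · rw [Monic, moebiusMonic, leadingCoeff_mul, leadingCoeff_C, leadingCoeff, hd,
      inv_mul_cancel₀ hlc]
  · rw [moebiusMonic, natDegree_C_mul (inv_ne_zero hlc), hd]
  · rw [moebiusMonic, aroots_C_mul _ (inv_ne_zero hlc), aroots_def, hmap, roots_C_mul _ hc0,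
      roots_multiset_prod_X_sub_C]

/-- A Möbius transformation that moves `quad t` to `quad t'`. -/
lemma exists_moebius_quad {t t' : ℝ} (ht : t ∈ Set.Ioo (-1 : ℝ) 1) (ht' : t' ∈ Set.Ioo (-1 : ℝ) 1) :
    ∃ s ∈ Set.Ioo (-1 : ℝ) 1, t * (1 + s ^ 2) - 2 * s = t' * (1 + s ^ 2 - 2 * t * s) := by
  let f : ℝ → ℝ := fun s => t * (1 + s ^ 2) - 2 * s - t' * (1 + s ^ 2 - 2 * t * s)
  have hf : ContinuousOn f (Set.Icc (-1) 1) := by fun_prop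
  have h := intermediate_value_Ioo' (by norm_num : (-1 : ℝ) ≤ 1) hf
  obtain ⟨s, hs, hs0⟩ := h (show (0 : ℝ) ∈ Set.Ioo (f 1) (f (-1)) by
    simp only [f]
    constructor
    · nlinarith [mul_pos (sub_pos.2 ht.2) (show 0 < 1 + t' by linarith [ht'.1])]
    · nlinarith [mul_pos (sub_pos.2 ht'.2) (show 0 < 1 + t by linarith [ht.1])])
  exact ⟨s, hs, by simp only [f] at hs0; linarith⟩

lemma moebiusPoly_quad_pow {t t' : ℝ} (μ : ℕ)
    (h : t * (1 + s ^ 2) - 2 * s = t' * (1 + s ^ 2 - 2 * t * s)) :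
    moebiusPoly s (2 * μ) (quad t ^ μ) = C ((1 + s ^ 2 - 2 * t * s) ^ μ) * quad t' ^ μ := by
  refine eq_of_eval_eq s fun w hw => ?_
  rw [eval_moebiusPoly s (natDegree_quad_pow t μ).le hw, eval_mul, eval_pow, eval_pow, eval_C,
    pow_mul, ← mul_pow, ← mul_pow]
  congr 1
  simp only [quad_eq, eval_add, eval_sub, eval_mul, eval_pow, eval_C, eval_X]
  field_simp
  linear_combination (-(2 * w)) * h

lemma moebiusMonic_quad_pow {t t' : ℝ} (ht : t ∈ Set.Ioo (-1 : ℝ) 1)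
    (μ : ℕ) (h : t * (1 + s ^ 2) - 2 * s = t' * (1 + s ^ 2 - 2 * t * s)) :
    (moebiusPoly s (2 * μ) (quad t ^ μ)).coeff (2 * μ) ≠ 0 ∧
      moebiusMonic s (2 * μ) (quad t ^ μ) = quad t' ^ μ := by
  have hD : (1 + s ^ 2 - 2 * t * s) ^ μ ≠ 0 := by
    apply pow_ne_zero
    have : 0 < 1 - t ^ 2 := by nlinarith [ht.1, ht.2]
    nlinarith [sq_nonneg (s - t)]
  have hc : (moebiusPoly s (2 * μ) (quad t ^ μ)).coeff (2 * μ) = (1 + s ^ 2 - 2 * t * s) ^ μ := by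
    rw [moebiusPoly_quad_pow μ h, coeff_C_mul]
    have h1 := ((monic_quad t').pow μ).coeff_natDegree
    rw [natDegree_quad_pow] at h1
    rw [h1, mul_one]
  refine ⟨hc ▸ hD, ?_⟩
  rw [moebiusMonic, hc, moebiusPoly_quad_pow μ h, ← mul_assoc, ← C_mul, inv_mul_cancel₀ hD, C_1,
    one_mul]

/-- Möbius transformations of the disk move any point of the open upper half circle to any other
one. -/
lemma exists_transport_quad {t t' : ℝ} (ht : t ∈ Set.Ioo (-1 : ℝ) 1)
    (ht' : t' ∈ Set.Ioo (-1 : ℝ) 1) (μ : ℕ) :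
    ∃ g : (Fin (2 * μ) → ℝ) → (Fin (2 * μ) → ℝ),
      Tendsto g (𝓝 (coeffVec _ (quad t ^ μ))) (𝓝 (coeffVec _ (quad t' ^ μ))) ∧
      ∀ᶠ u in 𝓝 (coeffVec _ (quad t ^ μ)), typeOf ℝ (monicOf (g u)) = typeOf ℝ (monicOf u) := by
  obtain ⟨s, hs, h⟩ := exists_moebius_quad ht ht'
  have hmon : monicOf (coeffVec (2 * μ) (quad t ^ μ)) = quad t ^ μ :=
    monicOf_coeffVec ((monic_quad t).pow μ) (natDegree_quad_pow t μ)
  refine ⟨fun u => coeffVec _ (moebiusMonic s (2 * μ) (monicOf u)), ?_, ?_⟩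
  · have hq := moebiusMonic_quad_pow ht μ h
    have hcc : ∀ i, Continuous fun u : Fin (2 * μ) → ℝ =>
        (moebiusPoly s (2 * μ) (monicOf u)).coeff i := by
      intro i
      simp only [coeff_moebiusPoly]
      refine continuous_finsetSum _ fun j _ => Continuous.mul ?_ continuous_const
      exact ((SmoothPoly.monicOf (K := ℝ) (v := fun u : Fin (2 * μ) → ℝ => u)
        contDiff_id) j).continuous
    have hcont : ContinuousAt (fun u : Fin (2 * μ) → ℝ =>
        coeffVec (2 * μ) (moebiusMonic s (2 * μ) (monicOf u))) (coeffVec _ (quad t ^ μ)) := by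
      rw [continuousAt_pi]
      intro i
      simp only [coeffVec, moebiusMonic, coeff_C_mul]
      refine ((hcc _).continuousAt.inv₀ ?_).mul (hcc _).continuousAt
      rw [hmon]
      exact hq.1
    have h1 := hcont.tendsto
    simp only [hmon, hq.2] at h1
    exact h1
  · have hev : ∀ᶠ u in 𝓝 (coeffVec (2 * μ) (quad t ^ μ)),
        ∀ l ∈ (monicOf u).aroots ℂ, 1 - s * l ≠ 0 := by
      by_cases hs0 : s = 0
      · simp [hs0]
      have hsC : (s : ℂ) ≠ 0 := by exact_mod_cast hs0
      -- the pole `1 / s` of the Möbius transformation lies outside the closed disk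
      have hne : aeval (1 / (s : ℂ)) (monicOf (coeffVec (2 * μ) (quad t ^ μ))) ≠ 0 := by
        rw [hmon, map_pow]
        refine pow_ne_zero _ fun e => ?_
        rw [← realAtom_upperPoint ht] at e
        have h1 := CircleModel.norm_of_aeval_atom _ (upperPoint_mem_rep ht) _ e
        rw [norm_div, norm_one, Complex.norm_real, Real.norm_eq_abs,
          div_eq_iff (abs_ne_zero.2 hs0), one_mul] at h1
        exact (abs_lt.2 hs).ne h1.symm
      have hct : Continuous fun u : Fin (2 * μ) → ℝ => aeval (1 / (s : ℂ)) (monicOf u) :=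
        (continuous_aeval_monicOf (K := ℝ)).comp (continuous_id.prodMk continuous_const)
      refine (hct.continuousAt.eventually_ne hne).mono fun u hu l hl e => hu ?_
      have hl' : l = 1 / (s : ℂ) := by
        rw [eq_div_iff hsC]
        linear_combination -e
      rw [← hl']
      exact (mem_aroots.1 hl).2
    refine hev.mono fun u hu => ?_
    obtain ⟨h1, h2, h3⟩ := moebiusMonic_spec (monic_monicOf u) (natDegree_monicOf u) hu
    simp only
    rw [monicOf_coeffVec h1 h2, typeOf, typeOf, h3]
    exact typ_map_moebius hs _ hu

instance realMovingCircleModel : MovingCircleModel ℝ where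
  isSubmanifold_curve := isSubmanifold_curve_real
  exists_transport := by
    intro z hz z' hz' h h' μ
    have hi := realKind_eq_zero.1 h
    have hi' := realKind_eq_zero.1 h'
    have h1 := exists_transport_quad (re_mem_Ioo hz.1 hi) (re_mem_Ioo hz'.1 hi') μ
    rw [← realAtom_of_im_ne_zero hi, ← realAtom_of_im_ne_zero hi'] at h1
    exact h1

end Transport

/-! ### Right invertible operators with a finite-dimensional kernel -/

section RightInvertible

variable {H : Type*} [NormedAddCommGroup H] [InnerProductSpace ℂ H]

/-- `F` has a bounded right inverse and a kernel of finite dimension `k`. -/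
def IsRightInvertible (F : H →L[ℂ] H) (k : ℕ) : Prop :=
  (∃ B : H →L[ℂ] H, F * B = 1) ∧ FiniteDimensional ℂ F.ker ∧ Module.finrank ℂ F.ker = k

lemma IsRightInvertible.of_mul_eq_one {F B : H →L[ℂ] H} (h : F * B = 1) (h' : B * F = 1) :
    IsRightInvertible F 0 := by
  have hker : F.ker = ⊥ := by
    rw [LinearMap.ker_eq_bot']
    intro x hx
    have h1 : (B * F) x = x := by rw [h']; rfl
    rw [← h1]
    change B (F x) = 0
    rw [show F x = 0 from hx, map_zero]
  refine ⟨⟨B, h⟩, ?_, ?_⟩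
  · rw [hker]; infer_instance
  · rw [hker]; exact finrank_bot ℂ H

/-- Right invertible operators are closed under composition, and the dimensions of the kernels add
up. -/
lemma IsRightInvertible.mul {F G : H →L[ℂ] H} {k l : ℕ} (hF : IsRightInvertible F k)
    (hG : IsRightInvertible G l) : IsRightInvertible (F * G) (k + l) := by
  obtain ⟨⟨B, hB⟩, hF1, hF2⟩ := hF
  obtain ⟨⟨D, hD⟩, hG1, hG2⟩ := hG
  have hGD : ∀ x, G (D x) = x := fun x => by
    have := congrArg (fun T : H →L[ℂ] H => T x) hD
    exact this
  -- `x ↦ (G x, x - D (G x))` identifies the kernel of `F G` with the product of the kernels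
  let e : (F * G).ker ≃ₗ[ℂ] F.ker × G.ker :=
    { toFun := fun x => (⟨G x, x.2⟩, ⟨x - D (G x), by
        change G ((x : H) - D (G x)) = 0
        rw [map_sub, hGD, sub_self]⟩)
      map_add' := fun x y => by
        refine Prod.ext (Subtype.ext ?_) (Subtype.ext ?_)
        · exact map_add G (x : H) y
        · change (x : H) + y - D (G ((x : H) + y)) = (x - D (G x)) + (y - D (G y))
          rw [map_add, map_add]
          abel
      map_smul' := fun c x => by
        refine Prod.ext (Subtype.ext ?_) (Subtype.ext ?_)
        · exact map_smul G c (x : H)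
        · change c • (x : H) - D (G (c • (x : H))) = c • ((x : H) - D (G x))
          rw [map_smul, map_smul, smul_sub]
      invFun := fun y => ⟨D y.1 + y.2, by
        change F (G (D y.1 + y.2)) = 0
        rw [map_add, hGD, show G (y.2 : H) = 0 from y.2.2, add_zero]
        exact y.1.2⟩
      left_inv := fun x => by
        apply Subtype.ext
        simp
      right_inv := fun y => by
        have hy : G (y.2 : H) = 0 := y.2.2
        refine Prod.ext (Subtype.ext ?_) (Subtype.ext ?_) <;> simp [hGD, hy] }
  refine ⟨⟨D * B, ?_⟩, Module.Finite.equiv e.symm, ?_⟩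
  · rw [mul_assoc, ← mul_assoc G, hD, one_mul, hB]
  · rw [e.finrank_eq, Module.finrank_prod, hF2, hG2]

lemma isCompactOperator_of_range_le [CompleteSpace H] (T : H →L[ℂ] H) (W : Submodule ℂ H)
    [FiniteDimensional ℂ W] (h : ∀ x, T x ∈ W) : IsCompactOperator T := by
  have : ProperSpace W := FiniteDimensional.proper ℂ W
  have h1 := (isCompactOperator_of_locallyCompactSpace_rng W.subtypeL).comp_clm
    (T.codRestrict W h)
  exact h1

/-- The adjoint of a right invertible operator is injective, so that the index is the dimension of
the kernel. -/
lemma IsRightInvertible.isFredholmOp [CompleteSpace H] {F : H →L[ℂ] H} {k : ℕ}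
    (hF : IsRightInvertible F k) : IsFredholmOp F ∧ fredholmIndex F = k := by
  obtain ⟨⟨B, hB⟩, hF1, hF2⟩ := hF
  refine ⟨⟨B, ?_, ?_⟩, ?_⟩
  · rw [hB, sub_self]
    exact isCompactOperator_zero
  · refine isCompactOperator_of_range_le _ F.ker fun x => ?_
    change F (x - B (F x)) = 0
    rw [map_sub, show F (B (F x)) = (F * B) (F x) from rfl, hB]
    exact sub_self _
  · have hker : (ContinuousLinearMap.adjoint F).ker = ⊥ := by
      rw [LinearMap.ker_eq_bot']
      intro x hx
      have h1 := ContinuousLinearMap.adjoint_comp F B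
      rw [show F ∘SL B = F * B from rfl, hB] at h1
      have h2 := congrArg (fun T : H →L[ℂ] H => T x) h1
      have h3 : ContinuousLinearMap.adjoint F x = 0 := hx
      simp only [ContinuousLinearMap.comp_apply, h3, map_zero] at h2
      rw [← h2, ← ContinuousLinearMap.star_eq_adjoint, star_one]
      rfl
    rw [fredholmIndex, hF2, hker, finrank_bot]
    simp

end RightInvertible

/-! ### Which polynomials of the shift are Fredholm -/

section Shift

/-- The sequence `0, x₀, x₁, …`. -/
def consZero (x : ℕ → ℂ) : ℕ → ℂ
  | 0 => 0
  | m + 1 => x m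

lemma hasSum_norm_consZero (x : ℓ²(ℕ, ℂ)) :
    HasSum (fun m => ‖consZero x m‖ ^ (2 : ENNReal).toReal) (‖x‖ ^ (2 : ENNReal).toReal) := by
  have h := (hasSum_nat_add_iff (f := fun m => ‖consZero x m‖ ^ (2 : ENNReal).toReal) 1).1
      (lp.hasSum_norm (by norm_num) x)
  simpa [consZero] using h

/-- The right shift `eₘ ↦ eₘ₊₁`, a right inverse of `shift`. -/
def rightShift : ℓ²(ℕ, ℂ) →L[ℂ] ℓ²(ℕ, ℂ) :=
  LinearMap.mkContinuous
    { toFun := fun x => ⟨consZero x, memℓp_gen (hasSum_norm_consZero x).summable⟩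
      map_add' := fun x y => by
        ext m
        cases m
        · exact (add_zero (0 : ℂ)).symm
        · rfl
      map_smul' := fun c x => by
        ext m
        cases m
        · exact (mul_zero c).symm
        · rfl } 1
    (fun x => by
      rw [one_mul]
      exact lp.norm_le_of_forall_sum_le (by norm_num) (norm_nonneg _) fun s =>
        sum_le_hasSum s (fun m _ => by positivity) (hasSum_norm_consZero x))

lemma shift_mul_rightShift : shift * rightShift = 1 := by
  ext x m
  rfl

lemma norm_rightShift_le : ‖rightShift‖ ≤ 1 := LinearMap.mkContinuous_norm_le _ zero_le_one _

lemma norm_shift_le : ‖shift‖ ≤ 1 := LinearMap.mkContinuous_norm_le _ zero_le_one _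

lemma isRightInvertible_shift : IsRightInvertible shift 1 := by
  have h0 : shift (lp.single 2 0 1) = 0 := shift_single_zero 1
  let v : shift.ker := ⟨lp.single 2 0 1, h0⟩
  have hv : v ≠ 0 := by
    intro e
    have h1 := congrArg (fun y : shift.ker => (y : ℓ²(ℕ, ℂ)) 0) e
    simp [v] at h1
  have hspan : ∀ w : shift.ker, ∃ c : ℂ, c • v = w := by
    intro w
    refine ⟨(w : ℓ²(ℕ, ℂ)) 0, ?_⟩
    apply Subtype.ext
    ext m
    cases m with
    | zero => simp [v]
    | succ m =>
      have h1 : shift (w : ℓ²(ℕ, ℂ)) = 0 := w.2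
      have h2 : (w : ℓ²(ℕ, ℂ)) (m + 1) = 0 := by
        rw [← shift_apply, h1]; rfl
      simp [v, h2]
  have hf := finrank_eq_one v hv hspan
  exact ⟨⟨rightShift, shift_mul_rightShift⟩, Module.finite_of_finrank_eq_succ hf, hf⟩

lemma isRightInvertible_of_isUnit {H : Type*} [NormedAddCommGroup H] [InnerProductSpace ℂ H]
    {F : H →L[ℂ] H} (h : IsUnit F) : IsRightInvertible F 0 := by
  obtain ⟨u, rfl⟩ := h
  exact IsRightInvertible.of_mul_eq_one u.mul_inv u.inv_mul

open Classical in
lemma isRightInvertible_shift_sub {l : ℂ} (hl : ‖l‖ ≠ 1) :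
    IsRightInvertible (shift - l • 1) (if ‖l‖ < 1 then 1 else 0) := by
  split_ifs with h
  · have h1 : shift - l • 1 = shift * (1 - l • rightShift) := by
      rw [mul_sub, mul_one, mul_smul_comm, shift_mul_rightShift]
    rw [h1]
    refine isRightInvertible_shift.mul (isRightInvertible_of_isUnit
      (isUnit_one_sub_of_norm_lt_one ?_))
    rw [norm_smul]
    exact (mul_le_of_le_one_right (norm_nonneg _) norm_rightShift_le).trans_lt h
  · have h' : 1 < ‖l‖ := lt_of_le_of_ne (not_lt.1 h) (Ne.symm hl)
    have hl0 : l ≠ 0 := by rintro rfl; simp at h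
    have h1 : shift - l • 1 = (-l) • (1 - l⁻¹ • shift) := by
      rw [smul_sub, smul_smul, neg_mul, mul_inv_cancel₀ hl0, neg_one_smul, neg_smul]
      abel
    rw [h1]
    refine isRightInvertible_of_isUnit ?_
    refine (isUnit_smul_iff (Units.mk0 (-l) (neg_ne_zero.2 hl0)) _).2
      (isUnit_one_sub_of_norm_lt_one ?_)
    rw [norm_smul, norm_inv]
    exact (mul_le_of_le_one_right (by positivity) norm_shift_le).trans_lt
      (inv_lt_one_of_one_lt₀ h')

lemma shiftPoly_eq_aeval {n : ℕ} (c : Fin (n + 1) → ℂ) :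
    shiftPoly c = aeval shift (polyOf c) := by
  simp only [shiftPoly, polyOf, map_sum, map_mul, aeval_C, map_pow, aeval_X]
  exact Finset.sum_congr rfl fun j _ => by rw [Algebra.smul_def]

open Classical in
lemma isRightInvertible_prod (Λ : Multiset ℂ) (h : ∀ l ∈ Λ, ‖l‖ ≠ 1) :
    IsRightInvertible (aeval shift (Λ.map fun l => X - C l).prod) (Λ.countP fun l => ‖l‖ < 1) := by
  induction Λ using Multiset.induction_on with
  | empty => simpa using isRightInvertible_of_isUnit isUnit_one
  | cons l Λ ih =>
    rw [Multiset.map_cons, Multiset.prod_cons, map_mul, Multiset.countP_cons, add_comm]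
    refine IsRightInvertible.mul ?_ (ih fun z hz => h z (Multiset.mem_cons_of_mem hz))
    have := isRightInvertible_shift_sub (h l (Multiset.mem_cons_self l Λ))
    rwa [map_sub, aeval_X, aeval_C, Algebra.algebraMap_eq_smul_one]

/-- A polynomial without roots on the circle gives a Fredholm operator, whose index is the number
of roots in the open disk. -/
lemma isFredholmOp_aeval_shift {p : ℂ[X]} (hp : p ≠ 0) (h : ∀ z : ℂ, ‖z‖ = 1 → eval z p ≠ 0) :
    IsFredholmOp (aeval shift p) ∧ fredholmIndex (aeval shift p) = (typeOf ℂ p).1 := by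
  classical
  have h1 := isRightInvertible_prod p.roots fun l hl e => h l e (isRoot_of_mem_roots hl)
  have h2 : IsRightInvertible (aeval shift (C p.leadingCoeff)) 0 := by
    refine isRightInvertible_of_isUnit ?_
    exact ((isUnit_C.2 (isUnit_iff_ne_zero.2 (leadingCoeff_ne_zero.2 hp))).map (aeval shift))
  have h3 := h2.mul h1
  rw [← map_mul, ← (IsAlgClosed.splits p).eq_prod_roots, zero_add] at h3
  convert h3.isFredholmOp using 3
  rw [typeOf, aroots_complex, typ]

/-- The eigenvector `(1, ζ, ζ², …)` of the shift with eigenvalue `ζ`. -/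
def geomVec (ζ : ℂ) (hζ : ‖ζ‖ < 1) : ℓ²(ℕ, ℂ) :=
  ⟨fun m => ζ ^ m, memℓp_gen (by
    have h : (fun m : ℕ => ‖ζ ^ m‖ ^ (2 : ENNReal).toReal) = fun m => (‖ζ‖ ^ 2) ^ m := by
      funext m
      simp [← pow_mul, mul_comm]
    rw [h]
    exact summable_geometric_of_lt_one (by positivity)
      (pow_lt_one₀ (norm_nonneg _) hζ two_ne_zero))⟩

lemma geomVec_apply (ζ : ℂ) (hζ : ‖ζ‖ < 1) (m : ℕ) : geomVec ζ hζ m = ζ ^ m := rfl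

lemma norm_sq_geomVec (ζ : ℂ) (hζ : ‖ζ‖ < 1) : ‖geomVec ζ hζ‖ ^ 2 = (1 - ‖ζ‖ ^ 2)⁻¹ := by
  have h1 := lp.hasSum_norm (p := 2) (by norm_num) (geomVec ζ hζ)
  have h2 : (fun m : ℕ => ‖geomVec ζ hζ m‖ ^ (2 : ENNReal).toReal) = fun m => (‖ζ‖ ^ 2) ^ m := by
    funext m
    simp [geomVec_apply, ← pow_mul, mul_comm]
  rw [h2] at h1
  have h3 := h1.unique (hasSum_geometric_of_lt_one (by positivity)
    (pow_lt_one₀ (norm_nonneg _) hζ two_ne_zero))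
  simpa using h3

lemma aeval_shift_geomVec (p : ℂ[X]) (ζ : ℂ) (hζ : ‖ζ‖ < 1) :
    aeval shift p (geomVec ζ hζ) = eval ζ p • geomVec ζ hζ := by
  have hX : shift (geomVec ζ hζ) = ζ • geomVec ζ hζ := by
    ext m
    simp [geomVec_apply, pow_succ, mul_comm]
  induction p using Polynomial.induction_on' with
  | add p q hp hq => rw [map_add, eval_add, add_smul, ← hp, ← hq]; rfl
  | monomial k a =>
    rw [aeval_monomial, eval_monomial, Algebra.algebraMap_eq_smul_one, smul_mul_assoc, one_mul,
      mul_smul]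
    change a • (shift ^ k) (geomVec ζ hζ) = _
    congr 1
    induction k with
    | zero => simp
    | succ k ih =>
      rw [pow_succ, mul_apply_eq_comp, hX, map_smul, ih, smul_smul, pow_succ']

/-- A Fredholm operator does not have approximate eigenvectors for `0` whose coordinates tend
to `0`. -/
lemma not_isFredholmOp_of_tendsto {F : ℓ²(ℕ, ℂ) →L[ℂ] ℓ²(ℕ, ℂ)} (x : ℕ → ℓ²(ℕ, ℂ))
    (hx : ∀ N, ‖x N‖ = 1) (hc : ∀ m, Tendsto (fun N => x N m) atTop (𝓝 0))
    (hF : Tendsto (fun N => F (x N)) atTop (𝓝 0)) : ¬ IsFredholmOp F := by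
  rintro ⟨B, -, hK⟩
  set K := 1 - B * F with hKdef
  obtain ⟨S, hS, hKS⟩ := IsCompactOperator.image_closedBall_subset_compact (f := K.toLinearMap) hK 1
  obtain ⟨y, -, φ, hφ, hy⟩ := hS.tendsto_subseq (x := fun N => K (x N)) fun N =>
    hKS ⟨x N, by simp [hx], rfl⟩
  have h1 : Tendsto (fun N => x (φ N)) atTop (𝓝 y) := by
    have h2 : ∀ N, x (φ N) = B (F (x (φ N))) + K (x (φ N)) := fun N => by
      change _ = B (F (x (φ N))) + (x (φ N) - B (F (x (φ N))))
      abel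
    have h3 : Tendsto (fun N => B (F (x (φ N)))) atTop (𝓝 (B 0)) :=
      (B.continuous.tendsto 0).comp (hF.comp hφ.tendsto_atTop)
    rw [map_zero] at h3
    have h4 := h3.add hy
    rw [zero_add] at h4
    exact h4.congr fun N => (h2 N).symm
  have hy1 : ‖y‖ = 1 := by
    refine tendsto_nhds_unique h1.norm ?_
    simp only [hx]
    exact tendsto_const_nhds
  have hy0 : y = 0 := by
    ext m
    have h2 : Tendsto (fun N => x (φ N) m) atTop (𝓝 (y m)) := by
      rw [tendsto_iff_norm_sub_tendsto_zero] at h1 ⊢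
      refine squeeze_zero (fun _ => norm_nonneg _) (fun N => ?_) h1
      exact lp.norm_apply_le_norm two_ne_zero (x (φ N) - y) m
    exact tendsto_nhds_unique h2 ((hc m).comp hφ.tendsto_atTop)
  rw [hy0, norm_zero] at hy1
  exact zero_ne_one hy1

/-- The normalized vectors `(1, ζ, ζ², …)`, with `ζ` tending to a root of `p` on the circle, are
approximate eigenvectors. -/
lemma not_isFredholmOp_aeval_shift {p : ℂ[X]} {z : ℂ} (hz : ‖z‖ = 1) (h : eval z p = 0) :
    ¬ IsFredholmOp (aeval shift p) := by
  let r : ℕ → ℝ := fun N => 1 - 1 / ((N : ℝ) + 1)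
  have hr0 : ∀ N, 0 ≤ r N := fun N => by
    have h1 : (0 : ℝ) < (N : ℝ) + 1 := by positivity
    have h2 : 1 / ((N : ℝ) + 1) ≤ 1 := by rw [div_le_one h1]; linarith [Nat.cast_nonneg (α := ℝ) N]
    simp only [r]; linarith
  have hr1 : ∀ N, r N < 1 := fun N => by
    have h1 : (0 : ℝ) < 1 / ((N : ℝ) + 1) := by positivity
    simp only [r]; linarith
  have hr : Tendsto r atTop (𝓝 1) := by
    have h1 := (tendsto_one_div_add_atTop_nhds_zero_nat (𝕜 := ℝ)).const_sub 1
    rwa [sub_zero] at h1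
  let ζ : ℕ → ℂ := fun N => r N * z
  have hζn : ∀ N, ‖ζ N‖ = r N := fun N => by
    simp only [ζ, norm_mul, hz, mul_one, Complex.norm_real, Real.norm_eq_abs]
    exact abs_of_nonneg (hr0 N)
  have hζ1 : ∀ N, ‖ζ N‖ < 1 := fun N => (hζn N).trans_lt (hr1 N)
  have hζ : Tendsto ζ atTop (𝓝 z) := by
    have h1 := ((Complex.continuous_ofReal.tendsto 1).comp hr).mul_const z
    simpa using h1
  let v : ℕ → ℓ²(ℕ, ℂ) := fun N => geomVec (ζ N) (hζ1 N)
  have hvn : ∀ N, ‖v N‖ ^ 2 = (1 - r N ^ 2)⁻¹ := fun N => by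
    rw [← hζn N]; exact norm_sq_geomVec _ _
  have hpos : ∀ N, 0 < 1 - r N ^ 2 := fun N => by nlinarith [hr0 N, hr1 N]
  have hv0 : ∀ N, ‖v N‖ ≠ 0 := fun N e => by
    have h1 := hvn N
    rw [e] at h1
    have := inv_pos.2 (hpos N)
    rw [← h1] at this
    simp at this
  have hvi : Tendsto (fun N => ‖v N‖⁻¹) atTop (𝓝 0) := by
    have h1 : (fun N => ‖v N‖⁻¹) = fun N => Real.sqrt (1 - r N ^ 2) := by
      funext N
      rw [eq_comm, Real.sqrt_eq_iff_eq_sq (hpos N).le (by positivity), inv_pow, hvn, inv_inv]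
    rw [h1]
    have h2 : Tendsto (fun N => Real.sqrt (1 - r N ^ 2)) atTop (𝓝 (Real.sqrt (1 - 1 ^ 2))) :=
      (Real.continuous_sqrt.tendsto _).comp ((hr.pow 2).const_sub 1)
    simpa using h2
  refine not_isFredholmOp_of_tendsto (fun N => ((‖v N‖⁻¹ : ℝ) : ℂ) • v N) ?_ ?_ ?_
  · intro N
    rw [norm_smul, Complex.norm_real, norm_inv, norm_norm, inv_mul_cancel₀ (hv0 N)]
  · intro m
    have h1 : ∀ N, (((‖v N‖⁻¹ : ℝ) : ℂ) • v N) m = ((‖v N‖⁻¹ : ℝ) : ℂ) * ζ N ^ m := fun N => rfl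
    simp only [h1]
    have h2 := ((Complex.continuous_ofReal.tendsto 0).comp hvi).mul (hζ.pow m)
    simpa using h2
  · have h1 : ∀ N, aeval shift p (((‖v N‖⁻¹ : ℝ) : ℂ) • v N) =
        eval (ζ N) p • (((‖v N‖⁻¹ : ℝ) : ℂ) • v N) := fun N => by
      rw [map_smul, aeval_shift_geomVec, smul_comm]
    simp only [h1]
    rw [tendsto_zero_iff_norm_tendsto_zero]
    have h2 : ∀ N, ‖eval (ζ N) p • (((‖v N‖⁻¹ : ℝ) : ℂ) • v N)‖ = ‖eval (ζ N) p‖ := fun N => by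
      rw [norm_smul, norm_smul, Complex.norm_real, norm_inv, norm_norm, inv_mul_cancel₀ (hv0 N),
        mul_one]
    simp only [h2]
    have h3 := ((p.continuous.tendsto z).comp hζ).norm
    rw [h, norm_zero] at h3
    exact h3

lemma isFredholmOp_aeval_shift_iff {p : ℂ[X]} :
    IsFredholmOp (aeval shift p) ↔ ∀ z : ℂ, ‖z‖ = 1 → eval z p ≠ 0 := by
  constructor
  · exact fun h z hz h0 => not_isFredholmOp_aeval_shift hz h0 h
  · intro h
    refine (isFredholmOp_aeval_shift ?_ h).1
    rintro rfl
    exact h 1 norm_one eval_zero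

end Shift

/-! ### The phases as strata -/

section Phases

variable {K : Type} [RCLike K] [NormedAlgebra K ℂ] {n : ℕ}

lemma shiftPoly_algebraMap (c : Fin (n + 1) → K) :
    shiftPoly (fun j => algebraMap K ℂ (c j)) =
      aeval shift ((polyOf c).map (algebraMap K ℂ)) := by
  rw [shiftPoly_eq_aeval, map_polyOf]

lemma isFredholmOp_shiftPoly_iff (c : Fin (n + 1) → K) :
    IsFredholmOp (shiftPoly fun j => algebraMap K ℂ (c j)) ↔
      ∀ z : ℂ, ‖z‖ = 1 → aeval z (polyOf c) ≠ 0 := by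
  rw [shiftPoly_algebraMap, isFredholmOp_aeval_shift_iff]
  simp only [eval_map_algebraMap]

variable [CircleModel K]

lemma fredholmIndex_shiftPoly {c : Fin (n + 1) → K}
    (h : ∀ z : ℂ, ‖z‖ = 1 → aeval z (polyOf c) ≠ 0) :
    fredholmIndex (shiftPoly fun j => algebraMap K ℂ (c j)) = (typeOf K (polyOf c)).1 := by
  have h0 : polyOf c ≠ 0 := by
    intro e
    exact h 1 norm_one (by rw [e, map_zero])
  rw [shiftPoly_algebraMap, (isFredholmOp_aeval_shift ((Polynomial.map_ne_zero_iff
    (algebraMap K ℂ).injective).2 h0) (by simpa only [eval_map_algebraMap] using h)).2,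
    typeOf, typeOf, aroots_complex]
  rfl

/-- The Fredholm operators of index `i` form the stratum of the polynomials with `i` roots in the
open disk and none on the circle. -/
lemma mem_stratum_zero {c : Fin (n + 1) → K} {i : ℕ} : c ∈ stratum K n (i, 0) ↔
    IsFredholmOp (shiftPoly fun j => algebraMap K ℂ (c j)) ∧
      fredholmIndex (shiftPoly fun j => algebraMap K ℂ (c j)) = i := by
  rw [isFredholmOp_shiftPoly_iff]
  constructor
  · rintro ⟨h0, h⟩
    have h1 := (typeOf_snd_eq_zero (fun e => h0 (polyOf_eq_zero.1 e))).1 (by rw [h])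
    refine ⟨h1, ?_⟩
    rw [fredholmIndex_shiftPoly h1, h]
  · rintro ⟨h1, h2⟩
    have h0 : polyOf c ≠ 0 := by
      intro e
      exact h1 1 norm_one (by rw [e, map_zero])
    rw [fredholmIndex_shiftPoly h1] at h2
    exact ⟨fun e => h0 (polyOf_eq_zero.2 e), Prod.ext (by exact_mod_cast h2)
      ((typeOf_snd_eq_zero h0).2 h1)⟩

lemma fredholmIndex_shiftPoly_nonneg {c : Fin (n + 1) → K}
    (h : IsFredholmOp (shiftPoly fun j => algebraMap K ℂ (c j))) :
    0 ≤ fredholmIndex (shiftPoly fun j => algebraMap K ℂ (c j)) := by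
  rw [fredholmIndex_shiftPoly ((isFredholmOp_shiftPoly_iff c).1 h)]
  exact Nat.cast_nonneg _

/-- The index is at most the formal degree. -/
lemma stratum_eq_empty {i : ℕ} (hi : n < i) : stratum K n (i, 0) = ∅ := by
  refine Set.eq_empty_of_forall_notMem fun x hx => ?_
  have h1 := add_sum_le_natDegree (fun e => hx.1 (polyOf_eq_zero.1 e) : polyOf x ≠ 0)
  have h2 := natDegree_polyOf_le x
  rw [hx.2] at h1
  simp only [Multiset.map_zero, Multiset.sum_zero] at h1
  omega

lemma complexPhase_natCast (n i : ℕ) : complexPhase n i = stratum ℂ n (i, 0) := by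
  ext c
  exact (mem_stratum_zero (K := ℂ)).symm

lemma realPhase_natCast (n i : ℕ) : realPhase n i = stratum ℝ n (i, 0) := by
  ext c
  exact (mem_stratum_zero (K := ℝ)).symm

lemma complexPhase_of_neg (n : ℕ) (i : ℤ) (hi : i < 0) : complexPhase n i = ∅ := by
  refine Set.eq_empty_of_forall_notMem fun c hc => ?_
  have h1 := fredholmIndex_shiftPoly_nonneg (K := ℂ) hc.1
  exact absurd (hc.2 ▸ h1) (not_le.2 hi)

lemma realPhase_of_neg (n : ℕ) (i : ℤ) (hi : i < 0) : realPhase n i = ∅ := by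
  refine Set.eq_empty_of_forall_notMem fun c hc => ?_
  have h1 := fredholmIndex_shiftPoly_nonneg (K := ℝ) hc.1
  exact absurd (hc.2 ▸ h1) (not_le.2 hi)

lemma frontier_complexPhase (n k i : ℕ) :
    frontier (complexPhase n i) ∩ frontier (complexPhase n (i + k)) = commonBoundary ℂ n k i := by
  rw [← Nat.cast_add, complexPhase_natCast, complexPhase_natCast]
  rfl

lemma frontier_realPhase (n k i : ℕ) :
    frontier (realPhase n i) ∩ frontier (realPhase n (i + k)) = commonBoundary ℝ n k i := by
  rw [← Nat.cast_add, realPhase_natCast, realPhase_natCast]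
  rfl

lemma jumpLocus_complexPhase (n k : ℕ) :
    jumpLocus (complexPhase n) k = ⋃ i, commonBoundary ℂ n k i := by
  rw [jumpLocus_eq_iUnion _ (complexPhase_of_neg n)]
  simp only [frontier_complexPhase]

lemma jumpLocus_realPhase (n k : ℕ) :
    jumpLocus (realPhase n) k = ⋃ i, commonBoundary ℝ n k i := by
  rw [jumpLocus_eq_iUnion _ (realPhase_of_neg n)]
  simp only [frontier_realPhase]

end Phases

/-! ### Almost every operator is Fredholm -/

section AlmostEverywhere

open MeasureTheory

/-- The coefficient vector of `p (s X)`, in terms of that of `p`. -/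
def dilate (K : Type) [RCLike K] (n : ℕ) (s : ℝ) (c : Fin (n + 1) → K) : Fin (n + 1) → K :=
  fun j => s ^ (j : ℕ) • c j

lemma continuous_dilate {K : Type} [RCLike K] {n : ℕ} :
    Continuous fun x : ℝ × (Fin (n + 1) → K) => dilate K n x.1 x.2 := by
  unfold dilate
  fun_prop

variable {K : Type} [RCLike K] [NormedAlgebra K ℂ] {n : ℕ}

variable (K) in
/-- The coefficient vectors of the polynomials with a root on the unit circle. -/
def circleRootSet (n : ℕ) : Set (Fin (n + 1) → K) :=
  {c | ∃ z : ℂ, ‖z‖ = 1 ∧ aeval z (polyOf c) = 0}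

lemma isClosed_circleRootSet : IsClosed (circleRootSet K n) := by
  rw [← isOpen_compl_iff, isOpen_iff_mem_nhds]
  intro c hc
  have h := eventually_forall_ne_zero isCompact_circle
    (continuous_aeval_polyOf (K := K) (m := n + 1)) (x₀ := c) fun z hz e => hc ⟨z, hz, e⟩
  filter_upwards [h] with y hy
  rintro ⟨z, hz, e⟩
  exact hy z hz e

lemma aeval_dilate [IsScalarTower ℝ K ℂ] (s : ℝ) (c : Fin (n + 1) → K) (z : ℂ) :
    aeval z (polyOf (dilate K n s c)) = aeval (s * z) (polyOf c) := by
  simp only [aeval_polyOf, dilate]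
  refine Finset.sum_congr rfl fun j _ => ?_
  have h : algebraMap K ℂ (s ^ (j : ℕ) • c j) = s ^ (j : ℕ) • algebraMap K ℂ (c j) := by
    rw [Algebra.algebraMap_eq_smul_one, smul_assoc, ← Algebra.algebraMap_eq_smul_one]
  rw [h, Complex.real_smul, mul_pow]
  push_cast
  ring

/-- Only finitely many dilations of a nonzero polynomial have a root on the circle. -/
lemma finite_setOf_dilate_mem [IsScalarTower ℝ K ℂ] {c : Fin (n + 1) → K} (hc : c ≠ 0) :
    {s : ℝ | s ∈ Set.Ioo (1 : ℝ) 2 ∧ dilate K n s c ∈ circleRootSet K n}.Finite := by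
  classical
  have hp : polyOf c ≠ 0 := fun e => hc (polyOf_eq_zero.1 e)
  refine (((polyOf c).aroots ℂ).toFinset.image fun w => ‖w‖).finite_toSet.subset ?_
  rintro s ⟨hs, z, hz, h⟩
  rw [aeval_dilate] at h
  rw [Finset.mem_coe, Finset.mem_image]
  refine ⟨s * z, Multiset.mem_toFinset.2 (mem_aroots.2 ⟨hp, h⟩), ?_⟩
  rw [norm_mul, hz, mul_one, Complex.norm_real, Real.norm_eq_abs, abs_of_pos (by linarith [hs.1])]

variable (K) in
/-- `dilate` as a linear automorphism. -/
def dilateEquiv (n : ℕ) {s : ℝ} (hs : s ≠ 0) : (Fin (n + 1) → K) ≃L[ℝ] (Fin (n + 1) → K) :=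
  (LinearEquiv.piCongrRight fun j : Fin (n + 1) =>
    LinearEquiv.smulOfNeZero ℝ K (s ^ (j : ℕ)) (pow_ne_zero _ hs)).toContinuousLinearEquiv

/-- By Fubini, since the polynomials with a circle root meet each orbit of dilations in a null
set. -/
theorem ae_forall_aeval_ne_zero [IsScalarTower ℝ K ℂ]
    [MeasurableSpace (Fin (n + 1) → K)] [BorelSpace (Fin (n + 1) → K)]
    (μ : Measure (Fin (n + 1) → K)) [μ.IsAddHaarMeasure] [SigmaFinite μ] :
    ∀ᵐ c ∂μ, ∀ z : ℂ, ‖z‖ = 1 → aeval z (polyOf c) ≠ 0 := by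
  have : Nontrivial (Fin (n + 1) → K) := inferInstance
  have : NullSingletonClass μ := inferInstance
  let ν : Measure ℝ := volume.restrict (Set.Ioo 1 2)
  have hmeas : MeasurableSet {x : ℝ × (Fin (n + 1) → K) |
      dilate K n x.1 x.2 ∉ circleRootSet K n} :=
    ((isClosed_circleRootSet (K := K)).preimage continuous_dilate).measurableSet.compl
  have h1 : ∀ᵐ c ∂μ, ∀ᵐ s ∂ν, dilate K n s c ∉ circleRootSet K n := by
    have h0 : ∀ᵐ c ∂μ, c ≠ 0 := by
      rw [ae_iff]
      simp
    filter_upwards [h0] with c hc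
    rw [ae_restrict_iff' measurableSet_Ioo, ae_iff]
    refine measure_mono_null ?_ ((finite_setOf_dilate_mem hc).measure_zero volume)
    intro s hs
    simpa [and_assoc] using hs
  rw [← Measure.ae_ae_comm hmeas] at h1
  have hν : ν ≠ 0 := by
    intro e
    have h2 := congrArg (fun m : Measure ℝ => m Set.univ) e
    norm_num [ν, Real.volume_Ioo] at h2
  have hνne : NeZero ν := ⟨hν⟩
  have h2 : ∀ᵐ s ∂ν, s ∈ Set.Ioo (1 : ℝ) 2 := ae_restrict_mem measurableSet_Ioo
  obtain ⟨s, hs, hs2⟩ := (h1.and h2).exists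
  have hs0 : s ≠ 0 := by linarith [hs2.1]
  have h3 : μ ((dilateEquiv K n hs0) ⁻¹' circleRootSet K n) = 0 := by
    rw [ae_iff] at hs
    refine measure_mono_null (fun c hc => ?_) hs
    exact not_not.2 hc
  have h4 := Measure.addHaar_preimage_continuousLinearEquiv μ (dilateEquiv K n hs0).symm
    ((dilateEquiv K n hs0) ⁻¹' circleRootSet K n)
  rw [h3, mul_zero, ← Set.preimage_comp, ContinuousLinearEquiv.self_comp_symm,
    Set.preimage_id] at h4
  rw [ae_iff]
  refine measure_mono_null ?_ h4
  intro c hc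
  simpa [circleRootSet] using hc

lemma ae_isFredholmOp [IsScalarTower ℝ K ℂ]
    [MeasurableSpace (Fin (n + 1) → K)] [BorelSpace (Fin (n + 1) → K)]
    (μ : Measure (Fin (n + 1) → K)) [μ.IsAddHaarMeasure] [SigmaFinite μ] :
    ∀ᵐ c ∂μ, IsFredholmOp (shiftPoly fun j => algebraMap K ℂ (c j)) :=
  (ae_forall_aeval_ne_zero μ).mono fun c => (isFredholmOp_shiftPoly_iff c).2

end AlmostEverywhere

/-! ### The codimensions of the jump loci -/

section Final

/-- There are arbitrarily many points on the open upper half circle. -/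
lemma exists_finset_rep_real_of_kind_zero (m : ℕ) :
    ∃ s : Finset ℂ, (∀ z ∈ s, z ∈ CircleModel.rep ℝ ∧ realKind z = 0) ∧ s.card = m := by
  classical
  let t : ℕ → ℝ := fun j => 1 / ((j : ℝ) + 2)
  have ht : ∀ j, t j ∈ Set.Ioo (-1 : ℝ) 1 := fun j => by
    have h1 : (0 : ℝ) < (j : ℝ) + 2 := by positivity
    have h2 : 0 < t j := by positivity
    refine ⟨by linarith, ?_⟩
    simp only [t]
    rw [div_lt_one h1]
    linarith [Nat.cast_nonneg (α := ℝ) j]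
  have hinj : Function.Injective fun j => upperPoint (t j) := by
    intro a b hab
    have h1 : t a = t b := congrArg Complex.re hab
    simp only [t, one_div, inv_inj, add_left_inj, Nat.cast_inj] at h1
    exact h1
  refine ⟨(Finset.range m).image fun j => upperPoint (t j), fun z hz => ?_, ?_⟩
  · obtain ⟨j, -, rfl⟩ := Finset.mem_image.1 hz
    exact ⟨upperPoint_mem_rep (ht j), realKind_upperPoint (ht j)⟩
  · rw [Finset.card_image_of_injective _ hinj, Finset.card_range]

lemma nonempty_commonBoundary_complex {n k : ℕ} (i : ℕ) (hk : 1 ≤ k) (hn : i + k ≤ n) :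
    (commonBoundary ℂ n k i).Nonempty := by
  obtain ⟨s, hs, hc⟩ := exists_finset_rep_real_of_kind_zero k
  obtain ⟨x, hx, -⟩ := exists_mem_commonBoundary (K := ℂ) hk hn (s := s)
    (fun z hz => mem_rep_complex.2 (hs z hz).1.1) (by
      change ∑ z ∈ s, 1 = k
      rw [Finset.sum_const, smul_eq_mul, mul_one, hc])
  exact ⟨x, hx⟩

lemma le_indexCodim_complex {n k i : ℕ} (hk : k ≤ n) {x : Fin (n + 1) → ℂ}
    (hx : x ∈ commonBoundary ℂ n k i) : k ≤ indexCodim ℂ n (stratumIndex x) := by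
  have h := le_indexCodim_of_mem_commonBoundary hk hx
  rw [Complex.finrank_real_complex] at h
  omega

lemma hasRealCodim_commonBoundary {n k i : ℕ} (hk : 1 ≤ k) (hn : i + k ≤ n) :
    HasRealCodim (commonBoundary ℂ n k i) k :=
  (isStratumUnion_commonBoundary n k i).hasRealCodim (nonempty_commonBoundary_complex i hk hn)
    (fun _ hx => le_indexCodim_complex (by omega) hx) (commonBoundary_subset_closure hk hn)

lemma commonBoundary_eq_empty {n k i : ℕ} (h : n < i + k) : commonBoundary ℂ n k i = ∅ := by
  rw [commonBoundary, stratum_eq_empty h, frontier_empty, Set.inter_empty]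

lemma hasRealCodim_iUnion_commonBoundary {n k : ℕ} (hk : 1 ≤ k) (hn : k ≤ n) :
    HasRealCodim (⋃ i, commonBoundary ℂ n k i) k := by
  refine (isStratumUnion_iUnion fun i => isStratumUnion_commonBoundary n k i).hasRealCodim
    ?_ ?_ ?_
  · obtain ⟨x, hx⟩ := nonempty_commonBoundary_complex 0 hk (by omega : 0 + k ≤ n)
    exact ⟨x, Set.mem_iUnion.2 ⟨0, hx⟩⟩
  · intro x hx
    obtain ⟨i, hi⟩ := Set.mem_iUnion.1 hx
    exact le_indexCodim_complex hn hi
  · refine Set.iUnion_subset fun i => ?_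
    rcases le_or_gt (i + k) n with h | h
    · refine (commonBoundary_subset_closure hk h).trans (closure_mono ?_)
      rintro x ⟨hx, hxc⟩
      exact ⟨Set.mem_iUnion.2 ⟨i, hx⟩, hxc⟩
    · rw [commonBoundary_eq_empty h]
      exact Set.empty_subset _

/-- A set of `⌊(k + 1) / 2⌋` orbits of total degree `k`: pairs of conjugate points, and the
point `1` if `k` is odd. -/
lemma exists_finset_rep_real (k : ℕ) : ∃ s : Finset ℂ, (∀ z ∈ s, z ∈ CircleModel.rep ℝ) ∧
    ∑ z ∈ s, CircleModel.deg ℝ (CircleModel.kind ℝ z) = k ∧ s.card = (k + 1) / 2 := by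
  classical
  obtain ⟨s, hs, hcard⟩ := exists_finset_rep_real_of_kind_zero (k / 2)
  have hsum : ∑ z ∈ s, CircleModel.deg ℝ (CircleModel.kind ℝ z) = 2 * (k / 2) := by
    have h1 : ∀ z ∈ s, CircleModel.deg ℝ (CircleModel.kind ℝ z) = 2 := fun z hz => by
      change realDeg (realKind z) = 2
      rw [(hs z hz).2]
      rfl
    rw [Finset.sum_congr rfl h1, Finset.sum_const, hcard, smul_eq_mul, mul_comm]
  rcases Nat.even_or_odd k with hk | hk
  · obtain ⟨m, rfl⟩ := hk
    exact ⟨s, fun z hz => (hs z hz).1, by rw [hsum]; omega, by rw [hcard]; omega⟩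
  · obtain ⟨m, rfl⟩ := hk
    have h1 : (1 : ℂ) ∉ s := fun h => by
      have := (hs 1 h).2
      rw [realKind_one] at this
      exact absurd this (by decide)
    refine ⟨insert 1 s, ?_, ?_, ?_⟩
    · intro z hz
      rcases Finset.mem_insert.1 hz with rfl | hz
      · exact ⟨norm_one, le_of_eq Complex.one_im.symm⟩
      · exact (hs z hz).1
    · rw [Finset.sum_insert h1, hsum]
      change realDeg (realKind 1) + _ = _
      rw [realKind_one]
      change 1 + _ = _
      omega
    · rw [Finset.card_insert_of_notMem h1, hcard]
      omega

lemma isStratified_commonBoundary_real {n k i : ℕ} (hk : 1 ≤ k) (hn : i + k ≤ n) :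
    IsStratifiedWithLargestCodim (commonBoundary ℝ n k i) ((k + 1) / 2) := by
  obtain ⟨s, hs, hsk, hc⟩ := exists_finset_rep_real k
  have h := isStratified_commonBoundary hk hn hs hsk (by rw [hc, Module.finrank_self, one_mul])
  rwa [Module.finrank_self, one_mul] at h

lemma isStratified_iUnion_commonBoundary_real {n k : ℕ} (hk : 1 ≤ k) (hn : k ≤ n) :
    IsStratifiedWithLargestCodim (⋃ i, commonBoundary ℝ n k i) ((k + 1) / 2) := by
  obtain ⟨s, hs, hsk, hc⟩ := exists_finset_rep_real k
  have h := isStratified_iUnion_commonBoundary hk hn hs hsk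
    (by rw [hc, Module.finrank_self, one_mul])
  rwa [Module.finrank_self, one_mul] at h

end Final

end ShiftPhase

end

theorem mainTheorem4 (n : ℕ) :
    -- complex coefficients
    ((∀ᵐ c : Fin (n + 1) → ℂ, ShiftPhase.IsFredholmOp (ShiftPhase.shiftPoly c)) ∧
      ∀ k : ℕ, 1 ≤ k → k ≤ n →
        ShiftPhase.HasRealCodim (ShiftPhase.jumpLocus (ShiftPhase.complexPhase n) k) k ∧
        ∀ i : ℕ, i + k ≤ n →
          ShiftPhase.HasRealCodim
            (frontier (ShiftPhase.complexPhase n i) ∩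
              frontier (ShiftPhase.complexPhase n (i + k))) k) ∧
    -- real coefficients
    ((∀ᵐ c : Fin (n + 1) → ℝ,
        ShiftPhase.IsFredholmOp (ShiftPhase.shiftPoly fun j => (c j : ℂ))) ∧
      ∀ k : ℕ, 1 ≤ k → k ≤ n →
        ShiftPhase.IsStratifiedWithLargestCodim
          (ShiftPhase.jumpLocus (ShiftPhase.realPhase n) k) ((k + 1) / 2) ∧
        ∀ i : ℕ, i + k ≤ n →
          ShiftPhase.IsStratifiedWithLargestCodim
            (frontier (ShiftPhase.realPhase n i) ∩
              frontier (ShiftPhase.realPhase n (i + k))) ((k + 1) / 2)) := by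
  refine ⟨⟨ShiftPhase.ae_isFredholmOp (K := ℂ) MeasureTheory.volume, fun k hk hn => ⟨?_, ?_⟩⟩,
    ShiftPhase.ae_isFredholmOp (K := ℝ) MeasureTheory.volume, fun k hk hn => ⟨?_, ?_⟩⟩
  · rw [ShiftPhase.jumpLocus_complexPhase]
    exact ShiftPhase.hasRealCodim_iUnion_commonBoundary hk hn
  · intro i hi
    rw [ShiftPhase.frontier_complexPhase]
    exact ShiftPhase.hasRealCodim_commonBoundary hk hi
  · rw [ShiftPhase.jumpLocus_realPhase]
    exact ShiftPhase.isStratified_iUnion_commonBoundary_real hk hn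
  · intro i hi
    rw [ShiftPhase.frontier_realPhase]
    exact ShiftPhase.isStratified_commonBoundary_real hk hi
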